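/- Take as tiles closed rhombi in the Euclidean plane with unit side length and alternate angles $60^\circ$ and $120^\circ$, in any position and orientation. Let $\mathcal T$ be a finite set of at least two tiles such that any two distinct tiles of $\mathcal T$ are disjoint, or meet exactly in a common vertex, or meet exactly in a common side (in the last case they are called adjacent). A run of $\mathcal T$ is a maximal collection of at least two tiles of $\mathcal T$ that are joined successively through common sides all of which are parallel to one another; its length is the number of its tiles. For an integer $\kappa\ge 2$, call $\mathcal T$ a $\kappa$-doku tiling if (1) any two tiles of $\mathcal T$ are joined by a sequence of tiles of $\mathcal T$ in which consecutive tiles are adjacent; (2) after the removal of any one tile, any two of the remaining tiles are still joined by a sequence of remaining tiles in which consecutive tiles intersect (possibly only in a vertex); (3) every run of $\mathcal T$ has length exactly $\kappa$; (4) $\mathcal T$ has no holes, i.e. the complement in the plane of the union of its tiles is connected. Theorem. Let $\kappa\ge 5$. Every $\kappa$-doku tiling with $\tau$ tiles and $\rho$ runs satisfies \[ \max\left(\left\lceil \frac{3(\kappa^2-1)}{4}\right\rceil,\ \left\lceil\frac{\kappa\rho}{2}\right\rceil\right)\ \le\ \tau\ \le\ \left\lfloor\frac{(\kappa+1)\rho+3}{2}\right\rfloor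 . \] -/

import Mathlib

namespace KDoku

/-- The unit complex number of argument `60°`; multiplication by it turns a vector by `60°`. -/
noncomputable def omega : ℂ := ⟨1 / 2, Real.sqrt 3 / 2⟩

/-- The closed rhombus with a vertex `p` from which its two sides `u` and `omega * u` emanate.
For `‖u‖ = 1` it has unit sides and alternate angles `60°` (at `p`) and `120°`. The same set is
also `rhombus (p + u + omega * u) (-u)`. -/
noncomputable def rhombus (p u : ℂ) : Set ℂ :=
  {z | ∃ s ∈ Set.Icc (0 : ℝ) 1, ∃ t ∈ Set.Icc (0 : ℝ) 1,
    z = p + (s : ℂ) * u + (t : ℂ) * (omega * u)}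

/-- A tile: a unit rhombus with alternate angles `60°` and `120°`, anywhere in the plane `ℂ`
and in any orientation. -/
def IsTile (A : Set ℂ) : Prop :=
  ∃ p u : ℂ, ‖u‖ = 1 ∧ A = rhombus p u

/-- `z` is one of the four vertices of the tile `A`. -/
def IsVertex (A : Set ℂ) (z : ℂ) : Prop :=
  ∃ p u : ℂ, ‖u‖ = 1 ∧ A = rhombus p u ∧
    (z = p ∨ z = p + u ∨ z = p + omega * u ∨ z = p + u + omega * u)

/-- The segment from `a` to `a + v` is one of the four sides of the tile `A`. As `(p, u)` runs
through the two descriptions of `A`, every side is obtained with both orientations, i.e.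
both as `(a, v)` and as `(a + v, -v)`. -/
def IsSide (A : Set ℂ) (a v : ℂ) : Prop :=
  ∃ p u : ℂ, ‖u‖ = 1 ∧ A = rhombus p u ∧
    ((a = p ∧ v = u) ∨ (a = p + omega * u ∧ v = u) ∨
      (a = p ∧ v = omega * u) ∨ (a = p + u ∧ v = omega * u))

/-- The tiles `A` and `B` have a common side that is parallel to the vector `v`. -/
def ShareSide (v : ℂ) (A B : Set ℂ) : Prop :=
  ∃ a : ℂ, IsSide A a v ∧ IsSide B a v

/-- Adjacency: two different tiles that have a side in common. Restricted to the tiles of a tiling,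
this is its dual graph. -/
def adjacencyGraph : SimpleGraph (Set ℂ) where
  Adj A B := A ≠ B ∧ ∃ v, ShareSide v A B
  symm := ⟨fun _ _ h => ⟨h.1.symm, h.2.imp fun _ hv => hv.imp fun _ ha => ha.symm⟩⟩
  loopless := ⟨fun _ h => h.1 rfl⟩

/-- Neighbours: two different tiles that meet, in a side or merely in a vertex. Restricted to the
tiles of a tiling, this is its neighbour dual graph (without the weights). -/
def neighbourGraph : SimpleGraph (Set ℂ) where
  Adj A B := A ≠ B ∧ (A ∩ B).Nonempty
  symm := ⟨fun A B h => ⟨h.1.symm, by rw [Set.inter_comm]; exact h.2⟩⟩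
  loopless := ⟨fun _ h => h.1 rfl⟩

/-- Two different tiles that have a common side parallel to `v`. -/
def parallelGraph (v : ℂ) : SimpleGraph (Set ℂ) where
  Adj A B := A ≠ B ∧ ShareSide v A B
  symm := ⟨fun _ _ h => ⟨h.1.symm, h.2.imp fun _ ha => ha.symm⟩⟩
  loopless := ⟨fun _ h => h.1 rfl⟩

/-- A run of `T`, as the set of its tiles: a maximal collection of at least two tiles of `T` that
are joined successively through common sides which are all parallel to one direction `v`. -/
def IsRun (T : Finset (Set ℂ)) (R : Set (Set ℂ)) : Prop :=
  R.Nontrivial ∧ ∃ (v : ℂ) (c : ((parallelGraph v).induce (T : Set (Set ℂ))).ConnectedComponent),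
    R = Subtype.val '' c.supp

/-- The number of runs of `T`. -/
noncomputable def numRuns (T : Finset (Set ℂ)) : ℕ :=
  {R : Set (Set ℂ) | IsRun T R}.ncard

/-- A `κ`-doku tiling (without holes), as the finite set of its tiles. -/
structure IsDokuTiling (κ : ℕ) (T : Finset (Set ℂ)) : Prop where
  /-- All pieces are rhombic tiles. -/
  isTile : ∀ A ∈ T, IsTile A
  /-- There is more than one tile. -/
  one_lt_card : 1 < T.card
  /-- The tiling is connected through common sides. -/
  edge_connected : (adjacencyGraph.induce (T : Set (Set ℂ))).Connected
  /-- Two tiles are disjoint, or meet exactly in a common vertex, or exactly in a common side. -/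
  meet : ∀ A ∈ T, ∀ B ∈ T, A ≠ B →
    A ∩ B = ∅ ∨
    (∃ z, IsVertex A z ∧ IsVertex B z ∧ A ∩ B = {z}) ∨
    (∃ a v, IsSide A a v ∧ IsSide B a v ∧ A ∩ B = segment ℝ a (a + v))
  /-- Removing one tile does not disconnect the tiling, where connection by just a vertex is
  allowed after the removal. -/
  remove_connected : ∀ A ∈ T, (neighbourGraph.induce ((T : Set (Set ℂ)) \ {A})).Preconnected
  /-- All runs consist of exactly `κ` tiles. -/
  run_length : ∀ R : Set (Set ℂ), IsRun T R → R.ncard = κ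
  /-- There are no holes: the part of the plane that is not covered is connected. -/
  no_holes : IsConnected (⋃ A ∈ T, A)ᶜ

end KDoku

/-! Adjacency forces all tiles into one triangular lattice, where a tile is a pair of triangles
glued along its short diagonal. Passing from a side of a tile to the opposite side and on into the
next tile sorts the sides into strips. A strip of at least two tiles is a run, so every strip has
length `κ` or 1. Call a tile with exactly one shared side a leaf, and let n be the number of leaves.
Since no tile is a cut tile and there are no holes, every strip of length 1 crosses a leaf
(`leafCond`). Every tile lies on two strips, so 2τ = κρ + n (`IsPatch.counts`), which contains κρ ≤
2τ.

The upper bound amounts to n ≤ ρ + 3 (`IsPatch.tip_le`). The boundary has 2ρ + 2n sides. With angles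
measured in units of 60°, a Gauss–Bonnet inequality gives Σ(angle - 3) ≥ -6 along the boundary
(`le_sum_ang`). Conversely, a discharging argument bounds this sum by the number of boundary sides
minus 4n (`sum_ang_le`): each side pays for one unit of excess angle, and the tip of a leaf has a
large deficit. The discharging can only fail where the boundary encloses a pocket of uncovered
triangles, that is, a hole (`ang_ne_five`).

For the quadratic bound, close a strip through the connected complement to a closed curve. Its
intersection numbers define a potential on the vertices (`exists_strip_potential`), with just two
values on the tiling (`exists_isCut`). Hence strips of different directions meet in at most one tile
(`IsPatch.cross_unique`). If there are a, b, c runs in the three directions, at most ab + bc + ca ≤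
ρ²/3 tiles lie on two runs, and the others are leaves, so τ ≤ ab + bc + ca + n. Combined with the
relations above this leaves, for κ ≥ 5, only the exception κ = 6, ρ = 7 with 3, 2, 2 runs in the
three directions. It is excluded by `IsPatch.false_of_three`: the middle one of three parallel runs
would begin with a leaf, and the place next to this leaf cannot be filled. -/

namespace KDoku

/-! ### Darts of the triangular lattice, and tilings encoded by short diagonals. -/

/-- A directed edge of the triangular lattice: its tail, and one of the six directions. -/
abbrev LDart := (ℤ × ℤ) × Fin 6

/-- The six lattice directions, in counterclockwise order. -/
def dir : Fin 6 → ℤ × ℤ := ![(1, 0), (0, 1), (-1, 1), (-1, 0), (0, -1), (1, -1)]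

namespace LDart

/-- The same edge with the opposite direction. -/
def rev (d : LDart) : LDart := (d.1 + dir d.2, d.2 + 3)

/-- The next side of the triangle on the left. -/
def nx (d : LDart) : LDart := (d.1 + dir d.2, d.2 + 2)

/-- The rotation by `60°` about the tail. -/
def rot (d : LDart) : LDart := (d.1, d.2 + 1)

theorem dir_add_three (k : Fin 6) : dir (k + 3) = -dir k := by
  fin_cases k <;> simp [dir]

theorem dir_add_dir (k : Fin 6) : dir k + dir (k + 2) = dir (k + 1) := by
  fin_cases k <;> simp [dir]

@[simp] theorem rev_rev (d : LDart) : rev (rev d) = d := by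
  rcases d with ⟨⟨x, y⟩, k⟩
  fin_cases k <;> simp [rev, dir]

@[simp] theorem nx_nx_nx (d : LDart) : nx (nx (nx d)) = d := by
  rcases d with ⟨⟨x, y⟩, k⟩
  fin_cases k <;> simp [nx, dir]

theorem rev_nx_nx (d : LDart) : rev (nx (nx d)) = rot d := by
  rcases d with ⟨⟨x, y⟩, k⟩
  fin_cases k <;> simp [nx, dir, rev, rot]

theorem rev_injective : Function.Injective rev := fun a b h => by
  rw [← rev_rev a, h, rev_rev]

theorem nx_injective : Function.Injective nx := fun a b h => by
  rw [← nx_nx_nx a, h, nx_nx_nx]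

theorem rev_ne (d : LDart) : rev d ≠ d := by
  rcases d with ⟨v, k⟩
  intro h
  have h2 : k + 3 = k := congrArg Prod.snd h
  clear h
  revert k
  decide

end LDart

open LDart

variable {M : Finset LDart}

/-- The triangle on the left of `d` is covered by the tiles with short diagonals `M`. -/
def Cov (M : Finset LDart) (d : LDart) : Prop := d ∈ M ∨ nx d ∈ M ∨ nx (nx d) ∈ M

instance : DecidablePred (Cov M) := fun d => by unfold Cov; infer_instance

/-- `d` is a side of the tile on its left. -/
def SideDart (M : Finset LDart) (d : LDart) : Prop := Cov M d ∧ d ∉ M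

instance : DecidablePred (SideDart M) := fun d => by unfold SideDart; infer_instance

/-- `d` is a boundary side, with its tile on its left. -/
def Bd (M : Finset LDart) (d : LDart) : Prop := Cov M d ∧ ¬ Cov M (rev d)

instance : DecidablePred (Bd M) := fun d => by unfold Bd; infer_instance

/-- The next side in counterclockwise order of the tile on the left of the side `e`. -/
def sn (M : Finset LDart) (e : LDart) : LDart :=
  if nx (nx e) ∈ M then nx e else nx (rev (nx e))

/-- The opposite side of the tile on the left of the side `e`. -/
def opp (M : Finset LDart) (e : LDart) : LDart := sn M (sn M e)

/-- The side parallel to `e` of the tile behind the side opposite to `e`. -/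
def stp (M : Finset LDart) (e : LDart) : LDart := rev (opp M e)

/-- `M` is the set of the short diagonals (in both directions) of a set of tiles with disjoint
interiors. -/
structure IsDiag (M : Finset LDart) : Prop where
  rev_mem : ∀ d ∈ M, rev d ∈ M
  excl : ∀ d ∈ M, nx d ∉ M

@[simp] theorem cov_nx (d : LDart) : Cov M (nx d) ↔ Cov M d := by
  simp only [Cov, nx_nx_nx]; tauto

theorem cov_rot (d : LDart) : Cov M (rev (rot d)) ↔ Cov M d := by
  rw [← rev_nx_nx, rev_rev, cov_nx, cov_nx]

/-- The triangle on the right of an edge at `v` is the preceding one of the six triangles around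
`v`. -/
theorem cov_rev_mk (v : ℤ × ℤ) (k : Fin 6) : Cov M (rev (v, k)) ↔ Cov M (v, k - 1) := by
  have := cov_rot (M := M) (v, k - 1)
  simpa [rot] using this

namespace IsDiag

variable (hM : IsDiag M)
include hM

theorem rev_mem_iff (d : LDart) : rev d ∈ M ↔ d ∈ M :=
  ⟨fun h => by simpa using hM.rev_mem _ h, hM.rev_mem d⟩

theorem excl' {d : LDart} (h : nx d ∈ M) : d ∉ M := fun h' => hM.excl d h' h

theorem excl'' {d : LDart} (h : d ∈ M) : nx (nx d) ∉ M := fun h' => by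
  have := hM.excl _ h'
  simp [h] at this

theorem cov_rev_of_mem {d : LDart} (h : d ∈ M) : Cov M (rev d) := Or.inl (hM.rev_mem d h)

theorem not_mem_of_bd {d : LDart} (h : Bd M d) : d ∉ M := fun h' => h.2 (hM.cov_rev_of_mem h')

theorem sideDart_of_bd {d : LDart} (h : Bd M d) : SideDart M d := ⟨h.1, hM.not_mem_of_bd h⟩

theorem sideDart_iff {d : LDart} : SideDart M d ↔ nx d ∈ M ∨ nx (nx d) ∈ M := by
  constructor
  · rintro ⟨h, h'⟩; simpa [Cov, h'] using h
  · rintro (h | h)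
    · exact ⟨Or.inr (Or.inl h), hM.excl' h⟩
    · exact ⟨Or.inr (Or.inr h), fun h' => hM.excl'' h' h⟩

theorem sideDart_rev {d : LDart} (h : SideDart M d) (h' : Cov M (rev d)) : SideDart M (rev d) :=
  ⟨h', fun h2 => h.2 ((hM.rev_mem_iff d).1 h2)⟩

omit hM in
theorem sn_nx {d : LDart} (h : d ∈ M) : sn M (nx d) = nx (nx d) := by
  simp [sn, h]

theorem sn_nx_nx {d : LDart} (h : d ∈ M) : sn M (nx (nx d)) = nx (rev d) := by
  simp [sn, hM.excl d h]

theorem sideDart_cases {e : LDart} (h : SideDart M e) :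
    ∃ d ∈ M, e = nx d ∨ e = nx (nx d) := by
  rcases hM.sideDart_iff.1 h with h | h
  · exact ⟨_, h, Or.inr (by simp)⟩
  · exact ⟨_, h, Or.inl (by simp)⟩

theorem sideDart_nx {d : LDart} (h : d ∈ M) : SideDart M (nx d) := by
  rw [hM.sideDart_iff]; simp [h]

theorem sideDart_nx_nx {d : LDart} (h : d ∈ M) : SideDart M (nx (nx d)) := by
  rw [hM.sideDart_iff]; simp [h]

theorem sideDart_sn {e : LDart} (h : SideDart M e) : SideDart M (sn M e) := by
  obtain ⟨d, hd, rfl | rfl⟩ := hM.sideDart_cases h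
  · rw [sn_nx hd]; exact hM.sideDart_nx_nx hd
  · rw [hM.sn_nx_nx hd]; exact hM.sideDart_nx (hM.rev_mem d hd)

theorem opp_nx {d : LDart} (h : d ∈ M) : opp M (nx d) = nx (rev d) := by
  rw [opp, sn_nx h, hM.sn_nx_nx h]

theorem opp_nx_nx {d : LDart} (h : d ∈ M) : opp M (nx (nx d)) = nx (nx (rev d)) := by
  rw [opp, hM.sn_nx_nx h, sn_nx (hM.rev_mem d h)]

theorem sideDart_opp {e : LDart} (h : SideDart M e) : SideDart M (opp M e) :=
  hM.sideDart_sn (hM.sideDart_sn h)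

theorem opp_opp {e : LDart} (h : SideDart M e) : opp M (opp M e) = e := by
  obtain ⟨d, hd, rfl | rfl⟩ := hM.sideDart_cases h
  · rw [hM.opp_nx hd, hM.opp_nx (hM.rev_mem d hd), rev_rev]
  · rw [hM.opp_nx_nx hd, hM.opp_nx_nx (hM.rev_mem d hd), rev_rev]

theorem snd_opp {e : LDart} (h : SideDart M e) : (opp M e).2 = e.2 + 3 := by
  obtain ⟨d, hd, rfl | rfl⟩ := hM.sideDart_cases h
  · rw [hM.opp_nx hd]; simp only [nx, rev]; abel
  · rw [hM.opp_nx_nx hd]; simp only [nx, rev]; abel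

theorem snd_stp {e : LDart} (h : SideDart M e) : (stp M e).2 = e.2 := by
  rw [stp, rev, hM.snd_opp h, add_assoc, show (3 + 3 : Fin 6) = 0 from rfl, add_zero]

end IsDiag

/-- The covered darts. -/
def covFin (M : Finset LDart) : Finset LDart := M ∪ M.image nx ∪ M.image (nx ∘ nx)

theorem mem_covFin {d : LDart} : d ∈ covFin M ↔ Cov M d := by
  simp only [covFin, Finset.mem_union, Finset.mem_image, Cov, Function.comp]
  constructor
  · rintro ((h | ⟨a, h, rfl⟩) | ⟨a, h, rfl⟩) <;> simp [h]
  · rintro (h | h | h)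
    · exact Or.inl (Or.inl h)
    · exact Or.inr ⟨_, h, by simp⟩
    · exact Or.inl (Or.inr ⟨_, h, by simp⟩)

/-- Each covered triangle has exactly one dart in `M`, and its other two darts are sides; so
`M.card` counts covered triangles, two for each tile. -/
theorem card_sideDart (hM : IsDiag M) : ((covFin M).filter (SideDart M)).card = 2 * M.card := by
  have : (covFin M).filter (SideDart M) = M.image nx ∪ M.image (nx ∘ nx) := by
    ext d
    simp only [Finset.mem_filter, mem_covFin, Finset.mem_union, Finset.mem_image,
      Function.comp]
    constructor
    · rintro ⟨-, h⟩
      obtain ⟨e, he, rfl | rfl⟩ := hM.sideDart_cases h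
      · exact Or.inl ⟨e, he, rfl⟩
      · exact Or.inr ⟨e, he, rfl⟩
    · rintro (⟨e, he, rfl⟩ | ⟨e, he, rfl⟩)
      · exact ⟨(hM.sideDart_nx he).1, hM.sideDart_nx he⟩
      · exact ⟨(hM.sideDart_nx_nx he).1, hM.sideDart_nx_nx he⟩
  rw [this, Finset.card_union_of_disjoint, Finset.card_image_of_injective _ nx_injective,
    Finset.card_image_of_injective _ (nx_injective.comp nx_injective), two_mul]
  rw [Finset.disjoint_left]
  simp only [Finset.mem_image, Function.comp, not_exists, not_and]
  rintro _ ⟨a, ha, rfl⟩ b hb h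
  rw [← nx_injective h] at ha
  exact hM.excl b hb ha

theorem card_covFin (hM : IsDiag M) : (covFin M).card = 3 * M.card := by
  rw [← Finset.card_filter_add_card_filter_not (SideDart M), card_sideDart hM]
  have : (covFin M).filter (fun d => ¬ SideDart M d) = M := by
    ext d
    rw [Finset.mem_filter, mem_covFin, SideDart]
    constructor
    · tauto
    · exact fun h => ⟨Or.inl h, by tauto⟩
  rw [this]; ring

end KDoku

/-! ### Discrete Gauss–Bonnet: Euler's inequality and the sum of the boundary angles. -/

namespace KDoku

open LDart IsDiag

/-- A connected multigraph on `X` with edges `ι` has at most `#ι + 1` vertices. -/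
theorem card_le_of_eqvGen {X ι : Type*} [Fintype X] [Fintype ι] [Nonempty X] (f g : ι → X)
    (h : ∀ a b, Relation.EqvGen (fun a b => ∃ i, f i = a ∧ g i = b) a b) :
    Fintype.card X ≤ Fintype.card ι + 1 := by
  classical
  let G : SimpleGraph X := SimpleGraph.fromEdgeSet (Set.range fun i => s(f i, g i))
  have hG : G.Connected := by
    have : ∀ a b, G.Reachable a b := fun a b => by
      induction h a b with
      | rel x y hxy =>
        obtain ⟨i, rfl, rfl⟩ := hxy
        by_cases hfg : f i = g i
        · rw [hfg]
        · exact SimpleGraph.Adj.reachable ((SimpleGraph.fromEdgeSet_adj _).2 ⟨⟨i, rfl⟩, hfg⟩)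
      | refl x => rfl
      | symm x y _ ih => exact ih.symm
      | trans x y z _ _ ih1 ih2 => exact ih1.trans ih2
    exact ⟨this⟩
  have h1 := hG.card_vert_le_card_edgeSet_add_one
  rw [Nat.card_eq_fintype_card] at h1
  have h2 : Nat.card G.edgeSet ≤ Fintype.card ι := by
    have hsub : G.edgeSet ⊆ Set.range fun i => s(f i, g i) := by
      rw [SimpleGraph.edgeSet_fromEdgeSet]; exact Set.sdiff_subset
    calc Nat.card G.edgeSet = G.edgeSet.ncard := Nat.card_coe_set_eq _
      _ ≤ (Set.range fun i => s(f i, g i)).ncard :=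
        Set.ncard_le_ncard hsub (Set.finite_range _)
      _ ≤ _ := by
        rw [← Set.image_univ]
        refine (Set.ncard_image_le Set.finite_univ).trans ?_
        rw [Set.ncard_univ, Nat.card_eq_fintype_card]
  omega

variable {M : Finset LDart}

/-- Two covered darts are joined through covered triangles. -/
def CovConn (M : Finset LDart) : Prop :=
  ∀ d e, Cov M d → Cov M e →
    Relation.ReflTransGen (fun a b => b = nx a ∨ (b = rev a ∧ Cov M b)) d e

/-- The direction of a diagonal, normalized. -/
def normDart (d : LDart) : LDart := if d.2 < 3 then d else rev d

theorem normDart_rev (d : LDart) : normDart (rev d) = normDart d := by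
  have h : ∀ k : Fin 6, (k + 3 < 3 ↔ ¬ k < 3) := by decide
  by_cases hd : d.2 < 3
  · rw [normDart, if_neg (by simpa only [rev, h, not_not] using hd), rev_rev, normDart, if_pos hd]
  · rw [normDart, if_pos (by simpa only [rev, h, not_not] using hd), normDart, if_neg hd]

theorem normDart_lt (d : LDart) : (normDart d).2 < 3 := by
  have h : ∀ k : Fin 6, (k + 3 < 3 ↔ ¬ k < 3) := by decide
  by_cases hd : d.2 < 3
  · rwa [normDart, if_pos hd]
  · rw [normDart, if_neg hd]; simpa only [rev, h] using hd

/-- The normalized short diagonal of the tile covering the triangle on the left of `d`. -/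
def diag (M : Finset LDart) (d : LDart) : LDart :=
  normDart (if d ∈ M then d else if nx d ∈ M then nx d else nx (nx d))

namespace IsDiag

variable (hM : IsDiag M)
include hM

theorem normDart_mem {d : LDart} (h : d ∈ M) : normDart d ∈ M := by
  unfold normDart; split_ifs
  · exact h
  · exact hM.rev_mem d h

omit hM in
theorem diag_of_mem {d : LDart} (h : d ∈ M) : diag M d = normDart d := by
  rw [diag, if_pos h]

theorem diag_mem {d : LDart} (h : Cov M d) : diag M d ∈ M := by
  apply hM.normDart_mem
  split_ifs with h1 h2
  · exact h1
  · exact h2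
  · simpa [Cov, h1, h2] using h

theorem diag_nx {d : LDart} (h : Cov M d) : diag M (nx d) = diag M d := by
  unfold diag
  rcases h with h | h | h
  · simp [h, hM.excl d h, hM.excl'' h]
  · simp [h, hM.excl' h]
  · have h1 : nx d ∉ M := hM.excl' h
    have h2 : d ∉ M := fun h' => hM.excl'' h' h
    simp [h, h1, h2]

end IsDiag

/-- All six triangles around the vertex `v` are covered. -/
def Inner (M : Finset LDart) (v : ℤ × ℤ) : Prop := ∀ k, Cov M (v, k)

instance : DecidablePred (Inner M) := fun d => by unfold Inner; infer_instance

/-- The vertices around which everything is covered. -/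
def innerFin (M : Finset LDart) : Finset (ℤ × ℤ) := ((covFin M).image Prod.fst).filter (Inner M)

theorem mem_innerFin {v : ℤ × ℤ} : v ∈ innerFin M ↔ Inner M v := by
  simp only [innerFin, Finset.mem_filter, Finset.mem_image, mem_covFin, and_iff_right_iff_imp]
  exact fun h => ⟨(v, 0), h 0, rfl⟩

/-- An edge leading upwards from a vertex, which is not a short diagonal. -/
def upDart (M : Finset LDart) (v : ℤ × ℤ) : LDart := if (v, 0) ∈ M then (v, 1) else (v, 0)

/-- The inner edges between tiles, with an upward orientation. -/
def innerEdges (M : Finset LDart) : Finset LDart :=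
  (covFin M).filter fun d => d ∉ M ∧ Cov M (rev d) ∧ d.2 < 3

theorem mem_innerEdges {d : LDart} :
    d ∈ innerEdges M ↔ Cov M d ∧ d ∉ M ∧ Cov M (rev d) ∧ d.2 < 3 := by
  simp only [innerEdges, Finset.mem_filter, mem_covFin]

theorem fst_upDart (v : ℤ × ℤ) : (upDart M v).1 = v := by
  unfold upDart; split_ifs <;> rfl

theorem upDart_injective : Function.Injective (upDart M) := fun a b h => by
  rw [← fst_upDart (M := M) a, h, fst_upDart]

theorem Inner.cov_rev {v : ℤ × ℤ} (h : Inner M v) (k : Fin 6) : Cov M (rev (v, k)) :=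
  (cov_rev_mk v k).2 (h _)

theorem upDart_mem (hM : IsDiag M) {v : ℤ × ℤ} (h : Inner M v) : upDart M v ∈ innerEdges M := by
  have : upDart M v ∉ M := by
    unfold upDart; split_ifs with h0
    · have h1 := hM.excl'' h0
      rw [← hM.rev_mem_iff, rev_nx_nx] at h1
      exact h1
    · exact h0
  rw [mem_innerEdges]
  refine ⟨?_, this, ?_, ?_⟩ <;> unfold upDart <;> split_ifs
  exacts [h _, h _, h.cov_rev _, h.cov_rev _, (by decide : (1 : Fin 6) < 3), (by decide : (0 : Fin 6) < 3)]

/-- The inner edges without one upward edge at each inner vertex. -/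
def treeEdges (M : Finset LDart) : Finset LDart := innerEdges M \ (innerFin M).image (upDart M)

theorem card_treeEdges (hM : IsDiag M) :
    (treeEdges M).card + (innerFin M).card = (innerEdges M).card := by
  rw [treeEdges, ← Finset.card_image_of_injective (innerFin M) (upDart_injective (M := M))]
  apply Finset.card_sdiff_add_card_eq_card
  intro d hd
  obtain ⟨v, hv, rfl⟩ := Finset.mem_image.1 hd
  exact upDart_mem hM (mem_innerFin.1 hv)

/-- Two normalized diagonals are linked through the edges that are left. -/
def Linked (M : Finset LDart) : LDart → LDart → Prop :=
  Relation.EqvGen fun a b => ∃ d ∈ treeEdges M, diag M d = a ∧ diag M (rev d) = b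

/-- The six triangles around an inner vertex form a cycle, so crossing one of its edges can be
replaced by crossing the other five. -/
theorem linked_around (hM : IsDiag M) {v : ℤ × ℤ} (hv : Inner M v) (k : Fin 6)
    (h : ∀ j, j ≠ k → Linked M (diag M (v, j)) (diag M (rev (v, j)))) :
    Linked M (diag M (v, k)) (diag M (rev (v, k))) := by
  have key : ∀ j, diag M (rev (v, j + 1)) = diag M (v, j) := fun j => by
    have : rev (v, j + 1) = nx (nx (v, j)) := by
      rw [← rev_rev (nx (nx (v, j))), rev_nx_nx]; rfl
    rw [this, hM.diag_nx ((cov_nx _).2 (hv j)), hM.diag_nx (hv j)]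
  have step : ∀ j, j + 1 ≠ k → Linked M (diag M (v, j + 1)) (diag M (v, j)) := fun j hj => by
    have := h (j + 1) hj
    rwa [key] at this
  have e5 : diag M (rev (v, k)) = diag M (v, k + 5) := by
    rw [← key (k + 5), add_assoc, show (5 + 1 : Fin 6) = 0 from rfl, add_zero]
  rw [e5]
  have nek : ∀ k : Fin 6, k + 1 ≠ k ∧ k + 1 + 1 ≠ k ∧ k + 1 + 1 + 1 ≠ k ∧ k + 1 + 1 + 1 + 1 ≠ k ∧
      k + 1 + 1 + 1 + 1 + 1 ≠ k ∧ k + 5 = k + 1 + 1 + 1 + 1 + 1 := by decide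
  obtain ⟨n1, n2, n3, n4, n5, n6⟩ := nek k
  rw [n6]
  exact ((((step _ n1).symm.trans _ _ _ (step _ n2).symm).trans _ _ _ (step _ n3).symm).trans _ _ _
    (step _ n4).symm).trans _ _ _ (step _ n5).symm

theorem linked_of_mem (hM : IsDiag M) {d : LDart} (h : d ∈ M) :
    Linked M (diag M d) (diag M (rev d)) := by
  rw [diag_of_mem h, diag_of_mem (hM.rev_mem d h), normDart_rev]
  exact Relation.EqvGen.refl _

/-- A height that increases along the directions 0, 1, 2. -/
def height (d : LDart) : ℤ := d.1.1 + 2 * d.1.2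

/-- Removing one upward edge at every inner vertex does not disconnect the tiles. A lowest removed
edge violating this starts at some inner vertex and is bypassed around that vertex: the other edges
upwards are kept, and the edges downwards start at lower vertices. -/
theorem linked_edge (hM : IsDiag M) {d : LDart} (h : Cov M d) (h' : Cov M (rev d)) :
    Linked M (diag M d) (diag M (rev d)) := by
  classical
  have main : ∀ d ∈ innerEdges M, Linked M (diag M d) (diag M (rev d)) := by
    by_contra! hbad
    obtain ⟨d, hd, hdb⟩ := hbad
    obtain ⟨e, he, hmin⟩ := Finset.exists_min_image
      ((innerEdges M).filter fun d => ¬ Linked M (diag M d) (diag M (rev d))) height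
      ⟨d, Finset.mem_filter.2 ⟨hd, hdb⟩⟩
    rw [Finset.mem_filter] at he
    obtain ⟨he, heb⟩ := he
    have het : e ∉ treeEdges M := fun ht => heb (Relation.EqvGen.rel _ _ ⟨e, ht, rfl, rfl⟩)
    rw [treeEdges, Finset.mem_sdiff, not_and_not_right] at het
    obtain ⟨v, hv, hve⟩ := Finset.mem_image.1 (het he)
    rw [mem_innerFin] at hv
    obtain ⟨v', k⟩ := e
    have hvv : v' = v := by
      have := fst_upDart (M := M) v
      rw [hve] at this; exact this
    subst hvv
    refine heb (linked_around hM hv k fun j hj => ?_)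
    by_cases hjM : (v', j) ∈ M
    · exact linked_of_mem hM hjM
    by_cases hj3 : j < 3
    · refine Relation.EqvGen.rel _ _ ⟨_, ?_, rfl, rfl⟩
      rw [treeEdges, Finset.mem_sdiff, mem_innerEdges]
      refine ⟨⟨hv j, hjM, hv.cov_rev j, hj3⟩, ?_⟩
      rw [Finset.mem_image]
      rintro ⟨w, hw, hwe⟩
      have hww : w = v' := by
        have := fst_upDart (M := M) w
        rw [hwe] at this; exact this.symm
      rw [hww, hve] at hwe
      exact hj (congrArg Prod.snd hwe).symm
    -- An edge leading down from the vertex, reversed, has a lower tail; minimality applies to it.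
    · by_contra hcon
      have hr : rev (v', j) ∈ innerEdges M := by
        rw [mem_innerEdges]
        refine ⟨hv.cov_rev j, fun h => hjM ((hM.rev_mem_iff _).1 h), by simpa using hv j, ?_⟩
        have h : ∀ k : Fin 6, ¬ k < 3 → k + 3 < 3 := by decide
        exact h j hj3
      have := hmin (rev (v', j)) (Finset.mem_filter.2 ⟨hr, fun hl => hcon ?_⟩)
      · have hj' : 3 ≤ j := not_lt.1 hj3
        clear hcon hr hmin hjM hj heb het he hve hj3
        simp only [height, rev] at this
        fin_cases j <;> simp [dir] at this hj' ⊢ <;> omega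
      · rw [rev_rev] at hl; exact hl.symm
  by_cases hd : d ∈ M
  · exact linked_of_mem hM hd
  by_cases hd3 : d.2 < 3
  · exact main d (mem_innerEdges.2 ⟨h, hd, h', hd3⟩)
  · have hr : rev d ∈ innerEdges M := by
      rw [mem_innerEdges]
      refine ⟨h', fun h => hd ((hM.rev_mem_iff _).1 h), by simpa using h, ?_⟩
      have h : ∀ k : Fin 6, ¬ k < 3 → k + 3 < 3 := by decide
      exact h _ hd3
    have := main _ hr
    rw [rev_rev] at this
    exact this.symm

theorem linked_of_cov (hM : IsDiag M) (hc : CovConn M) {d e : LDart} (hd : Cov M d)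
    (he : Cov M e) : Linked M (diag M d) (diag M e) := by
  have : Linked M (diag M d) (diag M e) ∧ Cov M e := by
    have hr := hc d e hd he
    clear he
    induction hr with
    | refl => exact ⟨Relation.EqvGen.refl _, hd⟩
    | @tail b c _ hbc ih =>
      obtain ⟨ih, hb⟩ := ih
      rcases hbc with rfl | ⟨rfl, hcv⟩
      · exact ⟨by rwa [hM.diag_nx hb], (cov_nx b).2 hb⟩
      · exact ⟨ih.trans _ _ _ (linked_edge hM hb hcv), hcv⟩
  exact this.1

/-- The normalized diagonals: one for each tile. -/
def tiles (M : Finset LDart) : Finset LDart := M.filter fun d => d.2 < 3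

theorem card_filter_lt_three (s : Finset LDart) (h : ∀ d ∈ s, rev d ∈ s) :
    2 * (s.filter fun d => d.2 < 3).card = s.card := by
  rw [← Finset.card_filter_add_card_filter_not (s := s) (fun d => d.2 < 3), two_mul]
  congr 1
  have h3 : ∀ k : Fin 6, (k + 3 < 3 ↔ ¬ k < 3) := by decide
  refine Finset.card_bij (fun d _ => rev d) ?_ (fun a _ b _ hab => rev_injective hab) ?_
  · intro d hd
    rw [Finset.mem_filter] at hd ⊢
    refine ⟨h d hd.1, ?_⟩
    simp only [rev, h3, not_not]; exact hd.2
  · intro d hd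
    rw [Finset.mem_filter] at hd
    refine ⟨rev d, ?_, rev_rev d⟩
    rw [Finset.mem_filter]
    exact ⟨h d hd.1, by simp only [rev, h3]; exact hd.2⟩

theorem card_tiles (hM : IsDiag M) : 2 * (tiles M).card = M.card :=
  card_filter_lt_three M hM.rev_mem

/-- One half of Euler's formula: the tiles stay connected through the inner edges that are left
after deleting one for each inner vertex, and a connected graph has at most one vertex more than
edges. -/
theorem card_tiles_le (hM : IsDiag M) (hc : CovConn M) (hne : M.Nonempty) :
    (tiles M).card + (innerFin M).card ≤ (innerEdges M).card + 1 := by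
  have hmem : ∀ {d}, Cov M d → diag M d ∈ tiles M := fun {d} h =>
    Finset.mem_filter.2 ⟨hM.diag_mem h, normDart_lt _⟩
  have hce : ∀ {d}, d ∈ treeEdges M → Cov M d ∧ Cov M (rev d) := fun {d} h => by
    have := mem_innerEdges.1 (Finset.mem_sdiff.1 h).1
    exact ⟨this.1, this.2.2.1⟩
  let f : treeEdges M → tiles M := fun d => ⟨diag M d, hmem (hce d.2).1⟩
  let g : treeEdges M → tiles M := fun d => ⟨diag M (rev d), hmem (hce d.2).2⟩
  obtain ⟨d0, hd0⟩ := hne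
  have : Nonempty (tiles M) := ⟨⟨diag M d0, hmem (Or.inl hd0)⟩⟩
  have key := card_le_of_eqvGen f g (by
    have aux : ∀ a b, Linked M a b → ∀ (ha : a ∈ tiles M) (hb : b ∈ tiles M),
        Relation.EqvGen (fun a b => ∃ i, f i = a ∧ g i = b) ⟨a, ha⟩ ⟨b, hb⟩ := by
      have aux2 : ∀ a b, Linked M a b → a = b ∨ ∃ (ha : a ∈ tiles M) (hb : b ∈ tiles M),
        Relation.EqvGen (fun a b => ∃ i, f i = a ∧ g i = b) ⟨a, ha⟩ ⟨b, hb⟩ := by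
        intro a b hab
        induction hab with
        | rel x y hxy =>
          obtain ⟨d, hd, rfl, rfl⟩ := hxy
          exact Or.inr ⟨hmem (hce hd).1, hmem (hce hd).2,
            Relation.EqvGen.rel _ _ ⟨⟨d, hd⟩, rfl, rfl⟩⟩
        | refl x => exact Or.inl rfl
        | symm x y _ ih =>
          rcases ih with rfl | ⟨ha, hb, ih⟩
          · exact Or.inl rfl
          · exact Or.inr ⟨hb, ha, ih.symm⟩
        | trans x y z _ _ ih1 ih2 =>
          rcases ih1 with rfl | ⟨ha, hb, ih1⟩
          · exact ih2
          · rcases ih2 with rfl | ⟨hb', hc, ih2⟩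
            · exact Or.inr ⟨ha, hb, ih1⟩
            · exact Or.inr ⟨ha, hc, ih1.trans _ _ _ ih2⟩
      intro a b hab ha hb
      rcases aux2 a b hab with rfl | ⟨_, _, h⟩
      · exact Relation.EqvGen.refl _
      · exact h
    rintro ⟨a, ha⟩ ⟨b, hb⟩
    have haM := (Finset.mem_filter.1 ha)
    have hbM := (Finset.mem_filter.1 hb)
    have := linked_of_cov hM hc (Or.inl haM.1 : Cov M a) (Or.inl hbM.1 : Cov M b)
    rw [diag_of_mem haM.1, diag_of_mem hbM.1, normDart, normDart, if_pos haM.2,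
      if_pos hbM.2] at this
    exact aux a b this ha hb)
  rw [Fintype.card_coe, Fintype.card_coe] at key
  have := card_treeEdges hM
  omega

/-- The boundary darts. -/
def bdFin (M : Finset LDart) : Finset LDart := (covFin M).filter (Bd M)

theorem mem_bdFin {d : LDart} : d ∈ bdFin M ↔ Bd M d := by
  simp only [bdFin, Finset.mem_filter, mem_covFin, and_iff_right_iff_imp]
  exact fun h => h.1

/-- The tiles have `2 * M.card` sides altogether; an inner edge is a side twice, a boundary edge
once. -/
theorem card_innerEdges (hM : IsDiag M) :
    2 * (innerEdges M).card + (bdFin M).card = 2 * M.card := by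
  have h1 : innerEdges M =
      (((covFin M).filter (SideDart M)).filter fun d => Cov M (rev d)).filter fun d => d.2 < 3 := by
    ext d
    rw [mem_innerEdges, Finset.mem_filter, Finset.mem_filter, Finset.mem_filter, mem_covFin,
      SideDart]
    tauto
  have h2 : bdFin M = ((covFin M).filter (SideDart M)).filter fun d => ¬ Cov M (rev d) := by
    ext d
    rw [mem_bdFin, Finset.mem_filter, Finset.mem_filter, mem_covFin]
    exact ⟨fun h => ⟨⟨h.1, hM.sideDart_of_bd h⟩, h.2⟩, fun h => ⟨h.1.1, h.2⟩⟩
  rw [← card_sideDart hM, ← Finset.card_filter_add_card_filter_not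
    (s := (covFin M).filter (SideDart M)) (fun d => Cov M (rev d)), h1, h2, card_filter_lt_three]
  intro d
  rw [Finset.mem_filter, Finset.mem_filter, Finset.mem_filter, Finset.mem_filter, mem_covFin,
    mem_covFin, SideDart, SideDart, rev_rev, hM.rev_mem_iff]
  tauto

/-- The number of consecutive `true` values of `c` from `k` on, at most 5. -/
def runLen (c : Fin 6 → Bool) (k : Fin 6) : ℕ :=
  if !c (k + 1) then 1 else if !c (k + 2) then 2 else if !c (k + 3) then 3 else
    if !c (k + 4) then 4 else 5

/-- The angle of the tiling at the tail of the boundary dart `d`, in units of `60°`. -/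
def ang (M : Finset LDart) (d : LDart) : ℕ := runLen (fun k => decide (Cov M (d.1, k))) d.2

/-- The covered sectors around a vertex split into cyclic runs, each of which is counted at its
first sector. -/
theorem runLen_sum : ∀ c : Fin 6 → Bool, (Finset.univ.filter fun k => c k).card =
    (if ∀ k, c k then 6 else 0) + ∑ k, if c k ∧ ¬ c (k - 1) then runLen c k else 0 := by
  decide

/-- A covered dart stands for the corner of its triangle at its tail. Collected by vertices, these
corners fill the six sectors of an inner vertex, or the sectors of boundary angles. -/
theorem sum_ang (M : Finset LDart) :
    (covFin M).card = 6 * (innerFin M).card + ∑ d ∈ bdFin M, ang M d := by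
  have h1 : (covFin M).card = ∑ v ∈ (covFin M).image Prod.fst,
      (Finset.univ.filter fun k => decide (Cov M (v, k)) = true).card := by
    rw [Finset.card_eq_sum_card_image Prod.fst (covFin M)]
    refine Finset.sum_congr rfl fun v _ => ?_
    symm
    refine Finset.card_bij (fun k _ => (v, k)) ?_ ?_ ?_
    · intro k hk
      simpa [mem_covFin] using hk
    · intro a _ b _ h
      exact congrArg Prod.snd h
    · rintro ⟨w, k⟩ h
      simp only [Finset.mem_filter, mem_covFin] at h
      obtain ⟨h, rfl⟩ := h
      exact ⟨k, by simpa using h, rfl⟩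
  have h2 : ∑ d ∈ bdFin M, ang M d = ∑ v ∈ (covFin M).image Prod.fst,
      ∑ k, if Cov M (v, k) ∧ ¬ Cov M (v, k - 1) then ang M (v, k) else 0 := by
    rw [← Finset.sum_product', bdFin, ← Finset.sum_filter]
    refine Finset.sum_congr ?_ fun _ _ => rfl
    ext ⟨v, k⟩
    simp only [Finset.mem_filter, mem_covFin, Finset.mem_product, Finset.mem_image,
      Finset.mem_univ, and_true, Bd, cov_rev_mk]
    constructor
    · rintro ⟨h, h'⟩; exact ⟨⟨_, h, rfl⟩, h'⟩
    · rintro ⟨-, h'⟩; exact ⟨h'.1, h'⟩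
  have h3 : 6 * (innerFin M).card = ∑ v ∈ (covFin M).image Prod.fst,
      if Inner M v then 6 else 0 := by
    rw [← Finset.sum_filter, Finset.sum_const, innerFin, smul_eq_mul, mul_comm]
  rw [h1, h2, h3, ← Finset.sum_add_distrib]
  refine Finset.sum_congr rfl fun v _ => ?_
  rw [runLen_sum]
  simp only [decide_eq_true_eq, Inner, ang]

/-- The discrete Gauss–Bonnet inequality. -/
theorem le_sum_ang (hM : IsDiag M) (hc : CovConn M) (hne : M.Nonempty) :
    3 * (bdFin M).card ≤ (∑ d ∈ bdFin M, ang M d) + 6 := by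
  have h1 := card_tiles_le hM hc hne
  have h2 := card_tiles hM
  have h3 := card_innerEdges hM
  have h4 := sum_ang M
  have h5 := card_covFin hM
  -- Six times Euler's inequality, where the inner vertices are expressed by the angle sum: all
  -- terms in the number of tiles cancel.
  omega

end KDoku

/-! ### Discharging the excess of the boundary angles. -/

namespace KDoku

open LDart IsDiag

variable {M : Finset LDart}

/-- The boundary dart that arrives at the tail of the boundary dart `d`. -/
def prv (M : Finset LDart) (d : LDart) : LDart := rev (d.1, d.2 + Fin.ofNat 6 (ang M d))

theorem ang_le (d : LDart) : ang M d ≤ 5 := by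
  unfold ang runLen; split_ifs <;> omega

theorem runLen_spec : ∀ (c : Fin 6 → Bool) (k : Fin 6), c k → ¬ c (k - 1) →
    c (k + Fin.ofNat 6 (runLen c k) - 1) ∧ ¬ c (k + Fin.ofNat 6 (runLen c k)) := by
  decide

theorem runLen_inj : ∀ (c : Fin 6 → Bool) (k l : Fin 6), c k → ¬ c (k - 1) → c l → ¬ c (l - 1) →
    k + Fin.ofNat 6 (runLen c k) = l + Fin.ofNat 6 (runLen c l) → k = l := by
  decide

theorem bd_iff {v : ℤ × ℤ} {k : Fin 6} : Bd M (v, k) ↔ Cov M (v, k) ∧ ¬ Cov M (v, k - 1) := by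
  rw [Bd, cov_rev_mk]

theorem bd_prv {d : LDart} (h : Bd M d) : Bd M (prv M d) := by
  obtain ⟨v, k⟩ := d
  rw [bd_iff] at h
  have := runLen_spec (fun k => decide (Cov M (v, k))) k (by simpa using h.1) (by simpa using h.2)
  rw [Bd, prv, rev_rev, cov_rev_mk]
  simpa [ang] using this

theorem prv_inj {d e : LDart} (h : Bd M d) (h' : Bd M e) (he : prv M d = prv M e) : d = e := by
  obtain ⟨v, k⟩ := d
  obtain ⟨w, l⟩ := e
  have he := rev_injective he
  simp only [Prod.mk.injEq] at he
  obtain ⟨rfl, he⟩ := he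
  rw [bd_iff] at h h'
  rw [runLen_inj (fun k => decide (Cov M (v, k))) k l (by simpa using h.1) (by simpa using h.2)
    (by simpa using h'.1) (by simpa using h'.2) he]

/-- `prv` injects the finite boundary into itself, hence permutes it. Nothing else about boundary
curves is needed. -/
theorem sum_prv (y : LDart → ℤ) : ∑ d ∈ bdFin M, y (prv M d) = ∑ d ∈ bdFin M, y d := by
  have hinj : Set.InjOn (prv M) (bdFin M) := fun a ha b hb h =>
    prv_inj (mem_bdFin.1 ha) (mem_bdFin.1 hb) h
  have himg : (bdFin M).image (prv M) = bdFin M := by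
    apply Finset.eq_of_subset_of_card_le
    · intro d hd
      obtain ⟨e, he, rfl⟩ := Finset.mem_image.1 hd
      exact mem_bdFin.2 (bd_prv (mem_bdFin.1 he))
    · rw [Finset.card_image_of_injOn hinj]
  conv_rhs => rw [← himg]
  rw [Finset.sum_image hinj]

theorem ang_eq_one {d : LDart} (h : ¬ Cov M (rot d)) : ang M d = 1 := by
  have h' : ¬ Cov M (d.1, d.2 + 1) := h
  simp [ang, runLen, h']

theorem ang_eq_two {d : LDart} (h : Cov M (rot d)) (h2 : ¬ Cov M (rot (rot d))) :
    ang M d = 2 := by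
  have h' : Cov M (d.1, d.2 + 1) := h
  have h2' : ¬ Cov M (d.1, d.2 + 2) := by
    have : (2 : Fin 6) = 1 + 1 := rfl
    rw [this, ← add_assoc]; exact h2
  simp [ang, runLen, h', h2']

theorem prv_of_ang_one {d : LDart} (h : ang M d = 1) : prv M d = rev (rot d) := by
  rw [prv, h]; rfl

theorem prv_of_ang_two {d : LDart} (h : ang M d = 2) : prv M d = rev (rot (rot d)) := by
  rw [prv, h, rot, rot, add_assoc]; rfl

/-- A boundary dart which is opposite to a boundary dart. -/
def Single (M : Finset LDart) (d : LDart) : Prop := Bd M d ∧ Bd M (opp M d)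

instance : DecidablePred (Single M) := fun d => by unfold Single; infer_instance

/-- The side at the tip of a leaf: the opposite side is the only shared one. -/
def Tip (M : Finset LDart) (d : LDart) : Prop :=
  Bd M d ∧ ¬ Bd M (opp M d) ∧ Bd M (sn M d) ∧ Bd M (opp M (sn M d))

instance : DecidablePred (Tip M) := fun d => by unfold Tip; infer_instance

section
variable (hM : IsDiag M)
include hM

omit hM in
theorem rot_nx_rev (D : LDart) : rot (nx (rev D)) = D := by
  rw [← rev_nx_nx, nx_nx_nx, rev_rev]

/-- The angles at the first vertex of the side after a boundary side of a tile. -/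
theorem ang_sn {e : LDart} (h : Bd M e) :
    prv M (sn M e) = e ∧
      ((e ∈ M.image nx ∧ ang M (sn M e) = 1) ∨ (e ∉ M.image nx ∧ ang M (sn M e) = 2)) := by
  obtain ⟨D, hD, rfl | rfl⟩ := hM.sideDart_cases (hM.sideDart_of_bd h)
  · rw [sn_nx hD]
    have h1 : ang M (nx (nx D)) = 1 := by
      apply ang_eq_one
      rw [← rev_nx_nx, nx_nx_nx]; exact h.2
    refine ⟨?_, Or.inl ⟨Finset.mem_image_of_mem _ hD, h1⟩⟩
    rw [prv_of_ang_one h1, ← rev_nx_nx, rev_rev, nx_nx_nx]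
  · rw [hM.sn_nx_nx hD]
    have h1 : ang M (nx (rev D)) = 2 := by
      apply ang_eq_two
      · rw [rot_nx_rev]; exact Or.inl hD
      · rw [rot_nx_rev, ← rev_nx_nx]; exact h.2
    refine ⟨?_, Or.inr ⟨?_, h1⟩⟩
    · rw [prv_of_ang_two h1, rot_nx_rev, ← rev_nx_nx, rev_rev]
    · rw [Finset.mem_image]
      rintro ⟨a, ha, hae⟩
      rw [nx_injective hae] at ha
      exact hM.excl D hD ha

theorem image_nx_sn {e : LDart} (h : SideDart M e) : sn M e ∈ M.image nx ↔ e ∉ M.image nx := by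
  have key : ∀ {D}, D ∈ M → nx (nx D) ∉ M.image nx := fun {D} hD => by
    rw [Finset.mem_image]
    rintro ⟨a, ha, hae⟩
    rw [nx_injective hae] at ha
    exact hM.excl D hD ha
  obtain ⟨D, hD, rfl | rfl⟩ := hM.sideDart_cases h
  · rw [sn_nx hD]
    simp only [key hD, Finset.mem_image_of_mem nx hD, not_true]
  · rw [hM.sn_nx_nx hD]
    simp only [key hD, Finset.mem_image_of_mem nx (hM.rev_mem D hD), not_false_iff]

theorem sn_opp_sn {e : LDart} (h : SideDart M e) : sn M (opp M (sn M e)) = e := by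
  have := hM.opp_opp h
  exact this

/-- Every singleton strip is crossed by exactly one neighbour. -/
def LeafCond (M : Finset LDart) : Prop :=
  ∀ d, Single M d → (Bd M (sn M d) ↔ ¬ Bd M (opp M (sn M d)))

omit hM in
theorem Tip.single {d : LDart} (h : Tip M d) : Single M (sn M d) := ⟨h.2.2.1, h.2.2.2⟩

theorem Tip.prv_eq {d : LDart} (h : Tip M d) : prv M d = opp M (sn M d) := by
  have := (ang_sn hM h.2.2.2).1
  rwa [sn_opp_sn hM (hM.sideDart_of_bd h.1)] at this

theorem Tip.not_tip_prv {d : LDart} (h : Tip M d) : ¬ Tip M (prv M d) := by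
  rw [h.prv_eq hM]
  rintro ⟨-, h2, -⟩
  rw [hM.opp_opp (hM.sideDart_of_bd h.2.2.1)] at h2
  exact h2 h.2.2.1

/-- At both ends of a tip the tiling consists of the leaf alone, so the angles are the 60° and the
120° of a rhombus. -/
theorem Tip.ang_add {d : LDart} (h : Tip M d) : ang M d + ang M (sn M d) = 3 := by
  have h1 := (ang_sn hM h.2.2.2).2
  rw [sn_opp_sn hM (hM.sideDart_of_bd h.1)] at h1
  have h2 := (ang_sn hM h.1).2
  have h3 := image_nx_sn hM (hM.sideDart_of_bd h.2.2.2)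
  rw [sn_opp_sn hM (hM.sideDart_of_bd h.1)] at h3
  rcases h1 with ⟨a, b⟩ | ⟨a, b⟩ <;> rcases h2 with ⟨c, e⟩ | ⟨c, e⟩ <;>
    first | omega | (exfalso; tauto)

theorem tip_prv {d : LDart} (hd : Bd M d) (h : Tip M (prv M d)) : d = sn M (prv M d) :=
  prv_inj hd h.2.2.1 (ang_sn hM (bd_prv hd)).1.symm

/-- The strip of length 1 through `d` crosses a leaf, and `d` follows or precedes the tip of this
leaf on the boundary. -/
theorem Single.tip (hl : LeafCond M) {d : LDart} (h : Single M d) :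
    Tip M (prv M d) ∨ (Bd M (sn M d) ∧ Tip M (sn M d)) := by
  have hs := hM.sideDart_of_bd h.1
  by_cases h1 : Bd M (sn M d)
  · exact Or.inr ⟨h1, h1, (hl d h).1 h1, h.2, by
      have : opp M (sn M (sn M d)) = d := hM.opp_opp hs
      rw [this]; exact h.1⟩
  · have h2 : Bd M (opp M (sn M d)) := by
      by_contra h2
      exact h1 ((hl d h).2 h2)
    left
    have h3 := (ang_sn hM h2).1
    rw [sn_opp_sn hM hs] at h3
    rw [h3]
    refine ⟨h2, ?_, ?_, ?_⟩
    · rwa [hM.opp_opp (hM.sideDart_sn hs)]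
    · rw [sn_opp_sn hM hs]; exact h.1
    · rw [sn_opp_sn hM hs]; exact h.2

/-- The boundary turns left along `d` and has done so before. -/
inductive LeftTurn (M : Finset LDart) : LDart → Prop
  | sharp {d : LDart} : ang M d = 5 → LeftTurn M d
  | blunt {d : LDart} : ang M d = 4 → LeftTurn M (prv M d) → LeftTurn M d

open Classical in
/-- The part of the angle excess charged to the vertex at the tail. -/
noncomputable def tailWeight (M : Finset LDart) (d : LDart) : ℤ :=
  if Tip M d then (ang M d : ℤ) - 3 else
    if Single M d then (if Tip M (prv M d) then 0 else 1) else if LeftTurn M d then 1 else 0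

open Classical in
/-- The part of the angle excess charged to the vertex at the head. -/
noncomputable def headWeight (M : Finset LDart) (d : LDart) : ℤ :=
  if Tip M d then -(ang M d : ℤ) else
    if Single M d then (if Tip M (prv M d) then 1 else 0) else if LeftTurn M d then 0 else 1

omit hM in
theorem weight_add (d : LDart) :
    tailWeight M d + headWeight M d = if Tip M d then -3 else 1 := by
  unfold tailWeight headWeight
  split_ifs <;> ring

-- The excess `ang M d - 3` is at most 2. A side pays one unit, normally at its head, but at its
-- tail after a `LeftTurn`; a single side of a leaf pays at the end away from the tip. An angle 5
-- thus receives units from both sides, because the preceding side is no `LeftTurn` by `hp`. An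
-- angle 4 receives a unit from the preceding side, or from the following one if it continues a
-- `LeftTurn`. The two ends of a tip are balanced by the negative weights of the tip.
open Classical in
theorem ang_le_weight (hl : LeafCond M)
    (hp : ∀ d, Bd M d → LeftTurn M (prv M d) → ang M d ≠ 5) {d : LDart} (hd : Bd M d) :
    (ang M d : ℤ) - 3 ≤ tailWeight M d + headWeight M (prv M d) := by
  have h5 := ang_le (M := M) d
  by_cases h1 : Tip M d
  · have h2 := h1.not_tip_prv hM
    have : 0 ≤ headWeight M (prv M d) := by
      unfold headWeight; rw [if_neg h2]; split_ifs <;> norm_num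
    have h3 : tailWeight M d = (ang M d : ℤ) - 3 := by rw [tailWeight, if_pos h1]
    omega
  by_cases h2 : Tip M (prv M d)
  · have h3 := tip_prv hM hd h2
    have h4 := h2.ang_add hM
    rw [← h3] at h4
    have h6 : Single M d := by rw [h3]; exact h2.single
    rw [tailWeight, if_neg h1, if_pos h6, if_pos h2, headWeight, if_pos h2]
    omega
  have hx : tailWeight M d = if Single M d then 1 else if LeftTurn M d then 1 else 0 := by
    rw [tailWeight, if_neg h1, if_neg h2]
  have hy : headWeight M (prv M d) = if Single M (prv M d) then 1 else
      if LeftTurn M (prv M d) then 0 else 1 := by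
    rw [headWeight, if_neg h2]
    by_cases hq : Single M (prv M d)
    · rw [if_pos hq, if_pos hq, if_pos]
      rcases hq.tip hM hl with h | h
      · exact h
      -- Otherwise `d` itself would be the tip that follows `prv M d`.
      · exfalso
        have := prv_inj hd h.1 (ang_sn hM (bd_prv hd)).1.symm
        rw [← this] at h
        exact h1 h.2
    · rw [if_neg hq, if_neg hq]
  have hp := hp d hd
  rw [hx, hy]
  have h54 : ang M d = 5 ∨ ang M d = 4 ∨ ang M d ≤ 3 := by omega
  rcases h54 with h | h | h
  · have : LeftTurn M d := .sharp h
    have h' : ¬ LeftTurn M (prv M d) := fun h' => hp h' h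
    simp [this, h', h]
  · by_cases h' : LeftTurn M (prv M d)
    · have : LeftTurn M d := .blunt h h'
      simp only [this, if_true, ite_self, h]
      split_ifs <;> norm_num
    · simp only [h', if_false, ite_self, h]
      split_ifs <;> norm_num
  · split_ifs <;> omega

/-- Every boundary side distributes weight 1, except that a tip distributes -3; so each tip lowers
the total by 4. -/
theorem sum_ang_le (hl : LeafCond M)
    (hp : ∀ d, Bd M d → LeftTurn M (prv M d) → ang M d ≠ 5) :
    (∑ d ∈ bdFin M, ang M d) + 4 * ((bdFin M).filter (Tip M)).card ≤ 4 * (bdFin M).card := by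
  have h1 : ∑ d ∈ bdFin M, ((ang M d : ℤ) - 3) ≤
      ∑ d ∈ bdFin M, (tailWeight M d + headWeight M (prv M d)) :=
    Finset.sum_le_sum fun d hd => ang_le_weight hM hl hp (mem_bdFin.1 hd)
  rw [Finset.sum_add_distrib, sum_prv, ← Finset.sum_add_distrib] at h1
  simp only [weight_add] at h1
  rw [Finset.sum_ite, Finset.sum_sub_distrib, Finset.sum_const, Finset.sum_const,
    Finset.sum_const] at h1
  have h2 := Finset.card_filter_add_card_filter_not (s := bdFin M) (Tip M)
  simp only [nsmul_eq_mul] at h1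
  zify at h2 ⊢
  linarith

/-- A leaf has one tip and two single sides, one before and one after the tip. They are told apart
by whether the next side of the tile is on the boundary. -/
theorem card_single (hl : LeafCond M) :
    ((bdFin M).filter (Single M)).card = 2 * ((bdFin M).filter (Tip M)).card := by
  rw [← Finset.card_filter_add_card_filter_not (s := (bdFin M).filter (Single M))
    (fun d => Bd M (sn M d)), two_mul]
  have hsd : ∀ {d}, Bd M d → SideDart M d := hM.sideDart_of_bd
  refine congrArg₂ (· + ·) ?_ ?_
  · refine Finset.card_bij' (fun d _ => sn M d) (fun d _ => opp M (sn M d)) ?_ ?_ ?_ ?_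
    · intro d hd
      simp only [Finset.mem_filter, mem_bdFin] at hd ⊢
      refine ⟨hd.2, hd.2, (hl d hd.1.2).1 hd.2, hd.1.2.2, ?_⟩
      have : opp M (sn M (sn M d)) = d := hM.opp_opp (hsd hd.1.1)
      rw [this]; exact hd.1.1
    · intro d hd
      simp only [Finset.mem_filter, mem_bdFin] at hd ⊢
      refine ⟨⟨hd.2.2.2.2, hd.2.2.2.2, ?_⟩, ?_⟩
      · rw [hM.opp_opp (hsd hd.2.2.2.1)]; exact hd.2.2.2.1
      · rw [sn_opp_sn hM (hsd hd.1)]; exact hd.1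
    · intro d hd
      simp only [Finset.mem_filter, mem_bdFin] at hd
      exact hM.opp_opp (hsd hd.1.1)
    · intro d hd
      simp only [Finset.mem_filter, mem_bdFin] at hd
      exact sn_opp_sn hM (hsd hd.1)
  · refine Finset.card_bij' (fun d _ => opp M (sn M d)) (fun d _ => sn M d) ?_ ?_ ?_ ?_
    · intro d hd
      simp only [Finset.mem_filter, mem_bdFin] at hd ⊢
      have h2 : Bd M (opp M (sn M d)) := by
        by_contra h2
        exact hd.2 ((hl d hd.1.2).2 h2)
      have hs := hsd hd.1.1
      refine ⟨h2, h2, ?_, ?_, ?_⟩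
      · rw [hM.opp_opp (hM.sideDart_sn hs)]; exact hd.2
      · rw [sn_opp_sn hM hs]; exact hd.1.1
      · rw [sn_opp_sn hM hs]; exact hd.1.2.2
    · intro d hd
      simp only [Finset.mem_filter, mem_bdFin] at hd ⊢
      exact ⟨⟨hd.2.2.2.1, hd.2.2.2⟩, hd.2.2.1⟩
    · intro d hd
      simp only [Finset.mem_filter, mem_bdFin] at hd
      exact sn_opp_sn hM (hsd hd.1.1)
    · intro d hd
      simp only [Finset.mem_filter, mem_bdFin] at hd
      exact hM.opp_opp (hsd hd.1)

/-- The tips are few compared to the boundary. -/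
theorem four_mul_tip_le (hc : CovConn M) (hne : M.Nonempty) (hl : LeafCond M)
    (hp : ∀ d, Bd M d → LeftTurn M (prv M d) → ang M d ≠ 5) :
    4 * ((bdFin M).filter (Tip M)).card ≤ (bdFin M).card + 6 := by
  have h1 := sum_ang_le hM hl hp
  have h2 := le_sum_ang hM hc hne
  omega

end

end KDoku

/-! ### Left turns enclose pockets, and a closed pocket is a hole. -/

namespace KDoku

open LDart IsDiag

variable {M : Finset LDart}

/-- Two uncovered darts are joined through uncovered triangles. -/
def UncovConn (M : Finset LDart) : Prop :=
  ∀ d e, ¬ Cov M d → ¬ Cov M e →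
    Relation.ReflTransGen (fun a b => b = nx a ∨ (b = rev a ∧ ¬ Cov M b)) d e

theorem nx_rev (d : LDart) : nx (rev d) = (d.1, d.2 + 5) := by
  simp only [nx, rev, dir_add_three, add_assoc, add_neg_cancel, add_zero]
  rfl

theorem rev_prv_of_ang_five {d : LDart} (h : ang M d = 5) : rev (prv M d) = nx (rev d) := by
  rw [prv, rev_rev, h, nx_rev]; rfl

theorem rev_prv_of_ang_four {d : LDart} (h : ang M d = 4) :
    rev (nx (nx (rev (prv M d)))) = nx (rev d) := by
  rw [prv, rev_rev, h, nx_rev, rev_nx_nx, rot, add_assoc]; rfl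

theorem cov_of_ang_five {d : LDart} (h : ang M d = 5) : Cov M (rev (nx (rev d))) := by
  rw [nx_rev, cov_rev_mk, add_sub_assoc, show (5 - 1 : Fin 6) = 4 from rfl]
  by_contra hc
  unfold ang runLen at h
  simp only [hc] at h
  split_ifs at h <;> simp_all

/-- Outside an angle 5 there is just one triangle; two of its sides are on the boundary, and it can
only be left through the third. Outside an angle 4 there are two triangles, the mouth of the pocket
so far being their common side. So the new triangle is added, and again one side of it remains as
the mouth. -/
theorem LeftTurn.exists_pocket {e : LDart} (h : LeftTurn M e) (hb : Bd M e) :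
    ∃ Z : Finset LDart, rev e ∈ Z ∧ (∀ z ∈ Z, nx z ∈ Z) ∧
      ∀ z ∈ Z, ¬ Cov M (rev z) → rev z ∈ Z ∨ z = nx (nx (rev e)) := by
  induction h with
  | @sharp e h =>
    refine ⟨{rev e, nx (rev e), nx (nx (rev e))}, by simp, ?_, ?_⟩
    · intro z hz
      simp only [Finset.mem_insert, Finset.mem_singleton] at hz ⊢
      rcases hz with rfl | rfl | rfl <;> simp
    · intro z hz hcz
      simp only [Finset.mem_insert, Finset.mem_singleton] at hz
      rcases hz with rfl | rfl | rfl
      · rw [rev_rev] at hcz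
        exact absurd hb.1 hcz
      · exact absurd (cov_of_ang_five h) hcz
      · exact Or.inr rfl
  | @blunt e h _ ih =>
    obtain ⟨Z, h1, h2, h3⟩ := ih (bd_prv hb)
    have hk := rev_prv_of_ang_four h
    refine ⟨Z ∪ {rev e, nx (rev e), nx (nx (rev e))}, by simp, ?_, ?_⟩
    · intro z hz
      simp only [Finset.mem_union, Finset.mem_insert, Finset.mem_singleton] at hz ⊢
      rcases hz with hz | rfl | rfl | rfl
      · exact Or.inl (h2 z hz)
      all_goals simp
    · intro z hz hcz
      simp only [Finset.mem_union, Finset.mem_insert, Finset.mem_singleton] at hz ⊢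
      rcases hz with hz | rfl | rfl | rfl
      · rcases h3 z hz hcz with h4 | rfl
        · exact Or.inl (Or.inl h4)
        · rw [hk]; simp
      · rw [rev_rev] at hcz
        exact absurd hb.1 hcz
      · rw [← hk, rev_rev]
        exact Or.inl (Or.inl (h2 _ (h2 _ h1)))
      · exact Or.inr rfl

/-- An angle 5 at the end of a left turn makes the mouth of the pocket the boundary side `rev d`.
The pocket is then a finite set of darts that cannot be left through uncovered triangles, although
uncovered darts exist outside it. -/
theorem ang_ne_five (hu : UncovConn M) {d : LDart} (hb : Bd M d)
    (h : LeftTurn M (prv M d)) : ang M d ≠ 5 := by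
  intro h5
  obtain ⟨Z, h1, h2, h3⟩ := h.exists_pocket (bd_prv hb)
  have h4 : ∀ z ∈ Z, ¬ Cov M (rev z) → rev z ∈ Z := fun z hz hcz => by
    rcases h3 z hz hcz with h | rfl
    · exact h
    · rw [rev_prv_of_ang_five h5, nx_nx_nx, rev_rev] at hcz
      exact absurd hb.1 hcz
  obtain ⟨e, he⟩ := Infinite.exists_notMem_finset (Z ∪ covFin M)
  rw [Finset.mem_union, mem_covFin, not_or] at he
  apply he.1
  have := hu (rev (prv M d)) e (bd_prv hb).2 he.2
  clear he
  induction this with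
  | refl => exact h1
  | tail _ hbc ih =>
    rcases hbc with rfl | ⟨rfl, hc⟩
    · exact h2 _ ih
    · exact h4 _ ih hc

end KDoku

/-! ### Strips, and the potential obtained from closing a strip in the complement. -/

namespace KDoku

open LDart IsDiag

variable {M : Finset LDart}

/-- The head of a dart. -/
def head (d : LDart) : ℤ × ℤ := d.1 + dir d.2

theorem exists_int_primitive (g : ℤ → ℤ) : ∃ f : ℤ → ℤ, f 0 = 0 ∧ ∀ i, f (i + 1) = f i + g i := by
  refine ⟨fun i => ∑ j ∈ Finset.Ico 0 i, g j - ∑ j ∈ Finset.Ico i 0, g j, by simp, fun i => ?_⟩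
  rcases lt_or_ge i 0 with h | h
  · have h1 : Finset.Ico i 0 = insert i (Finset.Ico (i + 1) 0) := by
      ext j; simp only [Finset.mem_insert, Finset.mem_Ico]; omega
    have h2 : Finset.Ico 0 i = ∅ := Finset.Ico_eq_empty (by omega)
    have h3 : Finset.Ico 0 (i + 1) = ∅ := Finset.Ico_eq_empty (by omega)
    simp only [h1, h2, h3]
    rw [Finset.sum_insert (by simp)]
    ring
  · have h1 : Finset.Ico 0 (i + 1) = insert i (Finset.Ico 0 i) := by
      ext j; simp only [Finset.mem_insert, Finset.mem_Ico]; omega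
    have h2 : Finset.Ico i 0 = ∅ := Finset.Ico_eq_empty (by omega)
    have h3 : Finset.Ico (i + 1) 0 = ∅ := Finset.Ico_eq_empty (by omega)
    simp only [h1, h2, h3]
    rw [Finset.sum_insert (by simp)]
    ring

/-- A function on darts that is antisymmetric and has sum zero on every triangle is the
differential of a function on the vertices. -/
theorem exists_potential (c : LDart → ℤ) (hrev : ∀ d, c (rev d) = -c d)
    (hdiv : ∀ d, c d + c (nx d) + c (nx (nx d)) = 0) :
    ∃ φ : ℤ × ℤ → ℤ, ∀ d, φ (head d) - φ d.1 = c d := by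
  obtain ⟨f, -, hf⟩ := exists_int_primitive fun x => c ((x, 0), 0)
  choose g hg0 hg using fun x => exists_int_primitive fun y => c ((x, y), 1)
  have hsq : ∀ x y, c ((x, y), 0) + c ((x + 1, y), 2) - c ((x, y), 1) = 0 ∧
      -- The two triangles that make up a fundamental parallelogram of the lattice.
      c ((x + 1, y), 1) - c ((x, y + 1), 0) - c ((x + 1, y), 2) = 0 := fun x y => by
    have h1 := hdiv ((x, y), 0)
    have h2 := hdiv ((x + 1, y), 1)
    have h3 := hrev ((x, y), 1)
    have h4 := hrev ((x, y + 1), 0)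
    have h5 := hrev ((x + 1, y), 2)
    simp [nx, rev, dir] at h1 h2 h3 h4 h5
    constructor <;> linarith
  let φ : ℤ × ℤ → ℤ := fun p => f p.1 + g p.1 p.2
  have hv : ∀ x y, φ (x, y + 1) - φ (x, y) = c ((x, y), 1) := fun x y => by
    simp only [φ, hg]; ring
  have hh : ∀ y x, φ (x + 1, y) - φ (x, y) = c ((x, y), 0) := by
    intro y
    -- `φ` is built by integrating along the row `y = 0` and along the columns. Horizontal edges in
    -- other rows are reached parallelogram by parallelogram.
    induction y using Int.induction_on with
    | zero => intro x; simp only [φ, hg0, hf]; ring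
    | succ i ih =>
      intro x
      have := hsq x i
      linarith [ih x, hv x i, hv (x + 1) i]
    | pred i ih =>
      intro x
      have h1 := hsq x (-i - 1)
      have h2 := hv x (-i - 1)
      have h3 := hv (x + 1) (-i - 1)
      rw [sub_add_cancel] at h1 h2 h3
      linarith [ih x]
  have hd : ∀ x y, φ (x - 1, y + 1) - φ (x, y) = c ((x, y), 2) := fun x y => by
    have := hsq (x - 1) y
    have h1 := hh y (x - 1)
    have h2 := hv (x - 1) y
    simp only [sub_add_cancel] at this h1
    linarith
  have hlow : ∀ d : LDart, d.2 < 3 → φ (head d) - φ d.1 = c d := by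
    rintro ⟨⟨x, y⟩, k⟩ hk
    have h3 : k = 0 ∨ k = 1 ∨ k = 2 := by
      have : ∀ k : Fin 6, k < 3 → k = 0 ∨ k = 1 ∨ k = 2 := by decide
      exact this k hk
    rcases h3 with rfl | rfl | rfl
    · rw [← hh]; simp [head, dir]
    · rw [← hv]; simp [head, dir]
    · rw [← hd]; simp [head, dir, sub_eq_add_neg]
  refine ⟨φ, fun d => ?_⟩
  by_cases hd : d.2 < 3
  · exact hlow d hd
  · have h : ∀ k : Fin 6, ¬ k < 3 → k + 3 < 3 := by decide
    have h1 := hlow (rev d) (h _ hd)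
    rw [hrev] at h1
    have h2 : head (rev d) = d.1 := by simp [head, rev, dir_add_three]
    have h3 : (rev d).1 = head d := rfl
    rw [h2, h3] at h1
    linarith

/-- The unit flow across the dart `d`, from right to left. -/
def unitFlow (d x : LDart) : ℤ := (if x = d then 1 else 0) - (if x = rev d then 1 else 0)

/-- The indicator function of the triangle on the left of `d`. -/
def triInd (d x : LDart) : ℤ :=
  (if x = d then 1 else 0) + (if x = nx d then 1 else 0) + (if x = nx (nx d) then 1 else 0)

theorem unitFlow_rev (d x : LDart) : unitFlow d (rev x) = -unitFlow d x := by
  have h1 : rev x = d ↔ x = rev d := ⟨fun h => by rw [← h, rev_rev], fun h => by rw [h, rev_rev]⟩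
  have h2 : rev x = rev d ↔ x = d := rev_injective.eq_iff
  simp only [unitFlow, h1, h2]; ring

theorem nx_eq_iff {x d : LDart} : nx x = d ↔ x = nx (nx d) :=
  ⟨fun h => by rw [← h, nx_nx_nx], fun h => by rw [h, nx_nx_nx]⟩

theorem unitFlow_div (d x : LDart) :
    unitFlow d x + unitFlow d (nx x) + unitFlow d (nx (nx x)) = triInd d x - triInd (rev d) x := by
  simp only [unitFlow, triInd, nx_eq_iff, nx_nx_nx]
  ring

theorem triInd_nx (d x : LDart) : triInd (nx d) x = triInd d x := by
  simp only [triInd, nx_nx_nx]; ring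

theorem triInd_nx_nx (d x : LDart) : triInd (nx (nx d)) x = triInd d x := by
  rw [triInd_nx, triInd_nx]

/-- A unit flow through uncovered triangles. -/
theorem exists_uncovered_flow (hu : UncovConn M) {d e : LDart} (hd : ¬ Cov M d)
    (he : ¬ Cov M e) : ∃ c : LDart → ℤ, (∀ x, c (rev x) = -c x) ∧ (∀ x, Cov M x → c x = 0) ∧
      ∀ x, c x + c (nx x) + c (nx (nx x)) = triInd e x - triInd d x := by
  have hr := hu d e hd he
  clear he
  suffices h : ¬ Cov M e ∧ ∃ c : LDart → ℤ, (∀ x, c (rev x) = -c x) ∧ (∀ x, Cov M x → c x = 0) ∧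
      ∀ x, c x + c (nx x) + c (nx (nx x)) = triInd e x - triInd d x from h.2
  induction hr with
  | refl => exact ⟨hd, fun _ => 0, by simp, by simp, by simp⟩
  | @tail a b _ hab ih =>
    obtain ⟨ha, c, h1, h2, h3⟩ := ih
    rcases hab with rfl | ⟨rfl, hb⟩
    · exact ⟨by rwa [cov_nx], c, h1, h2, fun x => by rw [h3, triInd_nx]⟩
    · refine ⟨hb, fun x => c x + unitFlow (rev a) x, ?_, ?_, ?_⟩
      · intro x; simp only [h1, unitFlow_rev]; ring
      · intro x hx
        have hxa : x ≠ a := by rintro rfl; exact ha hx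
        have hxb : x ≠ rev a := by rintro rfl; exact hb hx
        simp [h2 x hx, unitFlow, hxa, hxb]
      · intro x
        have h4 := unitFlow_div (rev a) x
        rw [rev_rev] at h4
        linarith [h3 x]

/-- `n` successive tiles from the boundary dart `s` to the opposite boundary. -/
def IsStrip (M : Finset LDart) (s : LDart) (n : ℕ) : Prop :=
  0 < n ∧ Bd M s ∧ (∀ i < n, SideDart M ((stp M)^[i] s)) ∧ Bd M (opp M ((stp M)^[n - 1] s))

/-- The entrance sides of the tiles in the strip. -/
def stripFin (M : Finset LDart) (s : LDart) (n : ℕ) : Finset LDart :=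
  (Finset.range n).image fun i => (stp M)^[i] s

theorem mem_stripFin {s x : LDart} {n : ℕ} :
    x ∈ stripFin M s n ↔ ∃ i < n, (stp M)^[i] s = x := by
  simp [stripFin]

namespace IsDiag

variable (hM : IsDiag M)
include hM

theorem stp_inj {a b : LDart} (ha : SideDart M a) (hb : SideDart M b) (h : stp M a = stp M b) :
    a = b := by
  have := rev_injective h
  rw [← hM.opp_opp ha, this, hM.opp_opp hb]

theorem stp_ne_bd {a s : LDart} (ha : SideDart M a) (hs : Bd M s) : stp M a ≠ s := by
  rintro rfl
  apply hs.2
  rw [stp, rev_rev]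
  exact (hM.sideDart_opp ha).1

/-- `stp` is injective on sides and never reaches a boundary side, so a strip can be traced back to
its unique entrance. -/
theorem iterate_stp_inj {s t : LDart} (hs : Bd M s) (ht : Bd M t) : ∀ {i j : ℕ},
    (∀ l < i, SideDart M ((stp M)^[l] s)) → (∀ l < j, SideDart M ((stp M)^[l] t)) →
    (stp M)^[i] s = (stp M)^[j] t → i = j ∧ s = t
  | 0, 0, _, _, h => ⟨rfl, h⟩
  | 0, j + 1, _, h2, h => by
    rw [Function.iterate_succ_apply'] at h
    exact absurd h.symm (hM.stp_ne_bd (h2 j (by omega)) hs)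
  | i + 1, 0, h1, _, h => by
    rw [Function.iterate_succ_apply'] at h
    exact absurd h (hM.stp_ne_bd (h1 i (by omega)) ht)
  | i + 1, j + 1, h1, h2, h => by
    rw [Function.iterate_succ_apply', Function.iterate_succ_apply'] at h
    have := iterate_stp_inj hs ht (fun l hl => h1 l (by omega)) (fun l hl => h2 l (by omega))
      (hM.stp_inj (h1 i (by omega)) (h2 j (by omega)) h)
    exact ⟨by omega, this.2⟩

theorem sideDart_stp {s : LDart} (h : SideDart M s) (h' : ¬ Bd M (opp M s)) :
    SideDart M (stp M s) := by
  have h1 := hM.sideDart_opp h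
  apply hM.sideDart_rev h1
  by_contra h2
  exact h' ⟨h1.1, h2⟩

/-- A strip that never reached the boundary would visit infinitely many distinct sides. -/
theorem exists_isStrip {s : LDart} (hs : Bd M s) : ∃ n, IsStrip M s n := by
  by_contra! hno
  have h : ∀ i, ∀ l < i + 1, SideDart M ((stp M)^[l] s) := by
    intro i
    induction i with
    | zero =>
      intro l hl
      obtain rfl : l = 0 := by omega
      exact hM.sideDart_of_bd hs
    | succ i ih =>
      intro l hl
      rcases Nat.lt_or_ge l (i + 1) with h | h
      · exact ih l h
      obtain rfl : l = i + 1 := by omega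
      rw [Function.iterate_succ_apply']
      refine hM.sideDart_stp (ih i (by omega)) fun hb => hno (i + 1) ?_
      exact ⟨by omega, hs, ih, hb⟩
  have h' : ∀ l, SideDart M ((stp M)^[l] s) := fun l => h l l (by omega)
  have hinj : Function.Injective fun l => (⟨(stp M)^[l] s, mem_covFin.2 (h' l).1⟩ : covFin M) :=
    fun i j hij => (hM.iterate_stp_inj hs hs (fun l _ => h' l) (fun l _ => h' l)
      (congrArg Subtype.val hij)).1
  exact not_injective_infinite_finite _ hinj

theorem snd_iterate_stp {s : LDart} : ∀ {i : ℕ}, (∀ l < i, SideDart M ((stp M)^[l] s)) →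
    ((stp M)^[i] s).2 = s.2
  | 0, _ => rfl
  | i + 1, h => by
    rw [Function.iterate_succ_apply', hM.snd_stp (h i (by omega)),
      snd_iterate_stp fun l hl => h l (by omega)]

end IsDiag

/-- The short diagonal in the triangle on the left of `d`. -/
def dg (M : Finset LDart) (d : LDart) : LDart :=
  if d ∈ M then d else if nx d ∈ M then nx d else nx (nx d)

theorem dg_mem {d : LDart} (h : Cov M d) : dg M d ∈ M := by
  unfold dg
  split_ifs with h1 h2
  · exact h1
  · exact h2
  · simpa [Cov, h1, h2] using h

theorem triInd_dg (d x : LDart) : triInd (dg M d) x = triInd d x := by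
  unfold dg
  split_ifs
  · rfl
  · rw [triInd_nx]
  · rw [triInd_nx_nx]

theorem IsDiag.triInd_rev_dg (hM : IsDiag M) {d : LDart} (h : SideDart M d) (x : LDart) :
    triInd (rev (dg M d)) x = triInd (opp M d) x := by
  obtain ⟨D, hD, rfl | rfl⟩ := hM.sideDart_cases h
  · rw [hM.opp_nx hD, triInd_nx, dg, if_neg h.2, nx_nx_nx, if_neg (hM.excl'' hD)]
  · rw [hM.opp_nx_nx hD, triInd_nx_nx, dg, if_neg h.2, nx_nx_nx, if_pos hD]

/-- Closing a strip through the uncovered part gives a function on the vertices that is constant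
along all the sides except those crossed by the strip. -/
theorem exists_strip_potential (hM : IsDiag M) (hu : UncovConn M) {s : LDart} {n : ℕ}
    (hs : IsStrip M s n) : ∃ φ : ℤ × ℤ → ℤ, ∀ x, SideDart M x → φ (head x) - φ x.1 =
      (if x ∈ stripFin M s n then 1 else 0) - (if opp M x ∈ stripFin M s n then 1 else 0) := by
  obtain ⟨hn, hb, hside, hend⟩ := hs
  set e : ℕ → LDart := fun i => (stp M)^[i] s with he
  have he1 : ∀ i, e (i + 1) = rev (opp M (e i)) := fun i => Function.iterate_succ_apply' _ _ _
  have hen : e n = rev (opp M (e (n - 1))) := by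
    rw [← he1]; congr 1; omega
  obtain ⟨c, hc1, hc2, hc3⟩ := exists_uncovered_flow hu (d := e n) (e := rev s)
    (by rw [hen]; exact hend.2) hb.2
  -- The flow along the strip crosses the sides `e 0, ..., e n` and, inside each tile, its short
  -- diagonal. It leads from the outer triangle at `rev s` to the outer triangle at `e n`; `c`
  -- brings it back outside the tiling.
  let c' : LDart → ℤ := fun x => ∑ i ∈ Finset.range (n + 1), unitFlow (e i) x +
    ∑ i ∈ Finset.range n, unitFlow (rev (dg M (e i))) x
  have hrev' : ∀ x, c' (rev x) = -c' x := fun x => by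
    simp only [c', unitFlow_rev, Finset.sum_neg_distrib]; ring
  have hdiv' : ∀ x, c' x + c' (nx x) + c' (nx (nx x)) = triInd (e n) x - triInd (rev s) x := by
    have key : ∀ l ≤ n, ∀ x,
        ∑ i ∈ Finset.range (l + 1), (triInd (e i) x - triInd (rev (e i)) x) +
        ∑ i ∈ Finset.range l, (triInd (rev (dg M (e i))) x - triInd (e i) x) =
        triInd (e l) x - triInd (rev s) x := by
      intro l
      induction l with
      | zero => intro _ x; simp [he]
      | succ l ih =>
        intro hl x
        rw [Finset.sum_range_succ (n := l + 1), Finset.sum_range_succ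
          (fun i => triInd (rev (dg M (e i))) x - triInd (e i) x)]
        have h1 := hM.triInd_rev_dg (hside l (by omega)) x
        have h2 : triInd (rev (e (l + 1))) x = triInd (opp M (e l)) x := by
          rw [he1, rev_rev]
        have h3 : triInd (rev (dg M (e l))) x = triInd (opp M (e l)) x := h1
        linarith [ih (by omega) x]
    intro x
    rw [← key n le_rfl x]
    simp only [c']
    have h1 : ∀ d, triInd (rev (dg M d)) x - triInd d x = unitFlow (rev (dg M d)) x +
        unitFlow (rev (dg M d)) (nx x) + unitFlow (rev (dg M d)) (nx (nx x)) := fun d => by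
      rw [unitFlow_div, rev_rev, triInd_dg]
    simp only [h1, ← unitFlow_div, Finset.sum_add_distrib]
    ring
  obtain ⟨φ, hφ⟩ := exists_potential (fun x => c x + c' x)
    (fun x => by simp only [hc1, hrev']; ring) (fun x => by linarith [hc3 x, hdiv' x])
  refine ⟨φ, fun x hx => ?_⟩
  rw [hφ, hc2 x hx.1, zero_add]
  -- The crossings of the diagonals are invisible along sides.
  have h0 : ∑ i ∈ Finset.range n, unitFlow (rev (dg M (e i))) x = 0 := by
    refine Finset.sum_eq_zero fun i hi => ?_
    have h1 := dg_mem (hside i (Finset.mem_range.1 hi)).1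
    have h2 : x ≠ dg M (e i) := fun h => hx.2 (h ▸ h1)
    have h3 : x ≠ rev (dg M (e i)) := fun h => hx.2 (h ▸ hM.rev_mem _ h1)
    simp [unitFlow, h2, h3]
  have hinj : ∀ i < n, ∀ j < n, e i = e j → i = j := fun i hi j hj h =>
    (hM.iterate_stp_inj hb hb (fun l hl => hside l (by omega)) (fun l hl => hside l (by omega)) h).1
  have hcount : ∀ y, ∑ i ∈ Finset.range n, (if y = e i then (1 : ℤ) else 0) =
      if y ∈ stripFin M s n then 1 else 0 := by
    intro y
    split_ifs with hy
    · obtain ⟨i, hi, rfl⟩ := mem_stripFin.1 hy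
      rw [Finset.sum_eq_single_of_mem i (Finset.mem_range.2 hi)]
      · exact if_pos rfl
      · intro j hj hji
        exact if_neg fun h => hji (hinj _ (Finset.mem_range.1 hj) _ hi h.symm)
    · refine Finset.sum_eq_zero fun i hi => if_neg ?_
      rintro rfl
      exact hy (mem_stripFin.2 ⟨i, Finset.mem_range.1 hi, rfl⟩)
  simp only [c', h0, add_zero]
  have h1 : ∑ i ∈ Finset.range (n + 1), unitFlow (e i) x =
      ∑ i ∈ Finset.range n, (if x = e i then (1 : ℤ) else 0) -
      ∑ i ∈ Finset.range n, (if opp M x = e i then (1 : ℤ) else 0) := by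
    simp only [unitFlow, Finset.sum_sub_distrib]
    congr 1
    · rw [Finset.sum_range_succ, if_neg, add_zero]
      rintro rfl
      rw [hen] at hx
      exact hend.2 hx.1
    · rw [Finset.sum_range_succ', if_neg, add_zero]
      · refine Finset.sum_congr rfl fun i hi => ?_
        have := hside i (Finset.mem_range.1 hi)
        rw [he1, rev_rev]
        congr 1
        rw [eq_iff_iff]
        constructor
        · rintro rfl; exact hM.opp_opp this
        · intro h; rw [← h, hM.opp_opp hx]
      · intro h
        have : x = rev s := h
        rw [this] at hx
        exact hb.2 hx.1
  rw [h1, hcount, hcount]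

end KDoku

/-! ### Cuts with two values, and the leaf condition. -/

namespace KDoku

open LDart IsDiag

variable {M : Finset LDart}

@[simp] theorem fst_nx (d : LDart) : (nx d).1 = head d := rfl

@[simp] theorem fst_rev (d : LDart) : (rev d).1 = head d := rfl

@[simp] theorem head_rev (d : LDart) : head (rev d) = d.1 := by
  rw [← fst_rev, rev_rev]

theorem head_nx_nx (d : LDart) : head (nx (nx d)) = d.1 := by
  rw [← fst_nx, nx_nx_nx]

namespace IsDiag

variable (hM : IsDiag M)
include hM

theorem fst_sn {x : LDart} (h : SideDart M x) : (sn M x).1 = head x := by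
  obtain ⟨D, hD, rfl | rfl⟩ := hM.sideDart_cases h
  · rw [sn_nx hD, fst_nx]
  · rw [hM.sn_nx_nx hD, fst_nx, head_rev, head_nx_nx]

theorem fst_opp {x : LDart} (h : SideDart M x) : (opp M x).1 = head (sn M x) :=
  hM.fst_sn (hM.sideDart_sn h)

theorem head_sn_opp {x : LDart} (h : SideDart M x) : head (sn M (opp M x)) = x.1 := by
  rw [← hM.fst_sn (hM.sideDart_sn (hM.sideDart_opp h))]
  exact congrArg Prod.fst (hM.opp_opp h)

theorem snd_sn {x : LDart} (h : SideDart M x) :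
    (sn M x).2 = x.2 + 1 ∨ (sn M x).2 = x.2 + 2 := by
  obtain ⟨D, hD, rfl | rfl⟩ := hM.sideDart_cases h
  · rw [sn_nx hD]; exact Or.inr rfl
  · rw [hM.sn_nx_nx hD]
    left
    simp only [nx, rev, add_assoc]
    rfl

theorem snd_sn_opp {x : LDart} (h : SideDart M x) :
    (sn M (opp M x)).2 = (sn M x).2 + 3 := hM.snd_opp (hM.sideDart_sn h)

end IsDiag

/-- The strip with the entrance sides `E`, of direction `k`, cuts the tiling into two sides, where
`φ` has the values `m` and `m + 1`. -/
structure IsCut (M E : Finset LDart) (k : Fin 6) (φ : ℤ × ℤ → ℤ) (m : ℤ) : Prop where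
  side : ∀ x ∈ E, SideDart M x
  snd : ∀ x ∈ E, x.2 = k
  diff : ∀ x, SideDart M x → φ (head x) - φ x.1 =
    (if x ∈ E then 1 else 0) - (if opp M x ∈ E then 1 else 0)
  base : ∀ x ∈ E, φ x.1 = m
  two : ∀ d, Cov M d → φ d.1 = m ∨ φ d.1 = m + 1

section
variable (hM : IsDiag M)
include hM

theorem not_mem_of_snd {E : Finset LDart} {k : Fin 6} (snd : ∀ x ∈ E, x.2 = k)
    (side : ∀ x ∈ E, SideDart M x)
    {x : LDart} (hx : x ∈ E) : opp M x ∉ E ∧ sn M x ∉ E ∧ opp M (sn M x) ∉ E := by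
  have hs := side x hx
  have key : ∀ k : Fin 6, k + 3 ≠ k ∧ k + 1 ≠ k ∧ k + 2 ≠ k ∧ k + 1 + 3 ≠ k ∧ k + 2 + 3 ≠ k := by
    decide
  have hk := snd x hx
  obtain ⟨h1, h2, h3, h4, h5⟩ := key k
  refine ⟨fun h => ?_, fun h => ?_, fun h => ?_⟩
  · have := snd _ h
    rw [hM.snd_opp hs, hk] at this
    exact h1 this
  · have := snd _ h
    rcases hM.snd_sn hs with h' | h' <;> rw [h', hk] at this
    exacts [h2 this, h3 this]
  · have := snd _ h
    rw [hM.snd_opp (hM.sideDart_sn hs)] at this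
    rcases hM.snd_sn hs with h' | h' <;> rw [h', hk] at this
    exacts [h4 this, h5 this]

/-- The values on a tile of the strip. -/
theorem values_of_mem {E : Finset LDart} {k : Fin 6} {φ : ℤ × ℤ → ℤ}
    (side : ∀ x ∈ E, SideDart M x) (snd : ∀ x ∈ E, x.2 = k)
    (diff : ∀ x, SideDart M x → φ (head x) - φ x.1 =
      (if x ∈ E then 1 else 0) - (if opp M x ∈ E then 1 else 0)) {x : LDart} (hx : x ∈ E) :
    φ (head x) = φ x.1 + 1 ∧ φ (sn M x).1 = φ x.1 + 1 ∧ φ (opp M x).1 = φ x.1 + 1 ∧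
      φ (sn M (opp M x)).1 = φ x.1 := by
  have hs := side x hx
  obtain ⟨h1, h2, h3⟩ := not_mem_of_snd hM snd side hx
  have d1 := diff x hs
  have d2 := diff _ (hM.sideDart_sn hs)
  have d3 := diff _ (hM.sideDart_opp hs)
  rw [if_pos hx, if_neg h1] at d1
  rw [if_neg h2, if_neg h3] at d2
  rw [hM.opp_opp hs, if_pos hx, if_neg h1] at d3
  rw [hM.fst_sn (hM.sideDart_opp hs), hM.fst_opp hs, hM.fst_sn hs] at *
  refine ⟨?_, ?_, ?_, ?_⟩ <;> linarith

/-- If no side of the tile lies in `E`, the potential is constant around it; otherwise the tile has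
two vertices on each side of the cut. -/
theorem eq_or_values {E : Finset LDart} {k : Fin 6} {φ : ℤ × ℤ → ℤ} {m : ℤ}
    (side : ∀ x ∈ E, SideDart M x) (snd : ∀ x ∈ E, x.2 = k)
    (diff : ∀ x, SideDart M x → φ (head x) - φ x.1 =
      (if x ∈ E then 1 else 0) - (if opp M x ∈ E then 1 else 0)) (base : ∀ x ∈ E, φ x.1 = m)
    {x : LDart} (hx : SideDart M x) :
    (φ (sn M x).1 = φ x.1 ∧ φ (opp M x).1 = φ x.1 ∧ φ (sn M (opp M x)).1 = φ x.1) ∨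
    ((φ x.1 = m ∨ φ x.1 = m + 1) ∧ (φ (sn M x).1 = m ∨ φ (sn M x).1 = m + 1) ∧
      (φ (opp M x).1 = m ∨ φ (opp M x).1 = m + 1) ∧
      (φ (sn M (opp M x)).1 = m ∨ φ (sn M (opp M x)).1 = m + 1)) := by
  have hoo := hM.opp_opp hx
  have e1 : opp M (sn M x) = sn M (opp M x) := rfl
  have e2 : sn M (sn M x) = opp M x := rfl
  have e3 : opp M (opp M (sn M x)) = sn M x := hM.opp_opp (hM.sideDart_sn hx)
  rw [e1] at e3
  have e4 : sn M (sn M (opp M x)) = x := hoo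
  by_cases h1 : x ∈ E
  · obtain ⟨-, a, b, c⟩ := values_of_mem hM side snd diff h1
    have := base x h1
    right; refine ⟨?_, ?_, ?_, ?_⟩ <;> omega
  by_cases h2 : opp M x ∈ E
  · obtain ⟨-, a, b, c⟩ := values_of_mem hM side snd diff h2
    rw [hoo] at b c
    have := base _ h2
    right; refine ⟨?_, ?_, ?_, ?_⟩ <;> omega
  by_cases h3 : sn M x ∈ E
  · obtain ⟨-, a, b, c⟩ := values_of_mem hM side snd diff h3
    rw [e1] at b c
    rw [e2] at a
    rw [e4] at c
    have := base _ h3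
    right; refine ⟨?_, ?_, ?_, ?_⟩ <;> omega
  by_cases h4 : sn M (opp M x) ∈ E
  · obtain ⟨-, a, b, c⟩ := values_of_mem hM side snd diff h4
    rw [e3] at b c
    rw [e4] at a
    rw [e2] at c
    have := base _ h4
    right; refine ⟨?_, ?_, ?_, ?_⟩ <;> omega
  left
  have d1 := diff x hx
  have d2 := diff _ (hM.sideDart_sn hx)
  have d3 := diff _ (hM.sideDart_opp hx)
  rw [if_neg h1, if_neg h2] at d1
  rw [e1, if_neg h3, if_neg h4] at d2
  rw [hoo, if_neg h1, if_neg h2] at d3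
  rw [hM.fst_sn (hM.sideDart_opp hx), hM.fst_opp hx, hM.fst_sn hx] at *
  refine ⟨?_, ?_, ?_⟩ <;> linarith

/-- The tails of the entrance sides are joined by sides that the strip does not cross, so they share
one value m. Passing from triangle to triangle, the values m and m + 1 are never left, since each
tile is either constant or has only these values. -/
theorem exists_isCut (hc : CovConn M) (hu : UncovConn M) {s : LDart} {n : ℕ}
    (hs : IsStrip M s n) : ∃ φ m, IsCut M (stripFin M s n) s.2 φ m := by
  obtain ⟨φ, diff⟩ := exists_strip_potential hM hu hs
  have side : ∀ x ∈ stripFin M s n, SideDart M x := fun x hx => by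
    obtain ⟨i, hi, rfl⟩ := mem_stripFin.1 hx
    exact hs.2.2.1 i hi
  have snd : ∀ x ∈ stripFin M s n, x.2 = s.2 := fun x hx => by
    obtain ⟨i, hi, rfl⟩ := mem_stripFin.1 hx
    exact hM.snd_iterate_stp fun l hl => hs.2.2.1 l (by omega)
  have base : ∀ x ∈ stripFin M s n, φ x.1 = φ s.1 := fun x hx => by
    obtain ⟨i, hi, rfl⟩ := mem_stripFin.1 hx
    clear hx
    induction i with
    | zero => rfl
    | succ i ih =>
      have hi' : (stp M)^[i] s ∈ stripFin M s n := mem_stripFin.2 ⟨i, by omega, rfl⟩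
      have := (values_of_mem hM side snd diff hi').2.2.2
      rw [hM.fst_sn (hM.sideDart_opp (side _ hi'))] at this
      rw [Function.iterate_succ_apply', stp, fst_rev, this, ih (by omega)]
  refine ⟨φ, φ s.1, side, snd, diff, base, fun d hd => ?_⟩
  have htri : ∀ d, Cov M d → (φ (nx d).1 = φ d.1 ∧ φ (nx (nx d)).1 = φ d.1) ∨
      ((φ d.1 = φ s.1 ∨ φ d.1 = φ s.1 + 1) ∧ (φ (nx d).1 = φ s.1 ∨ φ (nx d).1 = φ s.1 + 1) ∧
      (φ (nx (nx d)).1 = φ s.1 ∨ φ (nx (nx d)).1 = φ s.1 + 1)) := by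
    have hdiag : ∀ D ∈ M, (φ (nx D).1 = φ D.1 ∧ φ (nx (nx D)).1 = φ D.1) ∨
      ((φ D.1 = φ s.1 ∨ φ D.1 = φ s.1 + 1) ∧ (φ (nx D).1 = φ s.1 ∨ φ (nx D).1 = φ s.1 + 1) ∧
      (φ (nx (nx D)).1 = φ s.1 ∨ φ (nx (nx D)).1 = φ s.1 + 1)) := fun D hD => by
      have hx := hM.sideDart_nx hD
      have := eq_or_values hM side snd diff base hx
      rw [sn_nx hD, hM.opp_nx hD] at this
      simp only [fst_nx, head_rev] at this ⊢
      rcases this with ⟨a, b, c⟩ | ⟨a, b, c, -⟩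
      · left; constructor <;> omega
      · right; exact ⟨c, a, b⟩
    rintro d (h | h | h)
    · exact hdiag d h
    · have := hdiag _ h
      rw [nx_nx_nx] at this
      rcases this with ⟨a, b⟩ | ⟨a, b, c⟩
      · left; constructor <;> omega
      · right; exact ⟨c, a, b⟩
    · have := hdiag _ h
      rw [nx_nx_nx] at this
      rcases this with ⟨a, b⟩ | ⟨a, b, c⟩
      · left; constructor <;> omega
      · right; exact ⟨b, c, a⟩
  have hr := hc s d hs.2.1.1 hd
  clear hd
  suffices h : Cov M d ∧ (φ d.1 = φ s.1 ∨ φ d.1 = φ s.1 + 1) ∧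
      (φ (nx d).1 = φ s.1 ∨ φ (nx d).1 = φ s.1 + 1) ∧
      (φ (nx (nx d)).1 = φ s.1 ∨ φ (nx (nx d)).1 = φ s.1 + 1) from h.2.1
  induction hr with
  | refl =>
    refine ⟨hs.2.1.1, Or.inl rfl, ?_⟩
    rcases htri s hs.2.1.1 with ⟨a, b⟩ | ⟨-, a⟩
    · exact ⟨Or.inl a, Or.inl b⟩
    · exact a
  | @tail a b _ hab ih =>
    obtain ⟨hca, h1, h2, h3⟩ := ih
    rcases hab with rfl | ⟨rfl, hcb⟩
    · exact ⟨(cov_nx a).2 hca, h2, h3, by rwa [nx_nx_nx]⟩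
    · refine ⟨hcb, h2, ?_⟩
      rcases htri _ hcb with ⟨a, b⟩ | ⟨-, a⟩
      · rw [a, b]; exact ⟨h2, h2⟩
      · exact a

end

/-- The four vertices of the tile with the short diagonal `d`. -/
def tileVerts (d : LDart) : Finset (ℤ × ℤ) := {d.1, head d, (nx (nx d)).1, (nx (nx (rev d))).1}

/-- After the removal of a tile, the rest is connected through common vertices. -/
def RemoveConn (M : Finset LDart) : Prop :=
  ∀ D ∈ M, ∀ a ∈ M, ∀ b ∈ M, a ≠ D → a ≠ rev D → b ≠ D → b ≠ rev D →
    Relation.ReflTransGen (fun a b => b ∈ M ∧ b ≠ D ∧ b ≠ rev D ∧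
      (tileVerts a ∩ tileVerts b).Nonempty) a b

theorem isStrip_one (hM : IsDiag M) {d : LDart} (h : Single M d) : IsStrip M d 1 :=
  ⟨one_pos, h.1, fun i hi => by
    obtain rfl : i = 0 := by omega
    exact hM.sideDart_of_bd h.1, h.2⟩

theorem stripFin_one (d : LDart) : stripFin M d 1 = {d} := by simp [stripFin]

theorem tile_const (hM : IsDiag M) {φ : ℤ × ℤ → ℤ} {D : LDart} (hD : D ∈ M)
    (h : ∀ x, SideDart M x → (x = nx D ∨ x = nx (nx D) ∨ x = nx (rev D) ∨ x = nx (nx (rev D))) →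
      φ (head x) = φ x.1) : ∀ v ∈ tileVerts D, φ v = φ D.1 := by
  have hD' := hM.rev_mem D hD
  have h1 := h _ (hM.sideDart_nx hD) (by simp)
  have h2 := h _ (hM.sideDart_nx_nx hD) (by simp)
  have h3 := h _ (hM.sideDart_nx hD') (by simp)
  rw [head_nx_nx] at h2
  simp only [fst_nx, head_rev] at h1 h2 h3
  intro v hv
  simp only [tileVerts, Finset.mem_insert, Finset.mem_singleton, fst_nx] at hv
  rcases hv with rfl | rfl | rfl | rfl
  · rfl
  · rw [← h1, h2]
  · rw [h2]
  · rw [h3]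

theorem normDart_eq {a b : LDart} (h : normDart a = normDart b) : a = b ∨ a = rev b := by
  unfold normDart at h
  split_ifs at h
  · exact Or.inl h
  · exact Or.inr h
  · exact Or.inr (by rw [← h, rev_rev])
  · exact Or.inl (rev_injective h)

theorem head_mem_tileVerts_dg (d : LDart) : head d ∈ tileVerts (dg M d) := by
  unfold dg tileVerts
  split_ifs
  · simp
  · simp
  · simp

namespace IsDiag

variable (hM : IsDiag M)
include hM

theorem diag_nx_of_mem {D : LDart} (h : D ∈ M) : diag M (nx D) = normDart D := by
  rw [hM.diag_nx (Or.inl h), diag_of_mem h]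

theorem diag_nx_nx_of_mem {D : LDart} (h : D ∈ M) : diag M (nx (nx D)) = normDart D := by
  rw [hM.diag_nx ((cov_nx D).2 (Or.inl h)), hM.diag_nx_of_mem h]

theorem diag_sn {x : LDart} (h : SideDart M x) : diag M (sn M x) = diag M x := by
  obtain ⟨D, hD, rfl | rfl⟩ := hM.sideDart_cases h
  · rw [sn_nx hD, hM.diag_nx_nx_of_mem hD, hM.diag_nx_of_mem hD]
  · rw [hM.sn_nx_nx hD, hM.diag_nx_nx_of_mem hD, hM.diag_nx_of_mem (hM.rev_mem D hD), normDart_rev]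

theorem diag_opp {x : LDart} (h : SideDart M x) : diag M (opp M x) = diag M x := by
  rw [opp, hM.diag_sn (hM.sideDart_sn h), hM.diag_sn h]

/-- The four sides of a tile. -/
theorem eq_of_diag_eq {x y : LDart} (hx : SideDart M x) (hy : SideDart M y)
    (h : diag M y = diag M x) : y = x ∨ y = sn M x ∨ y = opp M x ∨ y = opp M (sn M x) := by
  obtain ⟨A, hA, ha⟩ := hM.sideDart_cases hx
  obtain ⟨B, hB, hb⟩ := hM.sideDart_cases hy
  have hA' := hM.rev_mem A hA
  have hd : normDart B = normDart A := by
    have h1 : diag M x = normDart A := by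
      rcases ha with rfl | rfl
      exacts [hM.diag_nx_of_mem hA, hM.diag_nx_nx_of_mem hA]
    have h2 : diag M y = normDart B := by
      rcases hb with rfl | rfl
      exacts [hM.diag_nx_of_mem hB, hM.diag_nx_nx_of_mem hB]
    rw [← h1, ← h2, h]
  have hsn : sn M (nx A) = nx (nx A) := sn_nx hA
  rcases ha with rfl | rfl
  · rw [hM.opp_nx hA, hsn, hM.opp_nx_nx hA]
    rcases normDart_eq hd with rfl | rfl <;> rcases hb with rfl | rfl <;> simp
  · rw [hM.opp_nx_nx hA, hM.sn_nx_nx hA, hM.opp_nx hA', rev_rev]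
    rcases normDart_eq hd with rfl | rfl <;> rcases hb with rfl | rfl <;> simp

omit hM in
theorem fst_ne_head (d : LDart) : d.1 ≠ head d := by
  have : ∀ k, dir k ≠ 0 := by decide
  simp only [head, ne_eq, left_eq_add]
  exact this _

theorem diag_rev_ne {x : LDart} (hx : SideDart M x) (h : Cov M (rev x)) :
    diag M (rev x) ≠ diag M x := by
  intro he
  have hk : ∀ k : Fin 6, k + 3 ≠ k ∧ k + 3 ≠ k + 1 ∧ k + 3 ≠ k + 2 ∧ k + 3 ≠ k + 1 + 3 ∧
    k + 3 ≠ k + 2 + 3 := by decide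
  obtain ⟨h1, h2, h3, h4, h5⟩ := hk x.2
  rcases hM.eq_of_diag_eq hx (hM.sideDart_rev hx h) he with h' | h' | h' | h'
  · exact h1 (congrArg Prod.snd h')
  · have h6 := hM.snd_sn hx
    rw [← h'] at h6
    exact h6.elim h2 h3
  · have h6 := congrArg Prod.fst h'
    rw [fst_rev, hM.fst_opp hx, ← hM.fst_sn hx] at h6
    exact fst_ne_head _ h6
  · have h6 := hM.snd_sn hx
    have h7 := hM.snd_opp (hM.sideDart_sn hx)
    rw [← h'] at h7
    change x.2 + 3 = _ at h7
    rcases h6 with h6 | h6 <;> rw [h6] at h7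
    exacts [h4 h7, h5 h7]

end IsDiag

/-- If both remaining sides of the tile were free, it would be isolated. If both were shared, its
removal would disconnect the tiling: the cut through this one tile has a potential which is constant
on every other tile, but differs between the neighbours on the two sides. -/
theorem leafCond (hM : IsDiag M) (hc : CovConn M) (hu : UncovConn M) (hr : RemoveConn M)
    (h2 : ∀ D ∈ M, ∃ D' ∈ M, D' ≠ D ∧ D' ≠ rev D) : LeafCond M := by
  intro d hd
  have hs := hM.sideDart_of_bd hd.1
  have hs1 := hM.sideDart_sn hs
  have hs3 := hM.sideDart_opp hs1
  have hDM := dg_mem hs.1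
  have hdd : diag M d = normDart (dg M d) := rfl
  set D := dg M d with hDdef
  have hnorm : ∀ {B}, normDart B ≠ diag M d → B ≠ D ∧ B ≠ rev D := fun {B} h => by
    rw [hdd] at h
    refine ⟨fun h' => h (by rw [h']), fun h' => h (by rw [h', normDart_rev])⟩
  constructor
  · intro h1 h3
    obtain ⟨D', hD'M, hne, hne'⟩ := h2 D hDM
    -- With four boundary sides, a path of covered triangles never leaves the tile.
    have hcl : Cov M D' ∧ diag M D' = diag M d := by
      have hpath := hc d D' hd.1.1 (Or.inl hD'M)
      clear hne hne' hD'M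
      induction hpath with
      | refl => exact ⟨hd.1.1, rfl⟩
      | @tail a b _ hab ih =>
        obtain ⟨hca, ih⟩ := ih
        rcases hab with rfl | ⟨rfl, hcv⟩
        · exact ⟨(cov_nx a).2 hca, by rw [hM.diag_nx hca, ih]⟩
        · refine ⟨hcv, ?_⟩
          by_cases haM : a ∈ M
          · rw [diag_of_mem (hM.rev_mem a haM), normDart_rev, ← diag_of_mem haM, ih]
          · rcases hM.eq_of_diag_eq hs ⟨hca, haM⟩ ih with rfl | rfl | rfl | rfl
            exacts [absurd hcv hd.1.2, absurd hcv h1.2, absurd hcv hd.2.2, absurd hcv h3.2]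
    rw [diag_of_mem hD'M] at hcl
    rcases normDart_eq hcl.2 with h | h
    exacts [hne h, hne' h]
  · intro h3
    by_contra h1
    obtain ⟨φ, m, hcut⟩ := exists_isCut hM hc hu (isStrip_one hM hd)
    rw [stripFin_one] at hcut
    have hconst : ∀ D' ∈ M, D' ≠ D → D' ≠ rev D → ∀ v ∈ tileVerts D', φ v = φ D'.1 := by
      intro D' hD' hne hne'
      refine tile_const hM hD' fun x hx hxD => ?_
      have hD'r := hM.rev_mem D' hD'
      have hdx : diag M x = normDart D' := by
        rcases hxD with rfl | rfl | rfl | rfl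
        · exact hM.diag_nx_of_mem hD'
        · exact hM.diag_nx_nx_of_mem hD'
        · rw [hM.diag_nx_of_mem hD'r, normDart_rev]
        · rw [hM.diag_nx_nx_of_mem hD'r, normDart_rev]
      have hno : diag M x ≠ diag M d := by
        rw [hdx]
        intro h
        rcases normDart_eq h with h | h
        exacts [hne h, hne' h]
      have hxd : x ≠ d := fun h => hno (by rw [h])
      have hxo : opp M x ≠ d := fun h => hno (by rw [← h, hM.diag_opp hx])
      have := hcut.diff x hx
      rw [if_neg (by simpa using hxd), if_neg (by simpa using hxo)] at this
      linarith
    have hcase : ∀ x, SideDart M x → diag M x = diag M d → ¬ Bd M x →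
        ∃ B ∈ M, B ≠ D ∧ B ≠ rev D ∧ x.1 ∈ tileVerts B := by
      intro x hsx hx hnb
      have hcr : Cov M (rev x) := by
        by_contra hh
        exact hnb ⟨hsx.1, hh⟩
      have hne := hM.diag_rev_ne hsx hcr
      rw [hx] at hne
      have := hnorm hne
      refine ⟨_, dg_mem hcr, this.1, this.2, ?_⟩
      have := head_mem_tileVerts_dg (M := M) (rev x)
      rwa [head_rev] at this
    obtain ⟨A, hA, hA1, hA2, hAv⟩ := hcase _ hs1 (hM.diag_sn hs) h1
    obtain ⟨B, hB, hB1, hB2, hBv⟩ := hcase _ hs3 (by rw [hM.diag_opp hs1, hM.diag_sn hs]) h3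
    have hval := values_of_mem hM hcut.side hcut.snd hcut.diff (Finset.mem_singleton_self d)
    have hpath := hr D hDM A hA B hB hA1 hA2 hB1 hB2
    -- Tiles with a common vertex have equal constants, and the path avoids the removed tile.
    have : B ∈ M ∧ B ≠ D ∧ B ≠ rev D ∧ φ B.1 = φ A.1 := by
      clear hBv hB1 hB2 hB
      induction hpath with
      | refl => exact ⟨hA, hA1, hA2, rfl⟩
      | tail _ hab ih =>
        obtain ⟨i1, i2, i3, i4⟩ := ih
        obtain ⟨j1, j2, j3, v, hv⟩ := hab
        rw [Finset.mem_inter] at hv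
        exact ⟨j1, j2, j3, by rw [← hconst _ j1 j2 j3 v hv.2, hconst _ i1 i2 i3 v hv.1, i4]⟩
    have e1 := hconst A hA hA1 hA2 _ hAv
    have e2 := hconst B hB hB1 hB2 _ hBv
    have e3 : φ (opp M (sn M d)).1 = φ d.1 := hval.2.2.2
    linarith [hval.2.1, this.2.2.2]

end KDoku

/-! ### Lattice tilings and the counting of strips. -/

namespace KDoku

open LDart IsDiag

variable {M : Finset LDart} {κ : ℕ}

/-- A doku tiling of the triangular lattice without holes, given by its short diagonals. -/
structure IsPatch (κ : ℕ) (M : Finset LDart) : Prop extends IsDiag M where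
  nonempty : M.Nonempty
  exists_other : ∀ D ∈ M, ∃ D' ∈ M, D' ≠ D ∧ D' ≠ rev D
  covConn : CovConn M
  uncovConn : UncovConn M
  removeConn : RemoveConn M
  length : ∀ s n, IsStrip M s n → n ≠ 1 → n = κ

/-- The height of a vertex above a line of direction `k`. -/
def hgt (k : Fin 6) (v : ℤ × ℤ) : ℤ :=
  ![v.2, -v.1, -v.1 - v.2, -v.2, v.1, v.1 + v.2] k

theorem hgt_add_dir (k : Fin 6) (v : ℤ × ℤ) :
    hgt k (v + dir (k + 4)) = hgt k v - 1 ∧ hgt k (v + dir (k + 5)) = hgt k v - 1 := by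
  fin_cases k <;> simp [hgt, dir] <;> (try constructor) <;> ring

namespace IsDiag

variable (hM : IsDiag M)
include hM

theorem fst_stp {x : LDart} (h : SideDart M x) : (stp M x).1 = (sn M (opp M x)).1 := by
  rw [stp, fst_rev, hM.fst_sn (hM.sideDart_opp h)]

theorem hgt_stp {x : LDart} (h : SideDart M x) : hgt x.2 (stp M x).1 = hgt x.2 x.1 + 1 := by
  have h1 : x.1 = (stp M x).1 + dir (sn M (opp M x)).2 := by
    rw [hM.fst_stp h]; exact (hM.head_sn_opp h).symm
  have h2 := hgt_add_dir x.2 (stp M x).1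
  have h3 : (sn M (opp M x)).2 = x.2 + 4 ∨ (sn M (opp M x)).2 = x.2 + 5 := by
    rw [hM.snd_sn_opp h]
    rcases hM.snd_sn h with h | h <;> rw [h, add_assoc]
    exacts [Or.inl rfl, Or.inr rfl]
  rcases h3 with h3 | h3 <;> rw [h3] at h1
  · rw [← h1] at h2; linarith [h2.1]
  · rw [← h1] at h2; linarith [h2.2]

theorem opp_rev_pred {x : LDart} (h : SideDart M x) (hb : ¬ Bd M x) :
    SideDart M (opp M (rev x)) ∧ stp M (opp M (rev x)) = x := by
  have hc : Cov M (rev x) := by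
    by_contra hc
    exact hb ⟨h.1, hc⟩
  have hr := hM.sideDart_rev h hc
  exact ⟨hM.sideDart_opp hr, by rw [stp, hM.opp_opp hr, rev_rev]⟩

/-- Every side belongs to a strip that starts at the boundary. -/
theorem exists_start {x : LDart} (h : SideDart M x) : ∃ s i, Bd M s ∧
    (∀ l ≤ i, SideDart M ((stp M)^[l] s)) ∧ (stp M)^[i] s = x := by
  classical
  by_contra hbad
  let P : LDart → Prop := fun y => y.2 = x.2 ∧ SideDart M y ∧ ¬ ∃ s i, Bd M s ∧
    (∀ l ≤ i, SideDart M ((stp M)^[l] s)) ∧ (stp M)^[i] s = y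
  -- Each step along a strip raises `hgt` by 1, so strips do not close up to rings. The predecessor
  -- of a lowest side without an entrance is lower and has an entrance.
  obtain ⟨y, hy, hmin⟩ := Finset.exists_min_image ((covFin M).filter P) (fun y => hgt x.2 y.1)
    ⟨x, Finset.mem_filter.2 ⟨mem_covFin.2 h.1, rfl, h, hbad⟩⟩
  obtain ⟨-, hy2, hy, hyb⟩ := Finset.mem_filter.1 hy
  have hb : ¬ Bd M y := fun hb => hyb ⟨y, 0, hb, by simpa using hy, rfl⟩
  obtain ⟨h1, h2⟩ := hM.opp_rev_pred hy hb
  set z := opp M (rev y)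
  have hz2 : z.2 = x.2 := by rw [← hy2, ← h2, hM.snd_stp h1]
  have hlt := hM.hgt_stp h1
  rw [h2, hz2] at hlt
  by_cases hz : P z
  · have := hmin z (Finset.mem_filter.2 ⟨mem_covFin.2 h1.1, hz⟩)
    omega
  · simp only [P, not_and, not_not] at hz
    obtain ⟨s, i, a, b, c⟩ := hz hz2 h1
    refine hyb ⟨s, i + 1, a, fun l hl => ?_, by rw [Function.iterate_succ_apply', c, h2]⟩
    rcases Nat.lt_or_ge i l with h | h
    · obtain rfl : l = i + 1 := by omega
      rw [Function.iterate_succ_apply', c, h2]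
      exact hy
    · exact b l h

end IsDiag

theorem IsStrip.iterate_not_side {s : LDart} {n : ℕ} (hs : IsStrip M s n) :
    ¬ SideDart M ((stp M)^[n] s) := by
  obtain ⟨hn, -, -, hb⟩ := hs
  obtain ⟨m, rfl⟩ : ∃ m, n = m + 1 := ⟨n - 1, by omega⟩
  rw [Function.iterate_succ_apply']
  exact fun h => hb.2 h.1

theorem IsDiag.exists_mem_stripFin (hM : IsDiag M) {x : LDart} (h : SideDart M x) :
    ∃ s n, IsStrip M s n ∧ x ∈ stripFin M s n := by
  obtain ⟨s, i, h1, h2, h3⟩ := hM.exists_start h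
  obtain ⟨n, hn⟩ := hM.exists_isStrip h1
  refine ⟨s, n, hn, mem_stripFin.2 ⟨i, ?_, h3⟩⟩
  by_contra hlt
  exact hn.iterate_not_side (h2 n (by omega))

/-- The length of the strip from `s`. -/
def slen (M : Finset LDart) (κ : ℕ) (s : LDart) : ℕ := if Single M s then 1 else κ

theorem IsStrip.single {s : LDart} (h : IsStrip M s 1) : Single M s := ⟨h.2.1, h.2.2.2⟩

theorem IsStrip.length_unique {s : LDart} {n m : ℕ} (h : IsStrip M s n)
    (h' : IsStrip M s m) : n = m := by
  rcases lt_trichotomy n m with hl | hl | hl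
  · exact absurd (h'.2.2.1 n hl) h.iterate_not_side
  · exact hl
  · exact absurd (h.2.2.1 m hl) h'.iterate_not_side

theorem card_stripFin (hM : IsDiag M) {s : LDart} {n : ℕ} (h : IsStrip M s n) :
    (stripFin M s n).card = n := by
  rw [stripFin, Finset.card_image_of_injOn, Finset.card_range]
  intro i hi j hj hij
  have hi := Finset.mem_range.1 (Finset.mem_coe.1 hi)
  have hj := Finset.mem_range.1 (Finset.mem_coe.1 hj)
  exact (hM.iterate_stp_inj h.2.1 h.2.1 (fun l hl => h.2.2.1 l (by omega))
    (fun l hl => h.2.2.1 l (by omega)) hij).1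

namespace IsStrip

theorem side {s : LDart} {n : ℕ} (h : IsStrip M s n) {x : LDart} (hx : x ∈ stripFin M s n) :
    SideDart M x := by
  obtain ⟨i, hi, rfl⟩ := mem_stripFin.1 hx
  exact h.2.2.1 i hi

theorem snd (hM : IsDiag M) {s : LDart} {n : ℕ} (h : IsStrip M s n) {x : LDart}
    (hx : x ∈ stripFin M s n) : x.2 = s.2 := by
  obtain ⟨i, hi, rfl⟩ := mem_stripFin.1 hx
  exact hM.snd_iterate_stp fun l hl => h.2.2.1 l (by omega)

theorem eq_start (hM : IsDiag M) {s s' : LDart} {n n' : ℕ} (h : IsStrip M s n)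
    (h' : IsStrip M s' n') {x : LDart} (hx : x ∈ stripFin M s n) (hx' : x ∈ stripFin M s' n') :
    s = s' := by
  obtain ⟨i, hi, rfl⟩ := mem_stripFin.1 hx
  obtain ⟨j, hj, hij⟩ := mem_stripFin.1 hx'
  exact (hM.iterate_stp_inj h.2.1 h'.2.1 (fun l hl => h.2.2.1 l (by omega))
    (fun l hl => h'.2.2.1 l (by omega)) hij.symm).2

end IsStrip

theorem Single.opp (hM : IsDiag M) {d : LDart} (h : Single M d) : Single M (opp M d) :=
  ⟨h.2, by rw [hM.opp_opp (hM.sideDart_of_bd h.1)]; exact h.1⟩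

/-- The entrances of the long strips of direction `k`. -/
def longFin (M : Finset LDart) (k : Fin 6) : Finset LDart :=
  (bdFin M).filter fun s => ¬ Single M s ∧ s.2 = k

theorem mem_longFin {k : Fin 6} {s : LDart} :
    s ∈ longFin M k ↔ Bd M s ∧ ¬ Single M s ∧ s.2 = k := by
  rw [longFin, Finset.mem_filter, mem_bdFin]

/-- The entrances of the strips of length one and direction `k`. -/
def shortFin (M : Finset LDart) (k : Fin 6) : Finset LDart :=
  (bdFin M).filter fun s => Single M s ∧ s.2 = k

theorem mem_shortFin {k : Fin 6} {s : LDart} :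
    s ∈ shortFin M k ↔ Single M s ∧ s.2 = k := by
  rw [shortFin, Finset.mem_filter, mem_bdFin]
  exact ⟨fun h => h.2, fun h => ⟨h.1.1, h⟩⟩

/-- The sides of direction `k`. -/
def sideFin (M : Finset LDart) (k : Fin 6) : Finset LDart :=
  (covFin M).filter fun s => SideDart M s ∧ s.2 = k

theorem mem_sideFin {k : Fin 6} {s : LDart} : s ∈ sideFin M k ↔ SideDart M s ∧ s.2 = k := by
  rw [sideFin, Finset.mem_filter, mem_covFin]
  exact ⟨fun h => h.2, fun h => ⟨h.1.1, h⟩⟩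

theorem card_sideFin_add_three (hM : IsDiag M) (k : Fin 6) :
    (sideFin M (k + 3)).card = (sideFin M k).card := by
  have h6 : k + 3 + 3 = k := by rw [add_assoc, show (3 + 3 : Fin 6) = 0 from rfl, add_zero]
  refine Finset.card_bij' (fun x _ => opp M x) (fun x _ => opp M x) ?_ ?_ ?_ ?_
  · intro x hx
    rw [mem_sideFin] at hx ⊢
    exact ⟨hM.sideDart_opp hx.1, by rw [hM.snd_opp hx.1, hx.2, h6]⟩
  · intro x hx
    rw [mem_sideFin] at hx ⊢
    exact ⟨hM.sideDart_opp hx.1, by rw [hM.snd_opp hx.1, hx.2]⟩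
  · exact fun x hx => hM.opp_opp (mem_sideFin.1 hx).1
  · exact fun x hx => hM.opp_opp (mem_sideFin.1 hx).1

theorem card_shortFin_add_three (hM : IsDiag M) (k : Fin 6) :
    (shortFin M (k + 3)).card = (shortFin M k).card := by
  have h6 : k + 3 + 3 = k := by rw [add_assoc, show (3 + 3 : Fin 6) = 0 from rfl, add_zero]
  have hs : ∀ {x}, Single M x → SideDart M x := fun h => hM.sideDart_of_bd h.1
  refine Finset.card_bij' (fun x _ => opp M x) (fun x _ => opp M x) ?_ ?_ ?_ ?_
  · intro x hx
    rw [mem_shortFin] at hx ⊢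
    exact ⟨hx.1.opp hM, by rw [hM.snd_opp (hs hx.1), hx.2, h6]⟩
  · intro x hx
    rw [mem_shortFin] at hx ⊢
    exact ⟨hx.1.opp hM, by rw [hM.snd_opp (hs hx.1), hx.2]⟩
  · exact fun x hx => hM.opp_opp (hs (mem_shortFin.1 hx).1)
  · exact fun x hx => hM.opp_opp (hs (mem_shortFin.1 hx).1)

theorem card_sum_dir (s : Finset LDart) : s.card = ∑ k, (s.filter fun d => d.2 = k).card := by
  rw [Finset.card_eq_sum_card_fiberwise (f := Prod.snd) (t := Finset.univ)]
  exact fun _ _ => Finset.mem_coe.2 (Finset.mem_univ _)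

namespace IsPatch

variable (hP : IsPatch κ M)
include hP

theorem leafCond : LeafCond M :=
  KDoku.leafCond hP.toIsDiag hP.covConn hP.uncovConn hP.removeConn hP.exists_other

theorem isStrip {s : LDart} (hs : Bd M s) : IsStrip M s (slen M κ s) := by
  obtain ⟨n, hn⟩ := hP.toIsDiag.exists_isStrip hs
  unfold slen
  split_ifs with h
  · exact isStrip_one hP.toIsDiag h
  · have : n ≠ 1 := by rintro rfl; exact h hn.single
    rwa [← hP.length s n hn this]

theorem isStrip_long {s : LDart} (hs : Bd M s) (h : ¬ Single M s) : IsStrip M s κ := by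
  have := hP.isStrip hs
  rwa [slen, if_neg h] at this

/-- The strips that enter in direction `k` partition the sides of direction `k`. -/
theorem card_sideFin (k : Fin 6) :
    (sideFin M k).card = κ * (longFin M k).card + (shortFin M k).card := by
  have hM := hP.toIsDiag
  have h1 : sideFin M k = ((bdFin M).filter fun s => s.2 = k).biUnion
      fun s => stripFin M s (slen M κ s) := by
    ext x
    rw [mem_sideFin, Finset.mem_biUnion]
    constructor
    · rintro ⟨hx, hk⟩
      obtain ⟨s, n, hs, hxs⟩ := hM.exists_mem_stripFin hx
      have hn := hs.length_unique (hP.isStrip hs.2.1)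
      refine ⟨s, Finset.mem_filter.2 ⟨mem_bdFin.2 hs.2.1, ?_⟩, hn ▸ hxs⟩
      rw [← hk, hs.snd hM hxs]
    · rintro ⟨s, hs, hx⟩
      rw [Finset.mem_filter, mem_bdFin] at hs
      have := hP.isStrip hs.1
      exact ⟨this.side hx, by rw [this.snd hM hx, hs.2]⟩
  rw [h1, Finset.card_biUnion]
  · have h2 : ∀ s ∈ (bdFin M).filter fun s => s.2 = k,
        (stripFin M s (slen M κ s)).card = if Single M s then 1 else κ := fun s hs => by
      rw [Finset.mem_filter, mem_bdFin] at hs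
      exact card_stripFin hM (hP.isStrip hs.1)
    rw [Finset.sum_congr rfl h2, Finset.sum_ite, Finset.sum_const, Finset.sum_const,
      smul_eq_mul, smul_eq_mul, mul_one, mul_comm, add_comm, Finset.filter_filter,
      Finset.filter_filter]
    simp only [longFin, shortFin, and_comm]
  · intro s hs t ht hst
    rw [Function.onFun, Finset.disjoint_left]
    intro x hx hx'
    rw [Finset.mem_coe, Finset.mem_filter, mem_bdFin] at hs ht
    exact hst ((hP.isStrip hs.1).eq_start hM (hP.isStrip ht.1) hx hx')

/-- Each long strip can be traversed backwards. It is enough to compare counts: `opp` matches both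
the sides and the single strips of the two directions, and `card_sideFin` does the rest. -/
theorem card_longFin_add_three (hκ : 0 < κ) (k : Fin 6) :
    (longFin M (k + 3)).card = (longFin M k).card := by
  have h1 := hP.card_sideFin k
  have h2 := hP.card_sideFin (k + 3)
  rw [card_sideFin_add_three hP.toIsDiag, card_shortFin_add_three hP.toIsDiag] at h2
  have h3 : κ * (longFin M (k + 3)).card = κ * (longFin M k).card := by omega
  exact Nat.eq_of_mul_eq_mul_left hκ h3

/-- The number of long strips. -/
theorem counts (hκ : 0 < κ) :
    M.card = κ * ((longFin M 0).card + (longFin M 1).card + (longFin M 2).card) +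
      ((bdFin M).filter (Tip M)).card ∧
    (bdFin M).card = 2 * ((longFin M 0).card + (longFin M 1).card + (longFin M 2).card) +
      2 * ((bdFin M).filter (Tip M)).card ∧
    (shortFin M 0).card + (shortFin M 1).card + (shortFin M 2).card =
      ((bdFin M).filter (Tip M)).card := by
  have hM := hP.toIsDiag
  have hS := card_single hM hP.leafCond
  have h1 := card_sum_dir ((bdFin M).filter (Single M))
  have h2 := card_sum_dir ((bdFin M).filter fun s => ¬ Single M s)
  have h3 := card_sum_dir ((covFin M).filter (SideDart M))
  have h4 := Finset.card_filter_add_card_filter_not (s := bdFin M) (Single M)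
  simp only [Finset.filter_filter] at h1 h2 h3
  change _ = ∑ k, (shortFin M k).card at h1
  change _ = ∑ k, (longFin M k).card at h2
  change _ = ∑ k, (sideFin M k).card at h3
  rw [card_sideDart hM] at h3
  rw [Fin.sum_univ_six] at h1 h2 h3
  have a0 := card_shortFin_add_three hM 0
  have a1 := card_shortFin_add_three hM 1
  have a2 := card_shortFin_add_three hM 2
  have b0 := hP.card_longFin_add_three hκ 0
  have b1 := hP.card_longFin_add_three hκ 1
  have b2 := hP.card_longFin_add_three hκ 2
  have c0 := card_sideFin_add_three hM 0
  have c1 := card_sideFin_add_three hM 1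
  have c2 := card_sideFin_add_three hM 2
  have d0 := hP.card_sideFin 0
  have d1 := hP.card_sideFin 1
  have d2 := hP.card_sideFin 2
  have e0 : (0 + 3 : Fin 6) = 3 := rfl
  have e1 : (1 + 3 : Fin 6) = 4 := rfl
  have e2 : (2 + 3 : Fin 6) = 5 := rfl
  rw [e0] at a0 b0 c0
  rw [e1] at a1 b1 c1
  rw [e2] at a2 b2 c2
  rw [mul_add, mul_add]
  -- Opposite directions contribute equally, so the sums over six directions are twice those over 0,
  -- 1, 2.
  omega

/-- There are few leaves. -/
theorem tip_le (hκ : 0 < κ) : ((bdFin M).filter (Tip M)).card ≤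
    (longFin M 0).card + (longFin M 1).card + (longFin M 2).card + 3 := by
  have h1 := four_mul_tip_le hP.toIsDiag hP.covConn hP.nonempty hP.leafCond
    fun d hd => ang_ne_five hP.uncovConn hd
  have h2 := hP.counts hκ
  -- With ρ long strips and n tips the boundary has 2ρ + 2n sides, so 4n ≤ 2ρ + 2n + 6.
  omega

end IsPatch

end KDoku

/-! ### Strips of different directions cross at most once. -/

namespace KDoku

open LDart IsDiag

variable {M : Finset LDart} {κ : ℕ}

/-- A sequence with values `m`, `m + 1` can increase only once. -/
theorem eq_of_increase {a : ℕ → ℤ} {p : ℕ → Prop} [DecidablePred p] {n : ℕ} {m : ℤ}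
    (ha : ∀ j < n, a (j + 1) = a j + if p j then 1 else 0)
    (hm : ∀ j ≤ n, a j = m ∨ a j = m + 1) {j : ℕ} (hj : j < n) (hp : p j) :
    (∀ i ≤ j, a i = m) ∧ ∀ i, j < i → i ≤ n → a i = m + 1 := by
  have hmono : ∀ d i, i + d ≤ n → a i ≤ a (i + d) := by
    intro d
    induction d with
    | zero => intro i _; simp
    | succ d ih =>
      intro i hi
      have h1 := ih i (by omega)
      have h2 := ha (i + d) (by omega)
      rw [← add_assoc, h2]
      split_ifs <;> omega
  have h0 := ha j hj
  rw [if_pos hp] at h0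
  have h1 := hm j (by omega)
  have h2 := hm (j + 1) (by omega)
  constructor
  · intro i hi
    have := hmono (j - i) i (by omega)
    rw [Nat.add_sub_cancel' hi] at this
    have := hm i (by omega)
    omega
  · intro i hi hin
    have := hmono (i - (j + 1)) (j + 1) (by omega)
    rw [Nat.add_sub_cancel' (by omega : j + 1 ≤ i)] at this
    have := hm i hin
    omega

section
variable {E : Finset LDart} {k : Fin 6} {φ : ℤ × ℤ → ℤ} {m : ℤ}

theorem IsCut.eq_of_snd (h : IsCut M E k φ m) (hM : IsDiag M) {x : LDart} (hx : SideDart M x)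
    (h1 : x.2 ≠ k) (h2 : x.2 ≠ k + 3) : φ (head x) = φ x.1 := by
  have hd := h.diff x hx
  have hk : ∀ j k : Fin 6, j ≠ k + 3 → j + 3 ≠ k := by decide
  rw [if_neg fun hm => h1 (h.snd x hm), if_neg] at hd
  · linarith
  · intro hm
    have := h.snd _ hm
    rw [hM.snd_opp hx] at this
    exact hk _ _ h2 this

theorem IsStrip.two_le (h : IsCut M E k φ m) (hM : IsDiag M) {t : LDart} {n : ℕ}
    (ht : IsStrip M t n) : ∀ j ≤ n, φ ((stp M)^[j] t).1 = m ∨ φ ((stp M)^[j] t).1 = m + 1 := by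
  intro j hj
  cases j with
  | zero => exact h.two _ ht.2.1.1
  | succ j =>
    have hs := ht.2.2.1 j (by omega)
    rw [Function.iterate_succ_apply', hM.fst_stp hs]
    exact h.two _ (hM.sideDart_sn (hM.sideDart_opp hs)).1

theorem IsCut.stp_diff (h : IsCut M E k φ m) (hM : IsDiag M) {x : LDart} (hx : SideDart M x) :
    φ (stp M x).1 = φ x.1 + (if sn M x ∈ E then 1 else 0) -
      (if opp M (sn M x) ∈ E then 1 else 0) := by
  have h1 := h.diff _ (hM.sideDart_sn (hM.sideDart_opp hx))
  have e1 : opp M (sn M (opp M x)) = sn M x := hM.opp_opp (hM.sideDart_sn hx)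
  have e2 : opp M (sn M x) = sn M (opp M x) := rfl
  rw [hM.head_sn_opp hx, e1] at h1
  rw [hM.fst_stp hx, e2]
  linarith

/-- A strip that crosses a cut upwards. -/
theorem IsCut.cross_up (h : IsCut M E k φ m) (hM : IsDiag M) {t : LDart} {n : ℕ}
    (ht : IsStrip M t n) (hk : k = t.2 + 1 ∨ k = t.2 + 2) {j : ℕ} (hj : j < n) {x : LDart}
    (hx : x ∈ E) (hd : diag M ((stp M)^[j] t) = diag M x) :
    (∀ i ≤ j, φ ((stp M)^[i] t).1 = m) ∧
      ∀ i, j < i → i ≤ n → φ ((stp M)^[i] t).1 = m + 1 := by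
  have hdir : ∀ i < n, ((stp M)^[i] t).2 = t.2 := fun i hi =>
    hM.snd_iterate_stp fun l hl => ht.2.2.1 l (by omega)
  have hno : ∀ i < n, opp M (sn M ((stp M)^[i] t)) ∉ E := fun i hi hm => by
    have h1 := h.snd _ hm
    have hs := ht.2.2.1 i hi
    rw [hM.snd_opp (hM.sideDart_sn hs)] at h1
    have h2 := hM.snd_sn hs
    rw [hdir i hi] at h2
    have key : ∀ l k a : Fin 6, (k = l + 1 ∨ k = l + 2) → (a = l + 1 ∨ a = l + 2) → a + 3 ≠ k := by
      decide
    exact key _ _ _ hk h2 h1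
  refine eq_of_increase (a := fun i => φ ((stp M)^[i] t).1)
    (p := fun i => sn M ((stp M)^[i] t) ∈ E) ?_ (IsStrip.two_le h hM ht) hj ?_
  · intro i hi
    simp only [Function.iterate_succ_apply']
    rw [h.stp_diff hM (ht.2.2.1 i hi), if_neg (hno i hi), sub_zero]
  · have hs := ht.2.2.1 j hj
    have hxk := h.snd x hx
    have h2 := hdir j hj
    have key : ∀ l : Fin 6, l ≠ l + 1 ∧ l ≠ l + 2 ∧ l + 3 ≠ l + 1 ∧ l + 3 ≠ l + 2 := by decide
    obtain ⟨k1, k2, k3, k4⟩ := key t.2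
    rcases hM.eq_of_diag_eq hs (h.side x hx) hd.symm with rfl | rfl | rfl | rfl
    · rw [h2] at hxk
      rw [← hxk] at hk
      exact absurd hk (not_or.2 ⟨k1, k2⟩)
    · exact hx
    · rw [hM.snd_opp hs, h2] at hxk
      rw [← hxk] at hk
      exact absurd hk (not_or.2 ⟨k3, k4⟩)
    · exact absurd hx (hno j hj)

/-- A strip that crosses a cut downwards. -/
theorem IsCut.cross_down (h : IsCut M E k φ m) (hM : IsDiag M) {t : LDart} {n : ℕ}
    (ht : IsStrip M t n) (hk : k = t.2 + 4 ∨ k = t.2 + 5) {j : ℕ} (hj : j < n) {x : LDart}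
    (hx : x ∈ E) (hd : diag M ((stp M)^[j] t) = diag M x) :
    (∀ i ≤ j, φ ((stp M)^[i] t).1 = m + 1) ∧
      ∀ i, j < i → i ≤ n → φ ((stp M)^[i] t).1 = m := by
  have hdir : ∀ i < n, ((stp M)^[i] t).2 = t.2 := fun i hi =>
    hM.snd_iterate_stp fun l hl => ht.2.2.1 l (by omega)
  have hno : ∀ i < n, sn M ((stp M)^[i] t) ∉ E := fun i hi hm => by
    have h1 := h.snd _ hm
    have hs := ht.2.2.1 i hi
    have h2 := hM.snd_sn hs
    rw [hdir i hi] at h2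
    have key : ∀ l k a : Fin 6, (k = l + 4 ∨ k = l + 5) → (a = l + 1 ∨ a = l + 2) → a ≠ k := by
      decide
    exact key _ _ _ hk h2 h1
  have := eq_of_increase (a := fun i => -φ ((stp M)^[i] t).1) (m := -m - 1)
    (p := fun i => opp M (sn M ((stp M)^[i] t)) ∈ E) (n := n) ?_ ?_ hj ?_
  · refine ⟨fun i hi => ?_, fun i hi hin => ?_⟩
    · have := this.1 i hi; omega
    · have := this.2 i hi hin; omega
  · intro i hi
    simp only [Function.iterate_succ_apply']
    rw [h.stp_diff hM (ht.2.2.1 i hi), if_neg (hno i hi)]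
    ring
  · intro i hi
    rcases IsStrip.two_le h hM ht i hi with h | h <;> simp only [h]
    · right; ring
    · left; ring
  · have hs := ht.2.2.1 j hj
    have hxk := h.snd x hx
    have h2 := hdir j hj
    have key : ∀ l : Fin 6, l ≠ l + 4 ∧ l ≠ l + 5 ∧ l + 3 ≠ l + 4 ∧ l + 3 ≠ l + 5 := by decide
    obtain ⟨k1, k2, k3, k4⟩ := key t.2
    rcases hM.eq_of_diag_eq hs (h.side x hx) hd.symm with rfl | rfl | rfl | rfl
    · rw [h2] at hxk
      rw [← hxk] at hk
      exact absurd hk (not_or.2 ⟨k1, k2⟩)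
    · exact absurd hx (hno j hj)
    · rw [hM.snd_opp hs, h2] at hxk
      rw [← hxk] at hk
      exact absurd hk (not_or.2 ⟨k3, k4⟩)
    · exact hx

end

theorem up_or_down : ∀ k l : Fin 6, k < 3 → l < 3 → k ≠ l →
    (k = l + 1 ∨ k = l + 2) ∨ (k = l + 4 ∨ k = l + 5) := by decide

namespace IsPatch

variable (hP : IsPatch κ M)
include hP

/-- Strips of different directions have at most one common tile. -/
theorem cross_unique {s t : LDart} {n n' : ℕ} (hs : IsStrip M s n) (ht : IsStrip M t n')
    (hs3 : s.2 < 3) (ht3 : t.2 < 3) (hst : s.2 ≠ t.2) {x x' y y' : LDart}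
    (hx : x ∈ stripFin M s n) (hx' : x' ∈ stripFin M s n) (hy : y ∈ stripFin M t n')
    (hy' : y' ∈ stripFin M t n') (h : diag M y = diag M x) (h' : diag M y' = diag M x') :
    y = y' := by
  have hM := hP.toIsDiag
  obtain ⟨φ, m, hcut⟩ := exists_isCut hM hP.covConn hP.uncovConn hs
  obtain ⟨j, hj, rfl⟩ := mem_stripFin.1 hy
  obtain ⟨j', hj', rfl⟩ := mem_stripFin.1 hy'
  -- At every common tile the potential jumps along `t`, always in the same sense, but it has only
  -- two values.
  rcases up_or_down _ _ hs3 ht3 hst with hk | hk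
  · obtain ⟨a1, a2⟩ := hcut.cross_up hM ht hk hj hx h
    obtain ⟨b1, b2⟩ := hcut.cross_up hM ht hk hj' hx' h'
    rcases lt_trichotomy j j' with hl | rfl | hl
    · have := a2 j' hl (by omega)
      have := b1 j' le_rfl
      omega
    · rfl
    · have := b2 j hl (by omega)
      have := a1 j le_rfl
      omega
  · obtain ⟨a1, a2⟩ := hcut.cross_down hM ht hk hj hx h
    obtain ⟨b1, b2⟩ := hcut.cross_down hM ht hk hj' hx' h'
    rcases lt_trichotomy j j' with hl | rfl | hl
    · have := a2 j' hl (by omega)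
      have := b1 j' le_rfl
      omega
    · rfl
    · have := b2 j hl (by omega)
      have := a1 j le_rfl
      omega

end IsPatch

/-- The side or its opposite side, with a normalized direction. -/
def lowSide (M : Finset LDart) (x : LDart) : LDart := if x.2 < 3 then x else opp M x

theorem add_three_lt : ∀ k : Fin 6, ¬ k < 3 → k + 3 < 3 := by decide

namespace IsDiag

variable (hM : IsDiag M)
include hM

theorem sideDart_lowSide {x : LDart} (h : SideDart M x) : SideDart M (lowSide M x) := by
  unfold lowSide; split_ifs
  exacts [h, hM.sideDart_opp h]

theorem snd_lowSide {x : LDart} (h : SideDart M x) : (lowSide M x).2 < 3 := by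
  unfold lowSide; split_ifs with h3
  · exact h3
  · rw [hM.snd_opp h]; exact add_three_lt _ h3

theorem diag_lowSide {x : LDart} (h : SideDart M x) : diag M (lowSide M x) = diag M x := by
  unfold lowSide; split_ifs
  exacts [rfl, hM.diag_opp h]

theorem single_lowSide {x : LDart} (h : SideDart M x) :
    Single M (lowSide M x) ↔ Single M x := by
  unfold lowSide; split_ifs
  · rfl
  · refine ⟨fun h' => ?_, fun h' => h'.opp hM⟩
    have := h'.opp hM
    rwa [hM.opp_opp h] at this

/-- A tile has only one side of a given direction. -/
theorem eq_of_diag_of_snd {x y : LDart} (hx : SideDart M x) (hy : SideDart M y)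
    (h : diag M y = diag M x) (h2 : y.2 = x.2) : y = x := by
  have key : ∀ k : Fin 6, k ≠ k + 1 ∧ k ≠ k + 2 ∧ k ≠ k + 3 ∧ k ≠ k + 1 + 3 ∧ k ≠ k + 2 + 3 := by
    decide
  obtain ⟨k1, k2, k3, k4, k5⟩ := key x.2
  rcases hM.eq_of_diag_eq hx hy h with h' | h' | h' | h'
  · exact h'
  · have := hM.snd_sn hx
    rw [← h', h2] at this
    tauto
  · have := hM.snd_opp hx
    rw [← h', h2] at this
    tauto
  · have h3 := hM.snd_opp (hM.sideDart_sn hx)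
    rw [← h', h2] at h3
    rcases hM.snd_sn hx with h4 | h4 <;> rw [h4] at h3 <;> tauto

end IsDiag

open Classical in
/-- The entrance of the strip through a side. -/
noncomputable def start (M : Finset LDart) (x : LDart) : LDart :=
  if h : ∃ s n, IsStrip M s n ∧ x ∈ stripFin M s n then h.choose else x

theorem start_spec (hM : IsDiag M) {x : LDart} (h : SideDart M x) :
    ∃ n, IsStrip M (start M x) n ∧ x ∈ stripFin M (start M x) n := by
  have h' := hM.exists_mem_stripFin h
  rw [start, dif_pos h']
  exact h'.choose_spec

theorem snd_start (hM : IsDiag M) {x : LDart} (h : SideDart M x) : (start M x).2 = x.2 := by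
  obtain ⟨n, h1, h2⟩ := start_spec hM h
  exact (h1.snd hM h2).symm

theorem single_start (hM : IsDiag M) {x : LDart} (h : SideDart M x) :
    Single M (start M x) ↔ Single M x := by
  obtain ⟨n, h1, h2⟩ := start_spec hM h
  constructor
  · intro h3
    have h4 := h1.length_unique (isStrip_one hM h3)
    rw [h4, stripFin_one, Finset.mem_singleton] at h2
    rw [h2]; exact h3
  · intro h3
    have h4 := isStrip_one hM h3
    have h5 : x ∈ stripFin M x 1 := by rw [stripFin_one, Finset.mem_singleton]
    rw [h1.eq_start hM h4 h2 h5]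
    exact h3

/-- The tile with diagonal `D` is on two long strips. -/
def Crossing (M : Finset LDart) (D : LDart) : Prop :=
  ¬ Single M (nx D) ∧ ¬ Single M (nx (nx D))

instance : DecidablePred (Crossing M) := fun d => by unfold Crossing; infer_instance

/-- A tile that is not a crossing is the only tile of some strip of length 1; different tiles give
different strips. -/
theorem card_tiles_le_add (hM : IsDiag M) : (tiles M).card ≤ ((tiles M).filter (Crossing M)).card +
    ((shortFin M 0).card + (shortFin M 1).card + (shortFin M 2).card) := by
  rw [← Finset.card_filter_add_card_filter_not (s := tiles M) (Crossing M)]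
  apply Nat.add_le_add_left
  have hin : ∀ {x}, Single M x → x.2 < 3 → x ∈ shortFin M 0 ∪ shortFin M 1 ∪ shortFin M 2 := by
    intro x hx hx3
    have : ∀ k : Fin 6, k < 3 → k = 0 ∨ k = 1 ∨ k = 2 := by decide
    simp only [Finset.mem_union, mem_shortFin, hx, true_and]
    have := this _ hx3
    tauto
  refine le_trans ?_ ((Finset.card_union_le _ _).trans
    (Nat.add_le_add_right (Finset.card_union_le _ _) _))
  let f : LDart → LDart := fun D =>
    if Single M (nx D) then lowSide M (nx D) else lowSide M (nx (nx D))
  have hf : ∀ D ∈ (tiles M).filter (fun D => ¬ Crossing M D),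
      f D ∈ shortFin M 0 ∪ shortFin M 1 ∪ shortFin M 2 ∧ diag M (f D) = D := by
    intro D hD
    rw [Finset.mem_filter, tiles, Finset.mem_filter, Crossing, not_and_or, not_not, not_not] at hD
    obtain ⟨⟨hDM, hD3⟩, hS⟩ := hD
    have hn : normDart D = D := by rw [normDart, if_pos hD3]
    have s1 := hM.sideDart_nx hDM
    have s2 := hM.sideDart_nx_nx hDM
    simp only [f]
    split_ifs with h
    · exact ⟨hin ((hM.single_lowSide s1).2 h) (hM.snd_lowSide s1),
        by rw [hM.diag_lowSide s1, hM.diag_nx_of_mem hDM, hn]⟩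
    · exact ⟨hin ((hM.single_lowSide s2).2 (hS.resolve_left h)) (hM.snd_lowSide s2),
        by rw [hM.diag_lowSide s2, hM.diag_nx_nx_of_mem hDM, hn]⟩
  refine Finset.card_le_card_of_injOn f (fun D hD => (hf D hD).1) ?_
  intro D hD D' hD' h
  rw [← (hf D hD).2, ← (hf D' hD').2, h]

/-- By `cross_unique` a crossing is determined by its two long strips, and these have two different
directions among three. -/
theorem IsPatch.card_crossing_le (hP : IsPatch κ M) : ((tiles M).filter (Crossing M)).card ≤
    (longFin M 2).card * (longFin M 1).card + (longFin M 0).card * (longFin M 2).card +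
      (longFin M 1).card * (longFin M 0).card := by
  have hM := hP.toIsDiag
  let f : LDart → LDart × LDart := fun D =>
    (start M (lowSide M (nx D)), start M (lowSide M (nx (nx D))))
  have hdir : ∀ D ∈ tiles M, ((lowSide M (nx D)).2, (lowSide M (nx (nx D))).2) = (2, 1) ∨
      ((lowSide M (nx D)).2, (lowSide M (nx (nx D))).2) = (0, 2) ∨
      ((lowSide M (nx D)).2, (lowSide M (nx (nx D))).2) = (1, 0) := by
    intro D hD
    rw [tiles, Finset.mem_filter] at hD
    have h1 : (lowSide M (nx D)).2 = if D.2 + 2 < 3 then D.2 + 2 else D.2 + 2 + 3 := by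
      rw [lowSide]
      change (if D.2 + 2 < 3 then _ else _ : LDart).2 = _
      split_ifs
      · rfl
      · rw [hM.snd_opp (hM.sideDart_nx hD.1)]; rfl
    have h2 : (lowSide M (nx (nx D))).2 = if D.2 + 4 < 3 then D.2 + 4 else D.2 + 4 + 3 := by
      have h4 : (nx (nx D)).2 = D.2 + 4 := by
        simp only [nx, add_assoc]; rfl
      rw [lowSide, h4]
      split_ifs
      · exact h4
      · rw [hM.snd_opp (hM.sideDart_nx_nx hD.1), h4]
    rw [h1, h2]
    -- The direction of the diagonal determines the ordered pair of side directions, so the three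
    -- products stand for the three kinds of tiles.
    have key : ∀ k : Fin 6, k < 3 → ((if k + 2 < 3 then k + 2 else k + 2 + 3),
        (if k + 4 < 3 then k + 4 else k + 4 + 3)) = ((2, 1) : Fin 6 × Fin 6) ∨
      ((if k + 2 < 3 then k + 2 else k + 2 + 3),
        (if k + 4 < 3 then k + 4 else k + 4 + 3)) = ((0, 2) : Fin 6 × Fin 6) ∨
      ((if k + 2 < 3 then k + 2 else k + 2 + 3),
        (if k + 4 < 3 then k + 4 else k + 4 + 3)) = ((1, 0) : Fin 6 × Fin 6) := by decide
    exact key _ hD.2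
  have hf : ∀ D ∈ (tiles M).filter (Crossing M), f D ∈ longFin M 2 ×ˢ longFin M 1 ∪
      longFin M 0 ×ˢ longFin M 2 ∪ longFin M 1 ×ˢ longFin M 0 := by
    intro D hD
    rw [Finset.mem_filter] at hD
    have hDM := (Finset.mem_filter.1 hD.1).1
    have s1 := hM.sideDart_lowSide (hM.sideDart_nx hDM)
    have s2 := hM.sideDart_lowSide (hM.sideDart_nx_nx hDM)
    have a1 := (single_start hM s1).not.2 ((hM.single_lowSide (hM.sideDart_nx hDM)).not.2 hD.2.1)
    have a2 := (single_start hM s2).not.2 ((hM.single_lowSide (hM.sideDart_nx_nx hDM)).not.2 hD.2.2)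
    obtain ⟨n1, b1, -⟩ := start_spec hM s1
    obtain ⟨n2, b2, -⟩ := start_spec hM s2
    have := hdir D hD.1
    simp only [Prod.mk.injEq] at this
    simp only [f, Finset.mem_union, Finset.mem_product, mem_longFin, snd_start hM s1,
      snd_start hM s2, a1, a2, b1.2.1, b2.2.1, not_false_iff, true_and]
    tauto
  have hinj : Set.InjOn f ((tiles M).filter (Crossing M)) := by
    intro D hD D' hD' h
    rw [Finset.mem_coe, Finset.mem_filter] at hD hD'
    obtain ⟨hDM, hD3⟩ := Finset.mem_filter.1 hD.1
    obtain ⟨hDM', hD3'⟩ := Finset.mem_filter.1 hD'.1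
    have s1 := hM.sideDart_lowSide (hM.sideDart_nx hDM)
    have s2 := hM.sideDart_lowSide (hM.sideDart_nx_nx hDM)
    have s1' := hM.sideDart_lowSide (hM.sideDart_nx hDM')
    have s2' := hM.sideDart_lowSide (hM.sideDart_nx_nx hDM')
    obtain ⟨n1, b1, c1⟩ := start_spec hM s1
    obtain ⟨n2, b2, c2⟩ := start_spec hM s2
    obtain ⟨n1', b1', c1'⟩ := start_spec hM s1'
    obtain ⟨n2', b2', c2'⟩ := start_spec hM s2'
    simp only [f, Prod.mk.injEq] at h
    rw [← h.1] at b1' c1'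
    rw [← h.2] at b2' c2'
    rw [← b1.length_unique b1'] at c1'
    rw [← b2.length_unique b2'] at c2'
    have hne : (lowSide M (nx D)).2 ≠ (lowSide M (nx (nx D))).2 := by
      have := hdir D hD.1
      simp only [Prod.mk.injEq] at this
      rcases this with ⟨a, b⟩ | ⟨a, b⟩ | ⟨a, b⟩ <;> rw [a, b] <;> decide
    have d1 := hM.diag_nx_of_mem hDM
    have d2 := hM.diag_nx_nx_of_mem hDM
    have d1' := hM.diag_nx_of_mem hDM'
    have d2' := hM.diag_nx_nx_of_mem hDM'
    rw [normDart, if_pos hD3] at d1 d2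
    rw [normDart, if_pos hD3'] at d1' d2'
    rw [← hM.diag_lowSide (hM.sideDart_nx hDM)] at d1
    rw [← hM.diag_lowSide (hM.sideDart_nx_nx hDM)] at d2
    rw [← hM.diag_lowSide (hM.sideDart_nx hDM')] at d1'
    rw [← hM.diag_lowSide (hM.sideDart_nx_nx hDM')] at d2'
    have l1 := hM.snd_lowSide (hM.sideDart_nx hDM)
    have l2 := hM.snd_lowSide (hM.sideDart_nx_nx hDM)
    have := hP.cross_unique b1 b2 (by rwa [snd_start hM s1]) (by rwa [snd_start hM s2])
      (by rwa [snd_start hM s1, snd_start hM s2]) c1 c1' c2 c2' (d2.trans d1.symm)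
      (d2'.trans d1'.symm)
    rw [← d2, this, d2']
  refine (Finset.card_le_card_of_injOn f hf hinj).trans ?_
  refine (Finset.card_union_le _ _).trans ?_
  rw [Finset.card_product]
  apply Nat.add_le_add_right
  refine (Finset.card_union_le _ _).trans ?_
  rw [Finset.card_product, Finset.card_product]

end KDoku

/-! ### The place next to a leaf at the end of a long strip. -/

namespace KDoku

open LDart IsDiag

variable {M : Finset LDart} {κ : ℕ}

theorem rev_rot (d : LDart) : rev (rot d) = nx (nx d) := by rw [← rev_nx_nx, rev_rev]

theorem IsDiag.diag_rev_rot (hM : IsDiag M) {d : LDart} (h : Cov M d) :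
    diag M (rev (rot d)) = diag M d := by
  rw [rev_rot, hM.diag_nx ((cov_nx d).2 h), hM.diag_nx h]

theorem IsDiag.bd_of_single_sn (hl : LeafCond M) {x : LDart} (hM : IsDiag M)
    (hx : SideDart M x) (h : Single M (sn M x)) : Bd M (opp M x) ↔ ¬ Bd M x := by
  have := hl _ h
  have e1 : opp M (sn M (sn M x)) = x := hM.opp_opp hx
  rw [e1] at this
  exact this

/-- A long strip that begins with a leaf leaning upwards has no long strip above it. Here `low`
describes the vertices below a certain strip of direction `k`. -/
theorem false_of_leaf_below (hM : IsDiag M) (hl : LeafCond M) {k : Fin 6} {low : ℤ × ℤ → Prop}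
    (up : ∀ f, SideDart M f → (f.2 = k + 1 ∨ f.2 = k + 2) → ¬ Single M f → low f.1 → ¬ Bd M f)
    (low1 : ∀ f, SideDart M f → (f.2 = k + 1 ∨ f.2 = k + 2) → low f.1 → low (head f))
    (low2 : ∀ f, Single M f → f.2 = k → low f.1 → low (head f))
    (hleaf : ∀ d, Bd M d → d.2 = k → ¬ Single M d → Single M (sn M d))
    {e : LDart} (he : Bd M e) (hek : e.2 = k) (hes : ¬ Single M e) (hdir : (sn M e).2 = k + 2)
    (hlow : low (opp M e).1) (h2 : ¬ Single M (sn M (stp M e))) : False := by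
  have hs := hM.sideDart_of_bd he
  have key : ∀ k : Fin 6, k + 1 ≠ k + 4 ∧ k + 1 ≠ k + 5 ∧ k + 2 ≠ k + 4 ∧ k + 2 ≠ k + 5 ∧
      k + 1 + 3 ≠ k + 1 ∧ k + 1 + 3 ≠ k + 2 ∧ k + 2 + 3 ≠ k + 1 ∧ k + 2 + 3 ≠ k + 2 ∧
      k + 1 + 3 ≠ k ∧ k + 2 + 3 ≠ k ∧ k + 1 + 3 ≠ k + 3 ∧ k + 2 + 3 ≠ k + 3 := by decide
  obtain ⟨-, -, -, -, k5, k6, k7, k8, k9, k10, k11, k12⟩ := key k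
  -- a boundary side of direction `k` below the strip, approached from below by a long strip
  have final : ∀ d f, Bd M d → d.2 = k → low d.1 → SideDart M f → Cov M (rev f) →
      (f.2 = k + 1 ∨ f.2 = k + 2) → ¬ Single M f → diag M (rev f) = diag M d → False := by
    intro d f hd hdk hdl hf hrf hfk hfs hfd
    have hds := hM.sideDart_of_bd hd
    have hrs := hM.sideDart_rev hf hrf
    have hsn : (sn M d).2 = k + 1 ∨ (sn M d).2 = k + 2 := by rw [← hdk]; exact hM.snd_sn hds
    have heq : rev f = opp M (sn M d) := by
      have hr2 : (rev f).2 = f.2 + 3 := rfl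
      rcases hM.eq_of_diag_eq hds hrs hfd with h | h | h | h
      · rw [h, hdk] at hr2
        rcases hfk with h' | h' <;> rw [h'] at hr2
        exacts [absurd hr2.symm k9, absurd hr2.symm k10]
      · rw [h] at hr2
        rcases hfk with h' | h' <;> rcases hsn with h'' | h'' <;> rw [h', h''] at hr2
        exacts [absurd hr2.symm k5, absurd hr2.symm k6, absurd hr2.symm k7, absurd hr2.symm k8]
      · rw [h, hM.snd_opp hds, hdk] at hr2
        rcases hfk with h' | h' <;> rw [h'] at hr2
        exacts [absurd hr2.symm k11, absurd hr2.symm k12]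
      · exact h
    have hnb : ¬ Bd M (opp M (sn M d)) := by
      rw [← heq]
      intro h
      apply h.2
      rw [rev_rev]; exact hf.1
    have hss : ¬ Single M (sn M d) := fun h => hnb h.2
    -- The cross strip of the tile at `d` is long and the tile has a neighbour beyond `rev f`. If
    -- `d` is single, the leaf condition puts `sn M d` on the boundary, against `up`; if `d` starts
    -- a long strip, its first tile has a single cross strip by `hleaf`.
    by_cases hS : Single M d
    · have h1 : Bd M (sn M d) := by
        have := hl d hS
        tauto
      refine up _ (hM.sideDart_sn hds) hsn hss ?_ h1
      rw [hM.fst_sn hds]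
      exact low2 d hS hdk hdl
    · exact hss (hleaf d hd hdk hS)
  have hso := hM.sideDart_opp hs
  have hsn := hM.sideDart_sn hs
  have hbsn : Bd M (sn M e) := (hleaf e he hek hes).1
  have hno : ¬ Bd M (opp M e) := fun h => hes ⟨he, h⟩
  have hs1 : SideDart M (stp M e) := hM.sideDart_stp hs hno
  have h1k : (stp M e).2 = k := by rw [hM.snd_stp hs, hek]
  have hf := hM.sideDart_sn hs1
  set f := sn M (stp M e) with hfdef
  have hfk : f.2 = k + 1 ∨ f.2 = k + 2 := by rw [← h1k]; exact hM.snd_sn hs1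
  have hfx : f.1 = (opp M e).1 := by
    rw [hfdef, hM.fst_sn hs1, stp, head_rev]
  set x := (opp M e).1 with hx
  have hnf : ¬ Bd M f := up f hf hfk h2 (by rw [hfx]; exact hlow)
  have hcf : Cov M (rev f) := by
    by_contra h
    exact hnf ⟨hf.1, h⟩
  -- the free side of the leaf ends at `x`
  have hfree : rev (sn M e) = (x, k + 5) := by
    ext1
    · rw [fst_rev, hx, hM.fst_opp hs]
    · simp only [rev, hdir, add_assoc]; rfl
  have hunc : ¬ Cov M (rev (x, k)) := by
    rw [cov_rev_mk, show k - 1 = k + 5 by rw [sub_eq_add_neg]; rfl, ← hfree]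
    exact hbsn.2
  have hxk : (x, k).1 = x := rfl
  -- The second tile has a long cross strip, so there is a tile behind `f`. It has to fit between
  -- `f` and the uncovered triangle next to the free side of the leaf, and in each case some tile
  -- acquires the boundary side `(x, k)` excluded by `final`.
  rcases hfk with hfk1 | hfk2
  · have hfr : f = rot (x, k) := by
      ext1
      · exact hfx
      · exact hfk1
    have hc : Cov M (x, k) := by rw [← cov_rot, ← hfr]; exact hcf
    refine final (x, k) f ⟨hc, hunc⟩ rfl hlow hf hcf (Or.inl hfk1) h2 ?_
    rw [hfr, hM.diag_rev_rot hc]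
  · have hfr : f = rot (x, k + 1) := by
      ext1
      · exact hfx
      · rw [hfk2]; simp only [rot, add_assoc]; rfl
    have hcg : Cov M (x, k + 1) := by rw [← cov_rot, ← hfr]; exact hcf
    have hdg : diag M (rev f) = diag M (x, k + 1) := by rw [hfr, hM.diag_rev_rot hcg]
    have hrg : (x, k + 1) = rot (x, k) := rfl
    -- The 120° sector between `f` and `(x, k)` is covered by one tile with diagonal `(x, k + 1)`,
    -- or this edge is a side and the argument is repeated with it in place of `f`.
    by_cases hg : (x, k + 1) ∈ M
    · have hc : Cov M (x, k) := by
        rw [← cov_rot, ← hrg]; exact Or.inl (hM.rev_mem _ hg)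
      refine final (x, k) f ⟨hc, hunc⟩ rfl hlow hf hcf (Or.inr hfk2) h2 ?_
      rw [hdg, ← hM.diag_rev_rot hc, ← hrg, diag_of_mem hg, diag_of_mem (hM.rev_mem _ hg),
        normDart_rev]
    · have hgs : SideDart M (x, k + 1) := ⟨hcg, hg⟩
      have hrf := hM.sideDart_rev hf hcf
      have hsnf : sn M (rev f) = (x, k + 1) := by
        have e1 : nx (rev f) = (x, k + 1) := by rw [hfr, rev_rot, nx_nx_nx]
        have e2 : nx (nx (rev f)) ∈ M := by
          rcases hrf.1 with h | h | h
          · exact absurd h hrf.2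
          · rw [e1] at h; exact absurd h hg
          · exact h
        rw [sn, if_pos e2, e1]
      have hsg : sn M (x, k + 1) = opp M (rev f) := by rw [← hsnf]; rfl
      have hnbr : ¬ Bd M (rev f) := fun h => by
        apply h.2
        rw [rev_rev]; exact hf.1
      have hgS : ¬ Single M (x, k + 1) := by
        intro hS
        rw [← hsnf] at hS
        have h3 : Bd M (opp M (rev f)) := (bd_of_single_sn hl hM hrf hS).2 hnbr
        rw [← hsg] at h3
        refine up _ (hM.sideDart_sn hgs) ?_ ?_ ?_ h3
        · rw [hsg, hM.snd_opp hrf]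
          right
          change f.2 + 3 + 3 = _
          rw [hfk2, add_assoc, add_assoc]; rfl
        · intro h4
          apply hnbr
          have := h4.2
          rwa [hsg, hM.opp_opp hrf] at this
        · rw [hM.fst_sn hgs]
          exact low1 _ hgs (Or.inl rfl) hlow
      have hng := up _ hgs (Or.inl rfl) hgS hlow
      have hcr : Cov M (rev (x, k + 1)) := by
        by_contra h
        exact hng ⟨hcg, h⟩
      have hc : Cov M (x, k) := by rw [← cov_rot, ← hrg]; exact hcr
      refine final (x, k) (x, k + 1) ⟨hc, hunc⟩ rfl hlow hgs hcr (Or.inl rfl) hgS ?_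
      rw [hrg, hM.diag_rev_rot hc]

/-- The reflection of a dart, combined with the reversal. -/
def mirror (d : LDart) : LDart := rev (d.1.swap, 1 - d.2)

theorem swap_dir (k : Fin 6) : (dir k).swap = dir (1 - k) := by
  fin_cases k <;> rfl

theorem mirror_mirror (d : LDart) : mirror (mirror d) = d := by
  rcases d with ⟨⟨x, y⟩, k⟩
  fin_cases k <;> simp [mirror, rev, dir]

theorem mirror_rev (d : LDart) : mirror (rev d) = rev (mirror d) := by
  rcases d with ⟨⟨x, y⟩, k⟩
  fin_cases k <;> simp [mirror, rev, dir]

/-- Reversing the reflected dart keeps its triangle on the left, but the sides of the triangle now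
follow one another in the opposite order. -/
theorem mirror_nx (d : LDart) : mirror (nx d) = nx (nx (mirror d)) := by
  rcases d with ⟨⟨x, y⟩, k⟩
  fin_cases k <;> simp [mirror, rev, dir, nx]

theorem mirror_nx_nx (d : LDart) : mirror (nx (nx d)) = nx (mirror d) := by
  rw [mirror_nx, mirror_nx, nx_nx_nx]

theorem snd_mirror (d : LDart) : (mirror d).2 = 4 - d.2 := by
  have : ∀ k : Fin 6, 1 - k + 3 = 4 - k := by decide
  exact this _

theorem fst_mirror (d : LDart) : (mirror d).1 = (head d).swap := by
  simp only [mirror, fst_rev, head, ← swap_dir]; rfl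

theorem head_mirror (d : LDart) : head (mirror d) = d.1.swap := by
  rw [mirror, head_rev]

theorem mem_image_mirror {d : LDart} : d ∈ M.image mirror ↔ mirror d ∈ M := by
  rw [Finset.mem_image]
  constructor
  · rintro ⟨a, ha, rfl⟩; rwa [mirror_mirror]
  · exact fun h => ⟨_, h, mirror_mirror d⟩

theorem cov_mirror {d : LDart} : Cov (M.image mirror) d ↔ Cov M (mirror d) := by
  simp only [Cov, mem_image_mirror, mirror_nx, nx_nx_nx]; tauto

theorem sideDart_mirror {d : LDart} :
    SideDart (M.image mirror) d ↔ SideDart M (mirror d) := by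
  simp only [SideDart, cov_mirror, mem_image_mirror]

theorem bd_mirror {d : LDart} : Bd (M.image mirror) d ↔ Bd M (mirror d) := by
  simp only [Bd, cov_mirror, mirror_rev]

theorem IsDiag.mirror (hM : IsDiag M) : IsDiag (M.image mirror) where
  rev_mem d hd := by
    rw [mem_image_mirror] at hd ⊢
    rw [mirror_rev]; exact hM.rev_mem _ hd
  excl d hd := by
    rw [mem_image_mirror] at hd ⊢
    rw [mirror_nx]; exact hM.excl'' hd

theorem sn_mirror (hM : IsDiag M) {d : LDart} (h : SideDart M (mirror d)) :
    sn (M.image mirror) d = mirror (opp M (sn M (mirror d))) := by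
  have hM' := hM.mirror
  obtain ⟨D, hD, hd | hd⟩ := hM.sideDart_cases h
  · have hd2 : d = nx (nx (mirror D)) := by rw [← mirror_nx, ← hd, mirror_mirror]
    have hDm : mirror D ∈ M.image mirror := by rwa [mem_image_mirror, mirror_mirror]
    rw [hd, sn_nx hD, hM.opp_nx_nx hD, hd2, hM'.sn_nx_nx hDm, mirror_nx_nx, mirror_rev]
  · have hd2 : d = nx (mirror D) := by rw [← mirror_nx_nx, ← hd, mirror_mirror]
    have hDm : mirror D ∈ M.image mirror := by rwa [mem_image_mirror, mirror_mirror]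
    rw [hd, hM.sn_nx_nx hD, hM.opp_nx (hM.rev_mem D hD), rev_rev, hd2, sn_nx hDm, mirror_nx]

theorem opp_mirror (hM : IsDiag M) {d : LDart} (h : SideDart M (mirror d)) :
    opp (M.image mirror) d = mirror (opp M (mirror d)) := by
  have h3 := hM.sideDart_opp (hM.sideDart_sn h)
  rw [opp, sn_mirror hM (by rw [sn_mirror hM h, mirror_mirror]; exact h3), sn_mirror hM h,
    mirror_mirror, sn_opp_sn hM h]

theorem single_mirror (hM : IsDiag M) {d : LDart} :
    Single (M.image mirror) d ↔ Single M (mirror d) := by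
  unfold Single
  rw [bd_mirror]
  refine and_congr_right fun h => ?_
  rw [bd_mirror, opp_mirror hM (hM.sideDart_of_bd h), mirror_mirror]

theorem LeafCond.mirror (hM : IsDiag M) (hl : LeafCond M) : LeafCond (M.image mirror) := by
  intro d hd
  have hs := hM.sideDart_of_bd (bd_mirror.1 hd.1)
  have h1 := hM.sideDart_sn hs
  have h3 := hM.sideDart_opp h1
  have h4 : SideDart M (KDoku.mirror (KDoku.mirror (opp M (sn M (KDoku.mirror d))))) := by
    rwa [mirror_mirror]
  have := hl _ ((single_mirror hM).1 hd)
  rw [sn_mirror hM hs, opp_mirror hM h4, bd_mirror, bd_mirror, mirror_mirror, mirror_mirror,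
    hM.opp_opp h1]
  tauto

/-- The mirror image of `false_of_leaf_below`. -/
theorem false_of_leaf_above (hM : IsDiag M) (hl : LeafCond M) {k : Fin 6} {high : ℤ × ℤ → Prop}
    (up : ∀ f, SideDart M f → (f.2 = k + 4 ∨ f.2 = k + 5) → ¬ Single M f → high (head f) →
      ¬ Bd M f)
    (high1 : ∀ f, SideDart M f → (f.2 = k + 4 ∨ f.2 = k + 5) → high (head f) → high f.1)
    (high2 : ∀ f, Single M f → f.2 = k → high (head f) → high f.1)
    (hleaf : ∀ d, Bd M d → d.2 = k → ¬ Single M d → Single M (sn M d))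
    {e : LDart} (he : Bd M e) (hek : e.2 = k) (hes : ¬ Single M e) (hdir : (sn M e).2 = k + 1)
    (hhigh : high (head (opp M e))) (h2 : ¬ Single M (sn M (stp M e))) : False := by
  have hs := hM.sideDart_of_bd he
  have hM' := hM.mirror
  have hmm : ∀ {d : LDart} {P : LDart → Prop}, P (mirror (mirror d)) ↔ P d := fun {d P} => by
    rw [mirror_mirror]
  have hdirs : ∀ {f : LDart}, (f.2 = 4 - k + 1 ∨ f.2 = 4 - k + 2) →
      ((mirror f).2 = k + 4 ∨ (mirror f).2 = k + 5) := fun {f} hf => by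
    rw [snd_mirror]
    have : ∀ k a : Fin 6, (a = 4 - k + 1 ∨ a = 4 - k + 2) → (4 - a = k + 4 ∨ 4 - a = k + 5) := by
      decide
    exact this _ _ hf
  have hk2 : ∀ {f : LDart}, f.2 = 4 - k → (mirror f).2 = k := fun {f} hf => by
    rw [snd_mirror, hf, sub_sub_cancel]
  have hside2 : SideDart M (mirror (mirror e)) := by rwa [mirror_mirror]
  have hno : ¬ Bd M (opp M e) := fun h => hes ⟨he, h⟩
  have hs1 : SideDart M (stp M e) := hM.sideDart_stp hs hno
  have hstp : stp (M.image mirror) (mirror e) = mirror (stp M e) := by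
    rw [stp, opp_mirror hM hside2, mirror_mirror, ← mirror_rev, stp]
  have hsingle : ∀ {d}, SideDart M d → (Single M (sn M d) ↔ Single M (opp M (sn M d))) :=
    fun {d} hd => by
      refine ⟨fun h => h.opp hM, fun h => ?_⟩
      have := h.opp hM
      rwa [hM.opp_opp (hM.sideDart_sn hd)] at this
  -- The reflection sends direction `k` to `4 - k` and interchanges the two sides of a cut.
  refine false_of_leaf_below (k := 4 - k) (low := fun v => high v.swap) (e := mirror e) hM'
    (hl.mirror hM) ?_ ?_ ?_ ?_ ?_ ?_ ?_ ?_ ?_ ?_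
  · intro f hf hfk hfs hfl
    rw [sideDart_mirror] at hf
    rw [single_mirror hM] at hfs
    rw [bd_mirror]
    refine up _ hf (hdirs hfk) hfs ?_
    rw [head_mirror]; exact hfl
  · intro f hf hfk hfl
    rw [sideDart_mirror] at hf
    have := high1 _ hf (hdirs hfk) (by rw [head_mirror]; exact hfl)
    rwa [fst_mirror] at this
  · intro f hf hfk hfl
    rw [single_mirror hM] at hf
    have := high2 _ hf (hk2 hfk) (by rw [head_mirror]; exact hfl)
    rwa [fst_mirror] at this
  · intro d hd hdk hds
    rw [bd_mirror] at hd
    rw [single_mirror hM] at hds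
    have hd' := hM.sideDart_of_bd hd
    rw [single_mirror hM, sn_mirror hM hd', mirror_mirror, ← hsingle hd']
    exact hleaf _ hd (hk2 hdk) hds
  · rw [bd_mirror, mirror_mirror]; exact he
  · rw [snd_mirror, hek]
  · rw [single_mirror hM, mirror_mirror]; exact hes
  · rw [sn_mirror hM hside2, mirror_mirror, snd_mirror, hM.snd_opp (hM.sideDart_sn hs), hdir]
    have : ∀ k : Fin 6, 4 - (k + 1 + 3) = 4 - k + 2 := by decide
    exact this k
  · rw [opp_mirror hM hside2, mirror_mirror, fst_mirror, Prod.swap_swap]; exact hhigh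
  · have hs1' : SideDart M (mirror (mirror (stp M e))) := by rwa [mirror_mirror]
    rw [hstp, single_mirror hM, sn_mirror hM hs1', mirror_mirror, mirror_mirror, ← hsingle hs1]
    exact h2

end KDoku

/-! ### Three parallel long strips crossed by `κ - 2` others are impossible. -/

namespace KDoku

open LDart IsDiag

variable {M : Finset LDart} {κ : ℕ}

/-- The entrances of the long strips in the normalized directions other than `c`. -/
def otherFin (M : Finset LDart) (c : Fin 6) : Finset LDart :=
  (bdFin M).filter fun s => ¬ Single M s ∧ s.2 < 3 ∧ s.2 ≠ c

theorem mem_otherFin {c : Fin 6} {s : LDart} :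
    s ∈ otherFin M c ↔ Bd M s ∧ ¬ Single M s ∧ s.2 < 3 ∧ s.2 ≠ c := by
  rw [otherFin, Finset.mem_filter, mem_bdFin]

/-- A tile with a single cross strip has just one neighbour, so it can only be at an end of a long
strip. -/
theorem IsStrip.sn_not_single (hM : IsDiag M) (hl : LeafCond M) {s : LDart} {n i : ℕ}
    (hs : IsStrip M s n) (h0 : 0 < i) (hi : i + 1 < n) : ¬ Single M (sn M ((stp M)^[i] s)) := by
  intro h
  have hside := hs.2.2.1 i (by omega)
  have h1 : ¬ Bd M ((stp M)^[i] s) := fun hb => by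
    obtain ⟨j, rfl⟩ : ∃ j, i = j + 1 := ⟨i - 1, by omega⟩
    rw [Function.iterate_succ_apply'] at hb
    exact hM.stp_ne_bd (hs.2.2.1 j (by omega)) hb rfl
  have h2 : ¬ Bd M (opp M ((stp M)^[i] s)) := fun hb => by
    have := hs.2.2.1 (i + 1) hi
    rw [Function.iterate_succ_apply'] at this
    exact hb.2 this.1
  have := bd_of_single_sn hl hM hside h
  tauto

namespace IsPatch

variable (hP : IsPatch κ M)
include hP

/-- The `κ - 2` inner tiles of the strip are crossed by distinct long strips, which exhausts
`otherFin M c`. So each of these crosses the strip, and none is left to cross its first tile. -/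
theorem leaf_and_cross (hκ : 2 < κ) {c : Fin 6} (hc : c < 3)
    (hO : (otherFin M c).card = κ - 2) {s : LDart} (hs : s ∈ longFin M c) :
    Single M (sn M s) ∧ ∀ t ∈ otherFin M c,
      ∃ x ∈ stripFin M s κ, ∃ y ∈ stripFin M t κ, diag M y = diag M x := by
  have hM := hP.toIsDiag
  rw [mem_longFin] at hs
  have hst := hP.isStrip_long hs.1 hs.2.1
  let f : ℕ → LDart := fun i => (stp M)^[i] s
  have hf : ∀ i < κ, SideDart M (f i) := hst.2.2.1
  have hf2 : ∀ i < κ, (f i).2 = c := fun i hi => by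
    rw [← hs.2.2]; exact hM.snd_iterate_stp fun l hl => hst.2.2.1 l (by omega)
  let y : ℕ → LDart := fun i => lowSide M (sn M (f i))
  have hy : ∀ i < κ, SideDart M (y i) := fun i hi => hM.sideDart_lowSide (hM.sideDart_sn (hf i hi))
  have hyd : ∀ i < κ, diag M (y i) = diag M (f i) := fun i hi => by
    rw [hM.diag_lowSide (hM.sideDart_sn (hf i hi)), hM.diag_sn (hf i hi)]
  have hy3 : ∀ i < κ, (y i).2 < 3 := fun i hi => hM.snd_lowSide (hM.sideDart_sn (hf i hi))
  have hyc : ∀ i < κ, (y i).2 ≠ c := fun i hi => by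
    have h1 := hM.snd_sn (hf i hi)
    rw [hf2 i hi] at h1
    have key : ∀ c a : Fin 6, (a = c + 1 ∨ a = c + 2) → a ≠ c ∧ a + 3 ≠ c := by decide
    have := key _ _ h1
    simp only [y, lowSide]
    split_ifs
    · exact this.1
    · rw [hM.snd_opp (hM.sideDart_sn (hf i hi))]; exact this.2
  have hmem : ∀ i < κ, ¬ Single M (sn M (f i)) → start M (y i) ∈ otherFin M c := by
    intro i hi hns
    obtain ⟨n, h1, -⟩ := start_spec hM (hy i hi)
    rw [mem_otherFin, snd_start hM (hy i hi)]
    refine ⟨h1.2.1, ?_, hy3 i hi, hyc i hi⟩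
    rw [single_start hM (hy i hi), hM.single_lowSide (hM.sideDart_sn (hf i hi))]
    exact hns
  have hinj : ∀ i < κ, ∀ j < κ, start M (y i) = start M (y j) → i = j := by
    intro i hi j hj hij
    obtain ⟨n, h1, h2⟩ := start_spec hM (hy i hi)
    obtain ⟨n', h1', h2'⟩ := start_spec hM (hy j hj)
    rw [← hij] at h1' h2'
    rw [← h1.length_unique h1'] at h2'
    have := hP.cross_unique h1 hst (by rw [snd_start hM (hy i hi)]; exact hy3 i hi)
      (by rw [hs.2.2]; exact hc) (by rw [snd_start hM (hy i hi), hs.2.2]; exact hyc i hi) h2 h2'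
      (mem_stripFin.2 ⟨i, hi, rfl⟩) (mem_stripFin.2 ⟨j, hj, rfl⟩) (hyd i hi).symm (hyd j hj).symm
    exact (hM.iterate_stp_inj hst.2.1 hst.2.1 (fun l hl => hst.2.2.1 l (by omega))
      (fun l hl => hst.2.2.1 l (by omega)) this).1
  have hmid : ∀ i ∈ Finset.Ioo 0 (κ - 1), start M (y i) ∈ otherFin M c := fun i hi => by
    rw [Finset.mem_Ioo] at hi
    exact hmem i (by omega) (hst.sn_not_single hM hP.leafCond hi.1 (by omega))
  have hinj' : Set.InjOn (fun i => start M (y i)) (Finset.Ioo 0 (κ - 1)) := fun i hi j hj h => by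
    have hi := Finset.mem_Ioo.1 (Finset.mem_coe.1 hi)
    have hj := Finset.mem_Ioo.1 (Finset.mem_coe.1 hj)
    exact hinj i (by omega) j (by omega) h
  have himg : (Finset.Ioo 0 (κ - 1)).image (fun i => start M (y i)) = otherFin M c := by
    apply Finset.eq_of_subset_of_card_le
    · intro t ht
      obtain ⟨i, hi, rfl⟩ := Finset.mem_image.1 ht
      exact hmid i hi
    · rw [Finset.card_image_of_injOn hinj', hO, Nat.card_Ioo]
      omega
  constructor
  · by_contra h
    have h0 := hmem 0 (by omega) h
    rw [← himg] at h0
    obtain ⟨i, hi, hi0⟩ := Finset.mem_image.1 h0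
    have hi := Finset.mem_Ioo.1 hi
    have := hinj i (by omega) 0 (by omega) hi0
    omega
  · intro t ht
    have ht' := mem_otherFin.1 ht
    rw [← himg] at ht
    obtain ⟨i, hi, rfl⟩ := Finset.mem_image.1 ht
    have hi := Finset.mem_Ioo.1 hi
    obtain ⟨n, h1, h2⟩ := start_spec hM (hy i (by omega))
    rw [h1.length_unique (hP.isStrip_long ht'.1 ht'.2.1)] at h2
    exact ⟨f i, mem_stripFin.2 ⟨i, by omega, rfl⟩, y i, h2, hyd i (by omega)⟩

-- Different strips of one direction have no common entrance side, so the potential of one does not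
-- change along the other.
omit hP in
theorem const_of_ne (hM : IsDiag M) {c : Fin 6} {s s' : LDart} {n n' : ℕ} {φ : ℤ × ℤ → ℤ} {m : ℤ}
    (hs : IsStrip M s n) (hs' : IsStrip M s' n') (h2 : s.2 = c) (hne : s ≠ s')
    (hcut : IsCut M (stripFin M s' n') c φ m) {x : LDart} (hx : x ∈ stripFin M s n) :
    φ x.1 = φ s.1 ∧ φ (sn M x).1 = φ s.1 ∧ φ (opp M x).1 = φ s.1 ∧
      φ (opp M (sn M x)).1 = φ s.1 := by
  have key : ∀ k : Fin 6, k + 3 ≠ k ∧ k + 1 ≠ k ∧ k + 2 ≠ k ∧ k + 1 ≠ k + 3 ∧ k + 2 ≠ k + 3 := by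
    decide
  obtain ⟨k1, k2, k3, k4, k5⟩ := key c
  have tile : ∀ x ∈ stripFin M s n, φ (sn M x).1 = φ x.1 ∧ φ (opp M x).1 = φ x.1 ∧
      φ (opp M (sn M x)).1 = φ x.1 := by
    intro x hx
    have hxs := hs.side hx
    have hxc : x.2 = c := by rw [hs.snd hM hx, h2]
    have h1 : φ (head x) = φ x.1 := by
      have := hcut.diff x hxs
      rw [if_neg fun h => hne (hs.eq_start hM hs' hx h), if_neg] at this
      · linarith
      · intro h
        have := hcut.snd _ h
        rw [hM.snd_opp hxs, hxc] at this
        exact k1 this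
    have h2 : φ (head (sn M x)) = φ (sn M x).1 := by
      have hsn := hM.snd_sn hxs
      rw [hxc] at hsn
      refine hcut.eq_of_snd hM (hM.sideDart_sn hxs) ?_ ?_ <;> rcases hsn with h | h <;> rw [h] <;>
        assumption
    have h3 : φ (head (opp M x)) = φ (opp M x).1 := by
      have := hcut.diff _ (hM.sideDart_opp hxs)
      rw [hM.opp_opp hxs, if_neg, if_neg fun h => hne (hs.eq_start hM hs' hx h)] at this
      · linarith
      · intro h
        have := hcut.snd _ h
        rw [hM.snd_opp hxs, hxc] at this
        exact k1 this
    have e : (opp M (sn M x)).1 = head (opp M x) := hM.fst_sn (hM.sideDart_opp hxs)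
    rw [e, h3, hM.fst_opp hxs, h2, hM.fst_sn hxs, h1]
    simp
  have base : φ x.1 = φ s.1 := by
    obtain ⟨i, hi, rfl⟩ := mem_stripFin.1 hx
    clear hx
    induction i with
    | zero => rfl
    | succ i ih =>
      have hi' : (stp M)^[i] s ∈ stripFin M s n := mem_stripFin.2 ⟨i, by omega, rfl⟩
      rw [Function.iterate_succ_apply', hM.fst_stp (hs.side hi'), ← ih (by omega)]
      exact (tile _ hi').2.2
  have := tile x hx
  rw [base] at this
  exact ⟨base, this⟩

/-- The value at the end of a long strip that crosses a cut. -/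
theorem value_at_end {c : Fin 6} {E : Finset LDart} {φ : ℤ × ℤ → ℤ} {m : ℤ}
    (hcut : IsCut M E c φ m)
    (hcross : ∀ t ∈ otherFin M c, ∃ x ∈ E, ∃ y ∈ stripFin M t κ, diag M y = diag M x)
    {f : LDart} (hf : Bd M f) (hfs : ¬ Single M f) :
    ((f.2 = c + 1 ∨ f.2 = c + 2) → φ f.1 = m + 1) ∧
      ((f.2 = c + 4 ∨ f.2 = c + 5) → φ f.1 = m) := by
  have hM := hP.toIsDiag
  have hside := hM.sideDart_of_bd hf
  by_cases hf3 : f.2 < 3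
  · have hfne : (f.2 = c + 1 ∨ f.2 = c + 2 ∨ f.2 = c + 4 ∨ f.2 = c + 5) → f ∈ otherFin M c := by
      intro h
      rw [mem_otherFin]
      refine ⟨hf, hfs, hf3, ?_⟩
      have : ∀ c a : Fin 6, (a = c + 1 ∨ a = c + 2 ∨ a = c + 4 ∨ a = c + 5) → a ≠ c := by decide
      exact this _ _ h
    have hst := hP.isStrip_long hf hfs
    constructor
    · intro h
      obtain ⟨x, hx, y, hy, hd⟩ := hcross f (hfne (by tauto))
      obtain ⟨j, hj, rfl⟩ := mem_stripFin.1 hy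
      have : ∀ c a : Fin 6, (a = c + 1 ∨ a = c + 2) → (c = a + 4 ∨ c = a + 5) := by decide
      exact (hcut.cross_down hM hst (this _ _ h) hj hx hd).1 0 (by omega)
    · intro h
      obtain ⟨x, hx, y, hy, hd⟩ := hcross f (hfne (by tauto))
      obtain ⟨j, hj, rfl⟩ := mem_stripFin.1 hy
      have : ∀ c a : Fin 6, (a = c + 4 ∨ a = c + 5) → (c = a + 1 ∨ c = a + 2) := by decide
      exact (hcut.cross_up hM hst (this _ _ h) hj hx hd).1 0 (by omega)
  -- Here `f` is the far end of a long strip in a normalized direction: the strip `t` through the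
  -- opposite side ends at `rev f`.
  · have ho := hM.sideDart_opp hside
    obtain ⟨n, h1, h2⟩ := start_spec hM ho
    have hons : ¬ Single M (opp M f) := fun h => hfs ⟨hf, h.1⟩
    have hts : ¬ Single M (start M (opp M f)) := by rwa [single_start hM ho]
    have ht2 : (start M (opp M f)).2 = f.2 + 3 := by rw [snd_start hM ho, hM.snd_opp hside]
    set t := start M (opp M f)
    have hst := hP.isStrip_long h1.2.1 hts
    rw [h1.length_unique hst] at h2
    obtain ⟨i, hi, hif⟩ := mem_stripFin.1 h2
    have hstp : (stp M)^[i + 1] t = rev f := by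
      rw [Function.iterate_succ_apply', hif, stp, hM.opp_opp hside]
    have hin : i + 1 = κ := by
      by_contra hne
      have := hst.2.2.1 (i + 1) (by omega)
      rw [hstp] at this
      exact hf.2 this.1
    rw [hin] at hstp
    have hfne : (f.2 = c + 1 ∨ f.2 = c + 2 ∨ f.2 = c + 4 ∨ f.2 = c + 5) →
        t ∈ otherFin M c ∧ φ (head f) = φ f.1 := by
      intro h
      rw [mem_otherFin, ht2]
      have : ∀ c a : Fin 6, (a = c + 1 ∨ a = c + 2 ∨ a = c + 4 ∨ a = c + 5) →
        a + 3 ≠ c ∧ a ≠ c ∧ a ≠ c + 3 := by decide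
      have := this _ _ h
      exact ⟨⟨h1.2.1, hts, add_three_lt _ hf3, this.1⟩,
        hcut.eq_of_snd hM hside this.2.1 this.2.2⟩
    constructor
    · intro h
      obtain ⟨ht, he⟩ := hfne (by tauto)
      obtain ⟨x, hx, y, hy, hd⟩ := hcross t ht
      obtain ⟨j, hj, rfl⟩ := mem_stripFin.1 hy
      have : ∀ c a : Fin 6, (a = c + 1 ∨ a = c + 2) → (c = a + 3 + 1 ∨ c = a + 3 + 2) := by decide
      have := (hcut.cross_up hM hst (by rw [ht2]; exact this _ _ h) hj hx hd).2 κ hj le_rfl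
      rw [hstp, fst_rev] at this
      rw [← he, this]
    · intro h
      obtain ⟨ht, he⟩ := hfne (by tauto)
      obtain ⟨x, hx, y, hy, hd⟩ := hcross t ht
      obtain ⟨j, hj, rfl⟩ := mem_stripFin.1 hy
      have : ∀ c a : Fin 6, (a = c + 4 ∨ a = c + 5) → (c = a + 3 + 4 ∨ c = a + 3 + 5) := by decide
      have := (hcut.cross_down hM hst (by rw [ht2]; exact this _ _ h) hj hx hd).2 κ hj le_rfl
      rw [hstp, fst_rev] at this
      rw [← he, this]

/-- Here `s` lies between `d` and `u`. All long strips of other directions cross both `d` and `u`,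
so none of them has its upper end below `u` or its lower end above `d`. The first tile of `s` has a
single cross strip and leans to one of the two sides; the corresponding one of `false_of_leaf_above`
and `false_of_leaf_below` applies. -/
theorem false_of_middle (hκ : 2 < κ) {c : Fin 6} (hc : c < 3)
    (hO : (otherFin M c).card = κ - 2) {s u d : LDart} (hs : s ∈ longFin M c)
    (hu : u ∈ longFin M c) (hd : d ∈ longFin M c) (hsu : s ≠ u) (hsd : s ≠ d)
    {φ ψ : ℤ × ℤ → ℤ} {m l : ℤ} (hφ : IsCut M (stripFin M u κ) c φ m)
    (hψ : IsCut M (stripFin M d κ) c ψ l) (hφs : φ s.1 = m) (hψs : ψ s.1 = l + 1) : False := by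
  have hM := hP.toIsDiag
  have hl := hP.leafCond
  have hleaf : ∀ d, Bd M d → d.2 = c → ¬ Single M d → Single M (sn M d) := fun d h1 h2 h3 =>
    (hP.leaf_and_cross hκ hc hO (mem_longFin.2 ⟨h1, h3, h2⟩)).1
  have hcu := (hP.leaf_and_cross hκ hc hO hu).2
  have hcd := (hP.leaf_and_cross hκ hc hO hd).2
  rw [mem_longFin] at hs hu hd
  have hst := hP.isStrip_long hs.1 hs.2.1
  have hut := hP.isStrip_long hu.1 hu.2.1
  have hdt := hP.isStrip_long hd.1 hd.2.1
  have hss := hM.sideDart_of_bd hs.1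
  have hmem : s ∈ stripFin M s κ := mem_stripFin.2 ⟨0, by omega, rfl⟩
  have h2 : ¬ Single M (sn M (stp M s)) :=
    hst.sn_not_single hM hl (i := 1) one_pos (by omega)
  have cu := const_of_ne hM hst hut hs.2.2 hsu hφ hmem
  have cd := const_of_ne hM hst hdt hs.2.2 hsd hψ hmem
  have hlow2 : ∀ {v : LDart} {χ : ℤ × ℤ → ℤ} {p : ℤ}, IsCut M (stripFin M v κ) c χ p → Bd M v →
      ¬ Single M v → ∀ f, Single M f → f.2 = c → χ (head f) = χ f.1 := by
    intro v χ p hχ hv hvs f hf hfc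
    have hfs := hM.sideDart_of_bd hf.1
    have := hχ.diff f hfs
    rw [if_neg, if_neg] at this
    · linarith
    · intro h
      have h' := hχ.snd _ h
      rw [hM.snd_opp hfs, hfc] at h'
      have : ∀ k : Fin 6, k + 3 ≠ k := by decide
      exact this _ h'
    · intro h
      have h1 : f ∈ stripFin M f 1 := by rw [stripFin_one, Finset.mem_singleton]
      have := (isStrip_one hM hf).eq_start hM (hP.isStrip_long hv hvs) h1 h
      exact hvs (this ▸ hf)
  have hne : ∀ c a : Fin 6, (a = c + 1 ∨ a = c + 2) ∨ (a = c + 4 ∨ a = c + 5) →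
      a ≠ c ∧ a ≠ c + 3 := by decide
  have hinv : ∀ {E : Finset LDart} {χ : ℤ × ℤ → ℤ} {p : ℤ}, IsCut M E c χ p → ∀ f, SideDart M f →
      (f.2 = c + 1 ∨ f.2 = c + 2) ∨ (f.2 = c + 4 ∨ f.2 = c + 5) → χ (head f) = χ f.1 :=
    fun hχ f hf hfc => hχ.eq_of_snd hM hf (hne _ _ hfc).1 (hne _ _ hfc).2
  have hdir := hM.snd_sn hss
  rw [hs.2.2] at hdir
  rcases hdir with hdir | hdir
  · refine false_of_leaf_above hM hl (k := c) (high := fun v => ψ v = l + 1) ?_ ?_ ?_ hleaf hs.1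
      hs.2.2 hs.2.1 hdir ?_ h2
    · intro f hf hfc hfs hfl hb
      have := (hP.value_at_end hψ hcd hb hfs).2 hfc
      rw [hinv hψ f hf (Or.inr hfc)] at hfl
      omega
    · intro f hf hfc hfl
      rwa [hinv hψ f hf (Or.inr hfc)] at hfl
    · intro f hf hfc hfl
      rwa [hlow2 hψ hd.1 hd.2.1 f hf hfc] at hfl
    · rw [← hM.fst_sn (hM.sideDart_opp hss), ← hψs]
      exact cd.2.2.2
  · refine false_of_leaf_below hM hl (k := c) (low := fun v => φ v = m) ?_ ?_ ?_ hleaf hs.1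
      hs.2.2 hs.2.1 hdir ?_ h2
    · intro f hf hfc hfs hfl hb
      have := (hP.value_at_end hφ hcu hb hfs).1 hfc
      omega
    · intro f hf hfc hfl
      rwa [← hinv hφ f hf (Or.inl hfc)] at hfl
    · intro f hf hfc hfl
      rwa [← hlow2 hφ hu.1 hu.2.1 f hf hfc] at hfl
    · rw [← hφs]; exact cu.2.2.1

/-- All long strips of direction `c` cross one common strip `t`, and the order of the crossings
along `t` tells which of three lies in the middle. -/
theorem false_of_three (hκ : 2 < κ) {c : Fin 6} (hc : c < 3)
    (hO : (otherFin M c).card = κ - 2) (h3 : 3 ≤ (longFin M c).card) : False := by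
  have hM := hP.toIsDiag
  obtain ⟨t, ht⟩ : (otherFin M c).Nonempty := by rw [← Finset.card_pos]; omega
  have ht' := mem_otherFin.1 ht
  have htt := hP.isStrip_long ht'.1 ht'.2.1
  have hpos : ∀ s ∈ longFin M c, ∃ j < κ, ∃ x ∈ stripFin M s κ,
      diag M ((stp M)^[j] t) = diag M x := fun s hs => by
    obtain ⟨x, hx, y, hy, hd⟩ := (hP.leaf_and_cross hκ hc hO hs).2 t ht
    obtain ⟨j, hj, rfl⟩ := mem_stripFin.1 hy
    exact ⟨j, hj, x, hx, hd⟩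
  have hstrip : ∀ {s}, s ∈ longFin M c → IsStrip M s κ := fun {s} hs =>
    hP.isStrip_long (mem_longFin.1 hs).1 (mem_longFin.1 hs).2.1
  have hsc : ∀ {s}, s ∈ longFin M c → s.2 = c := fun {s} hs => (mem_longFin.1 hs).2.2
  have main : ∀ s1 ∈ longFin M c, ∀ s2 ∈ longFin M c, ∀ s3 ∈ longFin M c, s1 ≠ s2 → s2 ≠ s3 →
      ∀ j1 j2 j3 x1 x2 x3, j1 < j2 → j2 < j3 → j3 < κ → x1 ∈ stripFin M s1 κ →
      x2 ∈ stripFin M s2 κ → x3 ∈ stripFin M s3 κ → diag M ((stp M)^[j1] t) = diag M x1 →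
      diag M ((stp M)^[j2] t) = diag M x2 → diag M ((stp M)^[j3] t) = diag M x3 → False := by
    intro s1 hs1 s2 hs2 s3 hs3 h12 h23 j1 j2 j3 x1 x2 x3 hj12 hj23 hj3 hx1 hx2 hx3 hd1 hd2 hd3
    obtain ⟨φ, m, hφ⟩ := exists_isCut hM hP.covConn hP.uncovConn (hstrip hs1)
    obtain ⟨ψ, l, hψ⟩ := exists_isCut hM hP.covConn hP.uncovConn (hstrip hs3)
    rw [hsc hs1] at hφ
    rw [hsc hs3] at hψ
    have hval : ∀ {v : LDart} {χ : ℤ × ℤ → ℤ} {p : ℤ}, v ∈ longFin M c → s2 ≠ v →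
        IsCut M (stripFin M v κ) c χ p → χ s2.1 = χ ((stp M)^[j2] t).1 := by
      intro v χ p hv hne hχ
      obtain ⟨a, b, e, g⟩ := const_of_ne hM (hstrip hs2) (hstrip hv) (hsc hs2) hne hχ hx2
      rcases hM.eq_of_diag_eq ((hstrip hs2).side hx2) (htt.2.2.1 j2 (by omega)) hd2 with
        h | h | h | h <;> rw [h]
      exacts [a.symm, b.symm, e.symm, g.symm]
    have v1 := hval hs1 h12.symm hφ
    have v3 := hval hs3 h23 hψ
    -- The sense in which `t` crosses the cuts decides which of `s1` and `s3` is the upper one.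
    rcases up_or_down c t.2 hc ht'.2.2.1 ht'.2.2.2.symm with hk | hk
    · have a1 := (hφ.cross_up hM htt hk (by omega) hx1 hd1).2 j2 hj12 (by omega)
      have a3 := (hψ.cross_up hM htt hk (by omega) hx3 hd3).1 j2 hj23.le
      exact hP.false_of_middle hκ hc hO hs2 hs3 hs1 h23 h12.symm hψ hφ (v3.trans a3) (v1.trans a1)
    · have a1 := (hφ.cross_down hM htt hk (by omega) hx1 hd1).2 j2 hj12 (by omega)
      have a3 := (hψ.cross_down hM htt hk (by omega) hx3 hd3).1 j2 hj23.le
      exact hP.false_of_middle hκ hc hO hs2 hs1 hs3 h12.symm h23 hφ hψ (v1.trans a1) (v3.trans a3)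
  have hjne : ∀ {s s' x x' j j'}, s ∈ longFin M c → s' ∈ longFin M c → s ≠ s' →
      x ∈ stripFin M s κ → x' ∈ stripFin M s' κ → diag M ((stp M)^[j] t) = diag M x →
      diag M ((stp M)^[j'] t) = diag M x' → j ≠ j' := by
    rintro s s' x x' j _ hs hs' hne hx hx' hd hd' rfl
    have h1 := (hstrip hs).snd hM hx
    have h2 := (hstrip hs').snd hM hx'
    have : x' = x := hM.eq_of_diag_of_snd ((hstrip hs).side hx) ((hstrip hs').side hx')
      (hd'.symm.trans hd) (by rw [h1, h2, hsc hs, hsc hs'])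
    rw [this] at hx'
    exact hne ((hstrip hs).eq_start hM (hstrip hs') hx hx')
  obtain ⟨s1, h1, s2, h2, s3, h3, h12, h13, h23⟩ := Finset.two_lt_card.1 h3
  obtain ⟨j1, hj1, x1, hx1, hd1⟩ := hpos s1 h1
  obtain ⟨j2, hj2, x2, hx2, hd2⟩ := hpos s2 h2
  obtain ⟨j3, hj3, x3, hx3, hd3⟩ := hpos s3 h3
  have n12 := hjne h1 h2 h12 hx1 hx2 hd1 hd2
  have n13 := hjne h1 h3 h13 hx1 hx3 hd1 hd3
  have n23 := hjne h2 h3 h23 hx2 hx3 hd2 hd3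
  rcases lt_or_gt_of_ne n12 with a | a <;> rcases lt_or_gt_of_ne n13 with b | b <;>
    rcases lt_or_gt_of_ne n23 with e | e
  · exact main s1 h1 s2 h2 s3 h3 h12 h23 _ _ _ _ _ _ a e hj3 hx1 hx2 hx3 hd1 hd2 hd3
  · exact main s1 h1 s3 h3 s2 h2 h13 h23.symm _ _ _ _ _ _ b e hj2 hx1 hx3 hx2 hd1 hd3 hd2
  · omega
  · exact main s3 h3 s1 h1 s2 h2 h13.symm h12 _ _ _ _ _ _ b a hj2 hx3 hx1 hx2 hd3 hd1 hd2
  · exact main s2 h2 s1 h1 s3 h3 h12.symm h13 _ _ _ _ _ _ a b hj3 hx2 hx1 hx3 hd2 hd1 hd3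
  · omega
  · exact main s2 h2 s3 h3 s1 h1 h23 h13.symm _ _ _ _ _ _ e b hj1 hx2 hx3 hx1 hd2 hd3 hd1
  · exact main s3 h3 s2 h2 s1 h1 h23.symm h12.symm _ _ _ _ _ _ e a hj1 hx3 hx2 hx1 hd3 hd2 hd1

end IsPatch

end KDoku

/-! ### The arithmetic of the bounds. -/

namespace KDoku

open LDart IsDiag

variable {M : Finset LDart} {κ : ℕ}

theorem card_otherFin (M : Finset LDart) :
    (otherFin M 0).card = (longFin M 1).card + (longFin M 2).card ∧
    (otherFin M 1).card = (longFin M 0).card + (longFin M 2).card ∧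
    (otherFin M 2).card = (longFin M 0).card + (longFin M 1).card := by
  have key : ∀ a b c : Fin 6, a ≠ b → (∀ k, (k < 3 ∧ k ≠ c) ↔ (k = a ∨ k = b)) →
      (otherFin M c).card = (longFin M a).card + (longFin M b).card := by
    intro a b c hab h
    rw [← Finset.card_union_of_disjoint]
    · congr 1
      ext s
      rw [mem_otherFin, Finset.mem_union, mem_longFin, mem_longFin, h]
      tauto
    · rw [Finset.disjoint_left]
      intro s hs hs'
      rw [mem_longFin] at hs hs'
      exact hab (hs.2.2.symm.trans hs'.2.2)
  exact ⟨key 1 2 0 (by decide) (by decide), key 0 2 1 (by decide) (by decide),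
    key 0 1 2 (by decide) (by decide)⟩

/-- The number of long strips, each counted once. -/
def numLong (M : Finset LDart) : ℕ :=
  (longFin M 0).card + (longFin M 1).card + (longFin M 2).card

/-- The inequalities for a doku tiling of the triangular lattice. -/
theorem IsPatch.bounds (hP : IsPatch κ M) (hκ : 5 ≤ κ) :
    2 * (tiles M).card ≤ (κ + 1) * numLong M + 3 ∧ κ * numLong M ≤ 2 * (tiles M).card ∧
      3 * κ ^ 2 ≤ 4 * (tiles M).card + 3 := by
  have hM := hP.toIsDiag
  have h1 := card_tiles hM
  obtain ⟨h2, -, h3⟩ := hP.counts (by omega)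
  have h4 := hP.tip_le (by omega)
  have h5 := card_tiles_le_add hM
  have h6 := hP.card_crossing_le
  have h7 := card_otherFin M
  have s0 := hP.false_of_three (c := 0) (by omega) (by decide)
  have s1 := hP.false_of_three (c := 1) (by omega) (by decide)
  have s2 := hP.false_of_three (c := 2) (by omega) (by decide)
  rw [h7.1] at s0
  rw [h7.2.1] at s1
  rw [h7.2.2] at s2
  have hcard : 3 ≤ M.card := by
    obtain ⟨D, hD⟩ := hP.nonempty
    obtain ⟨D', hD', hne, hne'⟩ := hP.exists_other D hD
    have : ({D, rev D, D'} : Finset LDart) ⊆ M := by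
      intro x hx
      simp only [Finset.mem_insert, Finset.mem_singleton] at hx
      rcases hx with rfl | rfl | rfl
      exacts [hD, hM.rev_mem _ hD, hD']
    refine le_trans ?_ (Finset.card_le_card this)
    rw [Finset.card_insert_of_notMem, Finset.card_pair hne'.symm]
    simp only [Finset.mem_insert, Finset.mem_singleton, not_or]
    exact ⟨(rev_ne D).symm, hne.symm⟩
  clear h7
  unfold numLong
  rw [h3] at h5
  generalize (longFin M 0).card = a at *
  generalize (longFin M 1).card = b at *
  generalize (longFin M 2).card = c at *
  generalize ((bdFin M).filter (Tip M)).card = n at *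
  generalize (tiles M).card = τ at *
  generalize ((tiles M).filter (Crossing M)).card = q at *
  clear h3 hM hP
  rw [← h1] at h2 hcard
  obtain ⟨ρ, hρ⟩ : ∃ ρ, a + b + c = ρ := ⟨_, rfl⟩
  rw [hρ] at h2 h4 ⊢
  -- Both linear bounds follow from 2τ = κρ + n and 0 ≤ n ≤ ρ + 3.
  refine ⟨by nlinarith, by omega, ?_⟩
  by_contra! hlt
  have hq3 : 3 * (c * b + a * c + b * a) ≤ ρ ^ 2 := by
    rw [← hρ]
    zify
    nlinarith [sq_nonneg ((a : ℤ) - b), sq_nonneg ((b : ℤ) - c), sq_nonneg ((a : ℤ) - c)]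
  have h2ρ : 2 * ρ < 3 * κ := by
    by_contra! h
    nlinarith
  -- From κρ = 2τ - n and τ ≤ q + n one gets κρ ≤ τ + ρ²/3, hence (3κ - 2ρ)² ≥ 9κ² - 12τ > 9.
  have h4ρ : 2 * ρ + 4 ≤ 3 * κ := by
    have hlin : κ * ρ ≤ τ + (c * b + a * c + b * a) := by omega
    have hsq : (9 : ℤ) < (3 * κ - 2 * ρ) ^ 2 := by
      zify at hlin hq3 hlt
      linarith [show (3 * (κ : ℤ) - 2 * ρ) ^ 2 = 9 * κ ^ 2 - 12 * (κ * ρ) + 4 * ρ ^ 2 by ring]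
    by_contra! h
    have h1 : (0 : ℤ) ≤ 3 * κ - 2 * ρ := by omega
    have h2 : 3 * (κ : ℤ) - 2 * ρ ≤ 3 := by omega
    generalize 3 * (κ : ℤ) - 2 * ρ = e at *
    interval_cases e <;> omega
  -- Eliminating τ gives κρ ≤ 2q + n, where n ≤ ρ + 3. Against 3κ ≥ 2ρ + 4 this leaves ρ ≤ 9.
  have hκρ : 3 * (κ * ρ) ≤ 2 * ρ ^ 2 + 3 * ρ + 9 := by omega
  have hρ9 : ρ ≤ 9 := by nlinarith
  have hκ20 : ρ = 0 ∨ κ ≤ 20 := by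
    rcases Nat.eq_zero_or_pos ρ with h | h
    · exact Or.inl h
    · right; nlinarith
  rcases Nat.eq_zero_or_pos ρ with h0 | h0
  · subst h0; omega
  -- This needs κ ≥ 5; for example κ = 4, ρ = 4 satisfies both inequalities.
  have hcase : κ = 6 ∧ ρ = 7 := by
    have : κ ≤ 20 := by omega
    clear hq3 hlt h6 h5 h2 s0 s1 s2 h2ρ h1 h4 hcard
    interval_cases ρ <;> omega
  obtain ⟨rfl, rfl⟩ := hcase
  -- Three numbers with sum 7 reach 16 only as 3, 2, 2. The direction with 3 long strips faces 2 + 2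
  -- = κ - 2 others.
  have hq16 : 16 ≤ c * b + a * c + b * a := by omega
  have ha : a ≤ 7 := by omega
  have hb : b ≤ 7 := by omega
  have hc : c = 7 - a - b := by omega
  subst hc
  clear hq3 hlt h6 h5 h2 h2ρ h1 h4 hcard
  interval_cases a <;> interval_cases b <;>
    first
    | omega
    | (refine s0 ?_ ?_ <;> omega)
    | (refine s1 ?_ ?_ <;> omega)
    | (refine s2 ?_ ?_ <;> omega)

end KDoku

/-! ### Rhombi in the plane in terms of lattice coordinates. -/

namespace KDoku

open LDart IsDiag

theorem omega_mul_omega : omega * omega = omega - 1 := by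
  have h : Real.sqrt 3 * Real.sqrt 3 = 3 := Real.mul_self_sqrt (by norm_num)
  apply Complex.ext <;> simp [omega] <;> nlinarith

theorem omega_im_pos : 0 < omega.im := by
  simp [omega]

theorem eq_zero_of_add_mul_omega {a b : ℝ} (h : (a : ℂ) + b * omega = 0) : a = 0 ∧ b = 0 := by
  have him := congrArg Complex.im h
  simp only [Complex.add_im, Complex.ofReal_im, Complex.mul_im, Complex.ofReal_re, zero_mul,
    add_zero, zero_add, Complex.zero_im] at him
  have hb : b = 0 := (mul_eq_zero.1 him).resolve_right omega_im_pos.ne'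
  subst hb
  simpa using h

theorem one_add_omega_ne_zero : 1 + omega ≠ 0 := fun h => by
  have := (eq_zero_of_add_mul_omega (a := 1) (b := 1) (by simpa using h)).1
  norm_num at this

theorem omega_ne_zero : omega ≠ 0 := fun h => by
  have := omega_im_pos
  rw [h] at this
  exact lt_irrefl _ this

theorem normSq_add_mul_omega (a b : ℝ) :
    Complex.normSq ((a : ℂ) + b * omega) = a ^ 2 + a * b + b ^ 2 := by
  have h : Real.sqrt 3 * Real.sqrt 3 = 3 := Real.mul_self_sqrt (by norm_num)
  rw [Complex.normSq_apply]
  simp [omega]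
  linear_combination (b ^ 2 / 4) * h

/-- The quadratic form is the squared distance in the basis 1, `omega`. In a unit rhombus the
distance √3 is attained only between the two acute vertices. -/
theorem corner_eq {s t s' t' : ℝ} (hs : s ∈ Set.Icc (0 : ℝ) 1) (ht : t ∈ Set.Icc (0 : ℝ) 1)
    (hs' : s' ∈ Set.Icc (0 : ℝ) 1) (ht' : t' ∈ Set.Icc (0 : ℝ) 1)
    (h : (s' - s) ^ 2 + (s' - s) * (t' - t) + (t' - t) ^ 2 = 3) :
    (s = 0 ∧ t = 0 ∧ s' = 1 ∧ t' = 1) ∨ (s = 1 ∧ t = 1 ∧ s' = 0 ∧ t' = 0) := by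
  obtain ⟨h1, h2⟩ := hs
  obtain ⟨h3, h4⟩ := ht
  obtain ⟨h5, h6⟩ := hs'
  obtain ⟨h7, h8⟩ := ht'
  have ha1 : s' - s ≤ 1 := by linarith
  have ha2 : -1 ≤ s' - s := by linarith
  have hb1 : t' - t ≤ 1 := by linarith
  have hb2 : -1 ≤ t' - t := by linarith
  have ha : (s' - s) ^ 2 = 1 := by nlinarith
  have hb : (t' - t) ^ 2 = 1 := by nlinarith
  have ha : s' - s = 1 ∨ s' - s = -1 := mul_self_eq_one_iff.1 (by rw [← sq]; exact ha)
  have hb : t' - t = 1 ∨ t' - t = -1 := mul_self_eq_one_iff.1 (by rw [← sq]; exact hb)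
  rcases ha with ha | ha <;> rcases hb with hb | hb <;> rw [ha, hb] at h
  · left; refine ⟨?_, ?_, ?_, ?_⟩ <;> linarith
  · norm_num at h
  · norm_num at h
  · right; refine ⟨?_, ?_, ?_, ?_⟩ <;> linarith

/-- A rhombus has exactly two descriptions. -/
theorem rhombus_eq {p u p' u' : ℂ} (hu : ‖u‖ = 1) (hu' : ‖u'‖ = 1)
    (h : rhombus p u = rhombus p' u') :
    (p' = p ∧ u' = u) ∨ (p' = p + u + omega * u ∧ u' = -u) := by
  have h1 : p ∈ rhombus p' u' := by
    rw [← h]; exact ⟨0, by simp, 0, by simp, by simp⟩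
  have h2 : p + u + omega * u ∈ rhombus p' u' := by
    rw [← h]; exact ⟨1, by simp, 1, by simp, by push_cast; ring⟩
  obtain ⟨s, hs, t, ht, hz⟩ := h1
  obtain ⟨s', hs', t', ht', hz'⟩ := h2
  -- The long diagonal of one description, expressed in the other; both have length √3.
  have hdiff : u * ((1 : ℝ) + (1 : ℝ) * omega) =
      u' * (((s' - s : ℝ) : ℂ) + ((t' - t : ℝ) : ℂ) * omega) := by
    push_cast
    linear_combination hz' - hz
  have hn := congrArg Complex.normSq hdiff
  rw [Complex.normSq_mul, Complex.normSq_mul, normSq_add_mul_omega, normSq_add_mul_omega,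
    Complex.normSq_eq_norm_sq, Complex.normSq_eq_norm_sq, hu, hu'] at hn
  have hc := one_add_omega_ne_zero
  rcases corner_eq hs ht hs' ht' (by linarith) with ⟨rfl, rfl, rfl, rfl⟩ | ⟨rfl, rfl, rfl, rfl⟩
  · left
    simp only [Complex.ofReal_zero, zero_mul, add_zero] at hz
    refine ⟨hz.symm, ?_⟩
    apply mul_right_cancel₀ hc
    push_cast at hdiff
    linear_combination -hdiff
  · right
    have hu2 : u' = -u := by
      apply mul_right_cancel₀ hc
      push_cast at hdiff
      linear_combination hdiff
    refine ⟨?_, hu2⟩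
    rw [hu2] at hz
    push_cast at hz
    linear_combination -hz

section Lattice

variable (p u : ℂ)

/-- The lattice vector of direction `k`. -/
noncomputable def dirC (k : Fin 6) : ℂ := u * ((dir k).1 + (dir k).2 * omega)

/-- The lattice point with the coordinates `v`. -/
noncomputable def pt (v : ℤ × ℤ) : ℂ := p + u * (v.1 + v.2 * omega)

/-- The tile with the short diagonal `d`. -/
noncomputable def tl (d : LDart) : Set ℂ := rhombus (pt p u (nx (nx d)).1) (dirC u (nx (nx d)).2)

theorem dirC_add_one (k : Fin 6) : dirC u (k + 1) = omega * dirC u k := by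
  have h := omega_mul_omega
  fin_cases k <;> simp [dirC, dir] <;>
    first
    | ring1
    | linear_combination u * h
    | linear_combination -u * h

theorem dirC_add_three (k : Fin 6) : dirC u (k + 3) = -dirC u k := by
  simp only [dirC, dir_add_three, Prod.fst_neg, Prod.snd_neg]
  push_cast
  ring

theorem pt_add (v w : ℤ × ℤ) : pt p u (v + w) = pt p u v + u * (w.1 + w.2 * omega) := by
  simp only [pt, Prod.fst_add, Prod.snd_add]
  push_cast
  ring

theorem pt_add_dir (v : ℤ × ℤ) (k : Fin 6) : pt p u (v + dir k) = pt p u v + dirC u k :=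
  pt_add p u v (dir k)

theorem pt_head (d : LDart) : pt p u (head d) = pt p u d.1 + dirC u d.2 := pt_add_dir p u _ _

variable {p u}

theorem norm_dirC (hu : ‖u‖ = 1) (k : Fin 6) : ‖dirC u k‖ = 1 := by
  have h : Complex.normSq (dirC u k) = 1 := by
    rw [dirC, Complex.normSq_mul, Complex.normSq_eq_norm_sq, hu]
    have := normSq_add_mul_omega ((dir k).1 : ℝ) ((dir k).2 : ℝ)
    push_cast at this
    rw [this]
    fin_cases k <;> simp [dir]
  rw [Complex.normSq_eq_norm_sq] at h
  nlinarith [norm_nonneg (dirC u k)]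

theorem intCoord_inj (hu : ‖u‖ = 1) {v w : ℤ × ℤ}
    (h : u * ((v.1 : ℂ) + v.2 * omega) = u * (w.1 + w.2 * omega)) : v = w := by
  have hu0 : u ≠ 0 := by rintro rfl; simp at hu
  have h := mul_left_cancel₀ hu0 h
  have := eq_zero_of_add_mul_omega (a := ((v.1 - w.1 : ℤ) : ℝ)) (b := ((v.2 - w.2 : ℤ) : ℝ)) (by
    push_cast
    linear_combination h)
  obtain ⟨h1, h2⟩ := this
  ext
  · have := Int.cast_eq_zero.1 h1; omega
  · have := Int.cast_eq_zero.1 h2; omega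

theorem pt_injective (hu : ‖u‖ = 1) : Function.Injective (pt p u) := fun _ _ h =>
  intCoord_inj hu (add_left_cancel h)

theorem dirC_injective (hu : ‖u‖ = 1) : Function.Injective (dirC u) := fun k l h => by
  have := intCoord_inj hu h
  revert this
  revert k l
  have : ∀ k l : Fin 6, dir k = dir l → k = l := by decide
  exact fun k l _ h => this k l h

theorem rhombus_rev (q w : ℂ) : rhombus (q + w + omega * w) (-w) = rhombus q w := by
  ext z
  constructor
  · rintro ⟨s, hs, t, ht, rfl⟩
    refine ⟨1 - s, ⟨by linarith [hs.2], by linarith [hs.1]⟩, 1 - t,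
      ⟨by linarith [ht.2], by linarith [ht.1]⟩, ?_⟩
    push_cast
    ring
  · rintro ⟨s, hs, t, ht, rfl⟩
    refine ⟨1 - s, ⟨by linarith [hs.2], by linarith [hs.1]⟩, 1 - t,
      ⟨by linarith [ht.2], by linarith [ht.1]⟩, ?_⟩
    push_cast
    ring

/-- The second description of the tile. -/
theorem pt_nx_nx_rev (d : LDart) : pt p u (nx (nx (rev d))).1 =
    pt p u (nx (nx d)).1 + dirC u (nx (nx d)).2 + omega * dirC u (nx (nx d)).2 ∧
    dirC u (nx (nx (rev d))).2 = -dirC u (nx (nx d)).2 := by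
  rw [← dirC_add_one, ← dirC_add_three, ← pt_add_dir, ← pt_add_dir]
  rcases d with ⟨⟨x, y⟩, k⟩
  constructor
  · congr 1
    fin_cases k <;> simp [nx, rev, dir]
  · congr 1
    simp only [nx, rev]
    abel

theorem tl_rev (d : LDart) : tl p u (rev d) = tl p u d := by
  rw [tl, (pt_nx_nx_rev d).1, (pt_nx_nx_rev (p := p) d).2, rhombus_rev, tl]

theorem nx_nx_injective : Function.Injective fun d : LDart => nx (nx d) :=
  nx_injective.comp nx_injective

theorem dart_ext (hu : ‖u‖ = 1) {d e : LDart} (h1 : pt p u d.1 = pt p u e.1)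
    (h2 : dirC u d.2 = dirC u e.2) : d = e :=
  Prod.ext (pt_injective hu h1) (dirC_injective hu h2)

/-- The descriptions of a lattice tile. -/
theorem tl_eq_rhombus (hu : ‖u‖ = 1) {d : LDart} {q w : ℂ} (hw : ‖w‖ = 1)
    (h : tl p u d = rhombus q w) : ∃ e, (e = d ∨ e = rev d) ∧
      q = pt p u (nx (nx e)).1 ∧ w = dirC u (nx (nx e)).2 := by
  rcases rhombus_eq (norm_dirC hu _) hw h with ⟨h1, h2⟩ | ⟨h1, h2⟩
  · exact ⟨d, Or.inl rfl, h1, h2⟩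
  · refine ⟨rev d, Or.inr rfl, ?_, ?_⟩
    · rw [h1, (pt_nx_nx_rev d).1]
    · rw [h2, (pt_nx_nx_rev (p := p) d).2]

theorem tl_eq_tl (hu : ‖u‖ = 1) {d e : LDart} (h : tl p u d = tl p u e) : e = d ∨ e = rev d := by
  obtain ⟨x, hx, h1, h2⟩ := tl_eq_rhombus hu (norm_dirC hu _) h
  have := nx_nx_injective (dart_ext hu h1 h2)
  rwa [← this] at hx

/-- The vertices and vectors of a description `(q, w)` in terms of darts. -/
theorem sides_of_desc (e : LDart) :
    pt p u (nx (nx e)).1 + dirC u (nx (nx e)).2 = pt p u e.1 ∧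
    pt p u (nx (nx e)).1 + omega * dirC u (nx (nx e)).2 = pt p u (head e) ∧
    omega * dirC u (nx (nx e)).2 = dirC u (nx (rev e)).2 ∧
    pt p u (nx (nx e)).1 + dirC u (nx (nx e)).2 + omega * dirC u (nx (nx e)).2 =
      pt p u (nx (nx (rev e))).1 := by
  refine ⟨?_, ?_, ?_, ?_⟩
  · rw [← pt_head, head_nx_nx]
  · rw [← dirC_add_one, ← pt_add_dir]
    congr 1
    rcases e with ⟨⟨x, y⟩, k⟩
    fin_cases k <;> simp [nx, head, dir]
  · rw [← dirC_add_one]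
    congr 1
    simp only [nx, rev, add_assoc]
    rfl
  · rw [(pt_nx_nx_rev e).1]

theorem isVertex_tl (hu : ‖u‖ = 1) {d : LDart} {z : ℂ} :
    IsVertex (tl p u d) z ↔ ∃ v ∈ tileVerts d, z = pt p u v := by
  have hrev : tileVerts (rev d) = tileVerts d := by
    ext v
    simp only [tileVerts, Finset.mem_insert, Finset.mem_singleton, rev_rev, head_rev, fst_rev]
    tauto
  constructor
  · rintro ⟨q, w, hw, h, hz⟩
    obtain ⟨e, he, rfl, rfl⟩ := tl_eq_rhombus hu hw h
    obtain ⟨a, b, -, c⟩ := sides_of_desc (p := p) (u := u) e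
    rw [a, b, ← a, c] at hz
    have : tileVerts e = tileVerts d := by
      rcases he with rfl | rfl
      exacts [rfl, hrev]
    rw [← this]
    rw [a] at hz
    rcases hz with hz | hz | hz | hz <;> exact ⟨_, by simp [tileVerts], hz⟩
  · rintro ⟨v, hv, rfl⟩
    refine ⟨_, _, norm_dirC hu _, rfl, ?_⟩
    obtain ⟨a, b, -, c⟩ := sides_of_desc (p := p) (u := u) d
    rw [c, a, b]
    simp only [tileVerts, Finset.mem_insert, Finset.mem_singleton] at hv
    rcases hv with rfl | rfl | rfl | rfl <;> simp

/-- `x` is a side of the tile with the short diagonal `d`, with the tile on its left. -/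
def IsSideOf (d x : LDart) : Prop :=
  x = nx d ∨ x = nx (nx d) ∨ x = nx (rev d) ∨ x = nx (nx (rev d))

theorem IsSideOf.rev_iff {d x : LDart} : IsSideOf (rev d) x ↔ IsSideOf d x := by
  simp only [IsSideOf, rev_rev]; tauto

theorem isSide_tl (hu : ‖u‖ = 1) {d : LDart} {a v : ℂ} :
    IsSide (tl p u d) a v ↔ ∃ x, (IsSideOf d x ∨ IsSideOf d (rev x)) ∧
      a = pt p u x.1 ∧ v = dirC u x.2 := by
  have four : ∀ e : LDart, ∀ a v : ℂ,
      ((a = pt p u (nx (nx e)).1 ∧ v = dirC u (nx (nx e)).2) ∨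
      (a = pt p u (nx (nx e)).1 + omega * dirC u (nx (nx e)).2 ∧ v = dirC u (nx (nx e)).2) ∨
      (a = pt p u (nx (nx e)).1 ∧ v = omega * dirC u (nx (nx e)).2) ∨
      (a = pt p u (nx (nx e)).1 + dirC u (nx (nx e)).2 ∧ v = omega * dirC u (nx (nx e)).2)) ↔
      ∃ x, (x = nx (nx e) ∨ x = rev (nx (nx (rev e))) ∨ x = rev (nx e) ∨ x = nx (rev e)) ∧
        a = pt p u x.1 ∧ v = dirC u x.2 := by
    intro e a v
    obtain ⟨s1, s2, s3, -⟩ := sides_of_desc (p := p) (u := u) e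
    have t1 : (rev (nx (nx (rev e)))).1 = head e := by rw [fst_rev, head_nx_nx, fst_rev]
    have t2 : (rev (nx (nx (rev e)))).2 = (nx (nx e)).2 := by
      simp only [nx, rev, add_assoc]; rfl
    have t3 : (rev (nx e)).1 = (nx (nx e)).1 := rfl
    have t4 : (rev (nx e)).2 = (nx (rev e)).2 := by simp only [nx, rev, add_assoc]; rfl
    have t5 : (nx (rev e)).1 = e.1 := by rw [fst_nx, head_rev]
    rw [s2, s3, s1]
    constructor
    · rintro (⟨rfl, rfl⟩ | ⟨rfl, rfl⟩ | ⟨rfl, rfl⟩ | ⟨rfl, rfl⟩)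
      · exact ⟨_, Or.inl rfl, rfl, rfl⟩
      · exact ⟨_, Or.inr (Or.inl rfl), by rw [t1], by rw [t2]⟩
      · exact ⟨_, Or.inr (Or.inr (Or.inl rfl)), by rw [t3], by rw [t4]⟩
      · exact ⟨_, Or.inr (Or.inr (Or.inr rfl)), by rw [t5], rfl⟩
    · rintro ⟨x, rfl | rfl | rfl | rfl, rfl, rfl⟩
      · exact Or.inl ⟨rfl, rfl⟩
      · rw [t1, t2]; exact Or.inr (Or.inl ⟨rfl, rfl⟩)
      · rw [t3, t4]; exact Or.inr (Or.inr (Or.inl ⟨rfl, rfl⟩))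
      · rw [t5]; exact Or.inr (Or.inr (Or.inr ⟨rfl, rfl⟩))
  have rev_eq : ∀ {x y : LDart}, rev x = y ↔ x = rev y := fun {x y} =>
    ⟨fun h => by rw [← h, rev_rev], fun h => by rw [h, rev_rev]⟩
  constructor
  · rintro ⟨q, w, hw, h, hz⟩
    obtain ⟨e, he, rfl, rfl⟩ := tl_eq_rhombus hu hw h
    obtain ⟨x, hx, h1, h2⟩ := (four e a v).1 hz
    refine ⟨x, ?_, h1, h2⟩
    have : IsSideOf e x ∨ IsSideOf e (rev x) := by
      simp only [IsSideOf, rev_eq]; tauto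
    rcases he with rfl | rfl
    · exact this
    · rwa [IsSideOf.rev_iff, IsSideOf.rev_iff] at this
  · rintro ⟨x, hx, h1, h2⟩
    have key : (x = nx (nx d) ∨ x = rev (nx (nx (rev d))) ∨ x = rev (nx d) ∨ x = nx (rev d)) ∨
        (x = nx (nx (rev d)) ∨ x = rev (nx (nx d)) ∨ x = rev (nx (rev d)) ∨ x = nx d) := by
      simp only [IsSideOf, rev_eq] at hx; tauto
    rcases key with hx | hx
    · exact ⟨_, _, norm_dirC hu _, rfl, (four d a v).2 ⟨x, hx, h1, h2⟩⟩
    · refine ⟨_, _, norm_dirC hu _, (tl_rev d).symm, (four (rev d) a v).2 ⟨x, ?_, h1, h2⟩⟩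
      rw [rev_rev]; exact hx

end Lattice

end KDoku

/-! ### From a tiling of the plane to a set of short diagonals. -/

namespace KDoku

open LDart IsDiag

section Lattice

variable {p u : ℂ}

theorem tl_nx (e : LDart) : tl p u (nx e) = rhombus (pt p u e.1) (dirC u e.2) := by
  rw [tl, nx_nx_nx]

theorem pt_sub_dirC (v : ℤ × ℤ) (k : Fin 6) : pt p u v - dirC u k = pt p u (v + dir (k + 3)) := by
  rw [pt_add_dir, dirC_add_three, sub_eq_add_neg]

/-- A tile that shares a side with a lattice tile is a lattice tile. -/
theorem exists_tl_of_shareSide (hu : ‖u‖ = 1) {d : LDart} {B : Set ℂ} {v : ℂ}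
    (h : ShareSide v (tl p u d) B) : ∃ e, B = tl p u e := by
  obtain ⟨a, h1, q, w, hw, hB, hq⟩ := h
  -- A rhombus with a given side has four possible positions, and all of them lie in the lattice.
  obtain ⟨x, -, rfl, rfl⟩ := (isSide_tl hu).1 h1
  have hpred : ∀ w : ℂ, dirC u x.2 = omega * w → w = dirC u (x.2 - 1) := fun w h => by
    apply mul_left_cancel₀ omega_ne_zero
    rw [← h, ← dirC_add_one, sub_add_cancel]
  rcases hq with ⟨h1, h2⟩ | ⟨h1, h2⟩ | ⟨h1, h2⟩ | ⟨h1, h2⟩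
  · exact ⟨nx x, by rw [tl_nx, hB, h1, h2]⟩
  · refine ⟨nx (x.1 + dir (x.2 + 1 + 3), x.2), ?_⟩
    rw [tl_nx, ← pt_sub_dirC, dirC_add_one, hB, h1, h2, add_sub_cancel_right]
  · refine ⟨nx (x.1, x.2 - 1), ?_⟩
    rw [tl_nx, ← hpred w h2, hB, h1]
  · refine ⟨nx (x.1 + dir (x.2 - 1 + 3), x.2 - 1), ?_⟩
    rw [tl_nx, ← pt_sub_dirC, ← hpred w h2, hB, h1, add_sub_cancel_right]

end Lattice

/-- The tiles of `T` are tiles of the lattice with the short diagonals `M`. -/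
structure Represents (p u : ℂ) (T : Finset (Set ℂ)) (M : Finset LDart) : Prop where
  norm : ‖u‖ = 1
  mem : ∀ d, d ∈ M ↔ tl p u d ∈ T
  surj : ∀ A ∈ T, ∃ d, tl p u d = A

/-- One tile fixes the lattice, and adjacency carries it to all others. A tile has only the two
diagonals `d` and `rev d`, so `M` is finite. -/
theorem exists_represents {κ : ℕ} {T : Finset (Set ℂ)} (hT : IsDokuTiling κ T) :
    ∃ p u M, Represents p u T M := by
  obtain ⟨A0, hA0⟩ : T.Nonempty := Finset.card_pos.1 (by have := hT.one_lt_card; omega)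
  obtain ⟨p, u, hu, hA⟩ := hT.isTile A0 hA0
  have hsurj : ∀ A ∈ T, ∃ d, tl p u d = A := by
    intro A hA'
    have hr := hT.edge_connected.preconnected ⟨A0, hA0⟩ ⟨A, hA'⟩
    rw [SimpleGraph.reachable_iff_reflTransGen] at hr
    have key : ∀ B : (T : Set (Set ℂ)), Relation.ReflTransGen
        (adjacencyGraph.induce (T : Set (Set ℂ))).Adj ⟨A0, hA0⟩ B → ∃ d, tl p u d = B := by
      intro B hB
      induction hB with
      | refl =>
        refine ⟨nx ((0, 0), 0), ?_⟩
        rw [tl_nx]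
        change _ = A0
        rw [hA]
        simp [pt, dirC, dir]
      | @tail b c _ hab ih =>
        obtain ⟨d, hd⟩ := ih
        rw [SimpleGraph.comap_adj] at hab
        obtain ⟨-, v, hv⟩ := hab
        change ShareSide v b c at hv
        rw [← hd] at hv
        obtain ⟨e, he⟩ := exists_tl_of_shareSide hu hv
        exact ⟨e, he.symm⟩
    exact key _ hr
  have hfin : {d : LDart | tl p u d ∈ T}.Finite := by
    have : {d : LDart | tl p u d ∈ T} = ⋃ A ∈ T, {d | tl p u d = A} := by
      ext d; simp
    rw [this]
    refine Set.Finite.biUnion (Finset.finite_toSet T) fun A _ => ?_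
    by_cases h : ∃ d, tl p u d = A
    · obtain ⟨d, rfl⟩ := h
      refine (Set.toFinite {d, rev d}).subset fun e he => ?_
      have he' : tl p u e = tl p u d := he
      exact tl_eq_tl hu he'.symm
    · convert Set.finite_empty
      ext d
      exact iff_of_false (fun hd => h ⟨d, hd⟩) id
  exact ⟨p, u, hfin.toFinset, hu, fun d => by simp, hsurj⟩

theorem vertex_mem_tl {p u : ℂ} {d : LDart} {v : ℤ × ℤ} (hv : v ∈ tileVerts d) :
    pt p u v ∈ tl p u d := by
  obtain ⟨a, b, -, c⟩ := sides_of_desc (p := p) (u := u) d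
  simp only [tileVerts, Finset.mem_insert, Finset.mem_singleton] at hv
  rcases hv with rfl | rfl | rfl | rfl
  · exact ⟨1, by simp, 0, by simp, by rw [← a]; simp⟩
  · exact ⟨0, by simp, 1, by simp, by rw [← b]; simp⟩
  · exact ⟨0, by simp, 0, by simp, by simp⟩
  · exact ⟨1, by simp, 1, by simp, by rw [← c]; simp⟩

theorem exists_of_mem_segment {a v z : ℂ} (h : z ∈ segment ℝ a (a + v)) :
    ∃ s : ℝ, z = a + s * v := by
  rw [segment_eq_image] at h
  obtain ⟨s, -, rfl⟩ := h
  refine ⟨s, ?_⟩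
  simp only [Complex.real_smul]
  push_cast
  ring

namespace Represents

variable {p u : ℂ} {κ : ℕ} {T : Finset (Set ℂ)} {M : Finset LDart} (h : Represents p u T M)
include h

theorem rev_mem {d : LDart} (hd : d ∈ M) : rev d ∈ M := by
  rw [h.mem] at hd ⊢
  rwa [tl_rev]

theorem tl_ne_tl_nx (d : LDart) : tl p u d ≠ tl p u (nx d) := by
  intro he
  have key : ∀ k : Fin 6, k + 2 ≠ k ∧ k + 2 ≠ k + 3 := by decide
  rcases tl_eq_tl h.norm he with h' | h'
  · exact (key d.2).1 (congrArg Prod.snd h')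
  · exact (key d.2).2 (congrArg Prod.snd h')

/-- Two tiles with diagonals on one triangle would share its three vertices. These are not
collinear, so the intersection is neither empty, nor a point, nor a segment. -/
theorem isDiag (hT : IsDokuTiling κ T) : IsDiag M where
  rev_mem _ hd := h.rev_mem hd
  excl d hd hn := by
    have hu := h.norm
    rw [h.mem] at hd hn
    have hne := h.tl_ne_tl_nx d
    have m1 : pt p u d.1 ∈ tl p u d ∩ tl p u (nx d) := ⟨vertex_mem_tl (by simp [tileVerts]),
      vertex_mem_tl (by simp [tileVerts])⟩
    have m2 : pt p u (head d) ∈ tl p u d ∩ tl p u (nx d) := ⟨vertex_mem_tl (by simp [tileVerts]),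
      vertex_mem_tl (by simp [tileVerts])⟩
    have m3 : pt p u (head (nx d)) ∈ tl p u d ∩ tl p u (nx d) :=
      ⟨vertex_mem_tl (by simp [tileVerts]), vertex_mem_tl (by simp [tileVerts])⟩
    rcases hT.meet _ hd _ hn hne with h' | ⟨z, -, -, h'⟩ | ⟨a, v, -, -, h'⟩
    · rw [h'] at m1; exact m1
    · rw [h'] at m1 m2
      exact fst_ne_head d (pt_injective hu (m1.trans m2.symm))
    · rw [h'] at m1 m2 m3
      obtain ⟨s1, e1⟩ := exists_of_mem_segment m1
      obtain ⟨s2, e2⟩ := exists_of_mem_segment m2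
      obtain ⟨s3, e3⟩ := exists_of_mem_segment m3
      have hk0 : dirC u d.2 ≠ 0 := fun h0 => by
        have := norm_dirC hu d.2
        rw [h0, norm_zero] at this
        exact zero_ne_one this
      have f1 : dirC u d.2 = (s2 - s1) * v := by
        have := pt_head p u d
        linear_combination e2 - e1 - this
      have f2 : omega * dirC u d.2 = (s3 - s1) * v := by
        have hh : head (nx d) = d.1 + dir (d.2 + 1) := by
          rw [← dir_add_dir, ← add_assoc]; rfl
        rw [hh, pt_add_dir, dirC_add_one] at e3
        linear_combination e3 - e1
      have hv0 : v ≠ 0 := by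
        rintro rfl
        rw [mul_zero] at f1
        exact hk0 f1
      have f3 : (((s1 - s3 : ℝ) : ℂ) + ((s2 - s1 : ℝ) : ℂ) * omega) = 0 := by
        apply mul_right_cancel₀ hv0
        push_cast
        linear_combination f2 - omega * f1
      obtain ⟨-, f4⟩ := eq_zero_of_add_mul_omega f3
      have f5 : (s2 : ℂ) - s1 = 0 := by rw [← Complex.ofReal_sub, f4, Complex.ofReal_zero]
      rw [f5, zero_mul] at f1
      exact hk0 f1

omit h in
theorem tl_normDart (d : LDart) : tl p u (normDart d) = tl p u d := by
  unfold normDart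
  split_ifs
  exacts [rfl, tl_rev d]

theorem tl_eq_iff {d e : LDart} : tl p u d = tl p u e ↔ normDart d = normDart e := by
  constructor
  · intro he
    rcases tl_eq_tl h.norm he with rfl | rfl
    exacts [rfl, (normDart_rev _).symm]
  · intro he
    rw [← tl_normDart, he, tl_normDart]

theorem card_tiles (hT : IsDokuTiling κ T) : (tiles M).card = T.card := by
  refine Finset.card_bij (fun d _ => tl p u d) ?_ ?_ ?_
  · intro d hd
    exact (h.mem d).1 (Finset.mem_filter.1 hd).1
  · intro a ha b hb hab
    have := h.tl_eq_iff.1 hab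
    rwa [normDart, normDart, if_pos (Finset.mem_filter.1 ha).2,
      if_pos (Finset.mem_filter.1 hb).2] at this
  · intro A hA
    obtain ⟨d, rfl⟩ := h.surj A hA
    refine ⟨normDart d, ?_, tl_normDart d⟩
    rw [tiles, Finset.mem_filter]
    exact ⟨(h.isDiag hT).normDart_mem ((h.mem d).2 hA), normDart_lt d⟩

theorem nonempty (hT : IsDokuTiling κ T) : M.Nonempty := by
  obtain ⟨A, hA⟩ : T.Nonempty := Finset.card_pos.1 (by have := hT.one_lt_card; omega)
  obtain ⟨d, rfl⟩ := h.surj A hA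
  exact ⟨d, (h.mem d).2 hA⟩

theorem exists_other (hT : IsDokuTiling κ T) : ∀ D ∈ M, ∃ D' ∈ M, D' ≠ D ∧ D' ≠ rev D := by
  intro D _
  obtain ⟨A, hA, hne⟩ := Finset.exists_mem_ne hT.one_lt_card (tl p u D)
  obtain ⟨d, rfl⟩ := h.surj A hA
  refine ⟨d, (h.mem d).2 hA, ?_, ?_⟩
  · rintro rfl; exact hne rfl
  · rintro rfl; exact hne (tl_rev D)

theorem isSideOf_iff (hM : IsDiag M) {d x : LDart} (hd : d ∈ M) :
    IsSideOf d x ↔ SideDart M x ∧ diag M x = normDart d := by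
  have hr := h.rev_mem hd
  constructor
  · rintro (rfl | rfl | rfl | rfl)
    · exact ⟨hM.sideDart_nx hd, hM.diag_nx_of_mem hd⟩
    · exact ⟨hM.sideDart_nx_nx hd, hM.diag_nx_nx_of_mem hd⟩
    · exact ⟨hM.sideDart_nx hr, by rw [hM.diag_nx_of_mem hr, normDart_rev]⟩
    · exact ⟨hM.sideDart_nx_nx hr, by rw [hM.diag_nx_nx_of_mem hr, normDart_rev]⟩
  · rintro ⟨hx, hxd⟩
    obtain ⟨e, he, hxe | hxe⟩ := hM.sideDart_cases hx
    · rw [hxe, hM.diag_nx_of_mem he] at hxd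
      rcases normDart_eq hxd with rfl | rfl <;> simp [IsSideOf, hxe]
    · rw [hxe, hM.diag_nx_nx_of_mem he] at hxd
      rcases normDart_eq hxd with rfl | rfl <;> simp [IsSideOf, hxe]

/-- The tile covering the triangle on the left of `x`. -/
theorem tl_diag_mem (hM : IsDiag M) {x : LDart} (hx : Cov M x) : tl p u (diag M x) ∈ T :=
  (h.mem _).1 (hM.diag_mem hx)

/-- Sharing a side, in terms of darts. -/
theorem shareSide_iff (hM : IsDiag M) {d e : LDart} (hd : d ∈ M) (he : e ∈ M)
    (hne : tl p u d ≠ tl p u e) {v : ℂ} : ShareSide v (tl p u d) (tl p u e) ↔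
    ∃ x, v = dirC u x.2 ∧ SideDart M x ∧ SideDart M (rev x) ∧
      ((diag M x = normDart d ∧ diag M (rev x) = normDart e) ∨
       (diag M x = normDart e ∧ diag M (rev x) = normDart d)) := by
  have hu := h.norm
  constructor
  · rintro ⟨a, h1, h2⟩
    obtain ⟨x, hx, rfl, rfl⟩ := (isSide_tl hu).1 h1
    obtain ⟨y, hy, ha, hv⟩ := (isSide_tl hu).1 h2
    obtain rfl := dart_ext hu ha hv
    refine ⟨x, rfl, ?_⟩
    rw [h.isSideOf_iff hM hd, h.isSideOf_iff hM hd] at hx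
    rw [h.isSideOf_iff hM he, h.isSideOf_iff hM he] at hy
    have hn : normDart d ≠ normDart e := fun hn => hne (h.tl_eq_iff.2 hn)
    rcases hx with hx | hx <;> rcases hy with hy | hy
    · exact absurd (hx.2.symm.trans hy.2) hn
    · exact ⟨hx.1, hy.1, Or.inl ⟨hx.2, hy.2⟩⟩
    · exact ⟨hy.1, hx.1, Or.inr ⟨hy.2, hx.2⟩⟩
    · exact absurd (hx.2.symm.trans hy.2) hn
  · rintro ⟨x, rfl, hx, hrx, hxd⟩
    refine ⟨pt p u x.1, (isSide_tl hu).2 ⟨x, ?_, rfl, rfl⟩, (isSide_tl hu).2 ⟨x, ?_, rfl, rfl⟩⟩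
    · rw [h.isSideOf_iff hM hd, h.isSideOf_iff hM hd]; tauto
    · rw [h.isSideOf_iff hM he, h.isSideOf_iff hM he]; tauto

theorem covConn_aux {d : LDart} (hd : Cov M d) :
    Relation.ReflTransGen (fun a b => b = nx a ∨ (b = rev a ∧ Cov M b)) d (diag M d) ∧
    Relation.ReflTransGen (fun a b => b = nx a ∨ (b = rev a ∧ Cov M b)) (diag M d) d := by
  have hnorm : ∀ e ∈ M,
      Relation.ReflTransGen (fun a b => b = nx a ∨ (b = rev a ∧ Cov M b)) e (normDart e) ∧
      Relation.ReflTransGen (fun a b => b = nx a ∨ (b = rev a ∧ Cov M b)) (normDart e) e := by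
    intro e he
    unfold normDart
    split_ifs
    · exact ⟨.refl, .refl⟩
    · exact ⟨.single (Or.inr ⟨rfl, Or.inl (h.rev_mem he)⟩),
        .single (Or.inr ⟨(rev_rev e).symm, Or.inl he⟩)⟩
  have h1 := hnorm _ (dg_mem hd)
  have h2 : Relation.ReflTransGen (fun a b => b = nx a ∨ (b = rev a ∧ Cov M b)) d (dg M d) ∧
    Relation.ReflTransGen (fun a b => b = nx a ∨ (b = rev a ∧ Cov M b)) (dg M d) d := by
    unfold dg
    split_ifs
    · exact ⟨.refl, .refl⟩
    · exact ⟨.single (Or.inl rfl), .tail (.single (Or.inl rfl)) (Or.inl (nx_nx_nx d).symm)⟩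
    · exact ⟨.tail (.single (Or.inl rfl)) (Or.inl rfl), .single (Or.inl (nx_nx_nx d).symm)⟩
  exact ⟨h2.1.trans h1.1, h1.2.trans h2.2⟩

/-- A path of adjacent tiles is followed diagonal by diagonal; within a tile one moves between its
triangles across the diagonal. -/
theorem covConn (hT : IsDokuTiling κ T) : CovConn M := by
  have hM := h.isDiag hT
  intro d e hd he
  refine (h.covConn_aux hd).1.trans (Relation.ReflTransGen.trans ?_ (h.covConn_aux he).2)
  have hr := hT.edge_connected.preconnected ⟨_, h.tl_diag_mem hM hd⟩ ⟨_, h.tl_diag_mem hM he⟩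
  rw [SimpleGraph.reachable_iff_reflTransGen] at hr
  have key : ∀ B : (T : Set (Set ℂ)), Relation.ReflTransGen
      (adjacencyGraph.induce (T : Set (Set ℂ))).Adj ⟨_, h.tl_diag_mem hM hd⟩ B →
      ∀ e, Cov M e → tl p u (diag M e) = B →
      Relation.ReflTransGen (fun a b => b = nx a ∨ (b = rev a ∧ Cov M b)) (diag M d)
        (diag M e) := by
    intro B hB
    induction hB with
    | refl =>
      intro e he heq
      have := h.tl_eq_iff.1 heq
      rw [normDart, normDart, if_pos (show (diag M e).2 < 3 from normDart_lt _),
        if_pos (show (diag M d).2 < 3 from normDart_lt _)] at this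
      rw [this]
    | @tail b c _ hab ih =>
      intro e he heq
      rw [SimpleGraph.comap_adj] at hab
      obtain ⟨hne, v, hv⟩ := hab
      obtain ⟨f, hf⟩ := h.surj b b.2
      have hfM : f ∈ M := (h.mem f).2 (hf ▸ b.2)
      have hfd : diag M f = normDart f := diag_of_mem hfM
      have heM := hM.diag_mem he
      have ih := ih f (Or.inl hfM) (by rw [hfd, tl_normDart, hf])
      change (b : Set ℂ) ≠ c at hne
      change ShareSide v b c at hv
      rw [← hf, ← heq] at hv hne
      obtain ⟨x, -, hx, hrx, hxd⟩ := (h.shareSide_iff hM hfM heM hne).1 hv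
      have hen : normDart (diag M e) = diag M e := by
        rw [normDart, if_pos (show (diag M e).2 < 3 from normDart_lt _)]
      rw [hfd] at ih
      rw [hen] at hxd
      refine ih.trans ?_
      rcases hxd with ⟨a, b⟩ | ⟨a, b⟩
      · rw [← a, ← b]
        exact ((h.covConn_aux hx.1).2.tail (Or.inr ⟨rfl, hrx.1⟩)).trans (h.covConn_aux hrx.1).1
      · rw [← a, ← b]
        exact ((h.covConn_aux hrx.1).2.tail (Or.inr ⟨(rev_rev x).symm, hx.1⟩)).trans
          (h.covConn_aux hx.1).1
  exact key _ hr e he rfl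

theorem removeConn (hT : IsDokuTiling κ T) : RemoveConn M := by
  have hM := h.isDiag hT
  have hu := h.norm
  intro D hD a ha b hb haD haD' hbD hbD'
  have hmem : ∀ {e}, e ∈ M → e ≠ D → e ≠ rev D →
      tl p u e ∈ (T : Set (Set ℂ)) \ {tl p u D} := fun {e} he h1 h2 => by
    refine ⟨(h.mem e).1 he, fun h3 => ?_⟩
    rcases tl_eq_tl hu (Set.mem_singleton_iff.1 h3).symm with h4 | h4
    exacts [h1 h4, h2 h4]
  have hr := hT.remove_connected _ ((h.mem D).1 hD) ⟨_, hmem ha haD haD'⟩ ⟨_, hmem hb hbD hbD'⟩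
  rw [SimpleGraph.reachable_iff_reflTransGen] at hr
  have hverts : ∀ e, tileVerts (rev e) = tileVerts e := fun e => by
    ext v
    simp only [tileVerts, Finset.mem_insert, Finset.mem_singleton, rev_rev, head_rev, fst_rev]
    tauto
  have hself : ∀ e, e.1 ∈ tileVerts e := fun e => by simp [tileVerts]
  have key : ∀ B : ((T : Set (Set ℂ)) \ {tl p u D} : Set (Set ℂ)), Relation.ReflTransGen
      (neighbourGraph.induce ((T : Set (Set ℂ)) \ {tl p u D})).Adj ⟨_, hmem ha haD haD'⟩ B →
      ∀ e ∈ M, e ≠ D → e ≠ rev D → tl p u e = B →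
      Relation.ReflTransGen (fun a b => b ∈ M ∧ b ≠ D ∧ b ≠ rev D ∧
        (tileVerts a ∩ tileVerts b).Nonempty) a e := by
    intro B hB
    induction hB with
    | refl =>
      intro e he h1 h2 heq
      refine .single ⟨he, h1, h2, a.1, ?_⟩
      rw [Finset.mem_inter]
      refine ⟨hself a, ?_⟩
      rcases tl_eq_tl hu heq with rfl | rfl
      · exact hself _
      · rw [← hverts]; exact hself _
    | @tail B C _ hab ih =>
      intro e he h1 h2 heq
      obtain ⟨f, hf⟩ := h.surj B B.2.1
      have hfT : tl p u f ∈ (T : Set (Set ℂ)) := hf ▸ B.2.1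
      have hfM : f ∈ M := (h.mem f).2 hfT
      have hf1 : f ≠ D := by
        rintro rfl
        exact B.2.2 hf.symm
      have hf2 : f ≠ rev D := by
        rintro rfl
        rw [tl_rev] at hf
        exact B.2.2 hf.symm
      refine (ih f hfM hf1 hf2 hf).tail ⟨he, h1, h2, ?_⟩
      rw [SimpleGraph.comap_adj] at hab
      obtain ⟨hne, hint⟩ := hab
      change (B : Set ℂ) ≠ C at hne
      change ((B : Set ℂ) ∩ C).Nonempty at hint
      rw [← hf, ← heq] at hne hint
      rcases hT.meet _ hfT _ ((h.mem e).1 he) hne with h' | ⟨z, hz1, hz2, -⟩ | ⟨q, w, hq1, hq2, -⟩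
      · rw [h'] at hint; exact absurd hint Set.not_nonempty_empty
      · obtain ⟨v, hv, rfl⟩ := (isVertex_tl hu).1 hz1
        obtain ⟨v', hv', hvv⟩ := (isVertex_tl hu).1 hz2
        rw [← pt_injective hu hvv] at hv'
        exact ⟨v, Finset.mem_inter.2 ⟨hv, hv'⟩⟩
      · obtain ⟨x, hx, rfl, rfl⟩ := (isSide_tl hu).1 hq1
        obtain ⟨y, hy, hy1, hy2⟩ := (isSide_tl hu).1 hq2
        obtain rfl := dart_ext hu hy1 hy2
        have hvx : ∀ d, (IsSideOf d x ∨ IsSideOf d (rev x)) → x.1 ∈ tileVerts d := by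
          have h1 : ∀ d y, IsSideOf d y → y.1 ∈ tileVerts d ∧ head y ∈ tileVerts d := by
            rintro d y (rfl | rfl | rfl | rfl) <;> simp [tileVerts, head_nx_nx]
          rintro d (hd | hd)
          · exact (h1 _ _ hd).1
          · have := (h1 _ _ hd).2
            rwa [head_rev] at this
        exact ⟨x.1, Finset.mem_inter.2 ⟨hvx _ hx, hvx _ hy⟩⟩
  exact key _ hr b hb hbD hbD' rfl

end Represents

end KDoku

/-! ### From a connected complement to connected uncovered triangles. -/

namespace KDoku

open LDart IsDiag

/-- The barycentric coordinate of `z`, in the triangle on the left of `x`, for the vertex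
opposite to `x`; the plane is described by real lattice coordinates. -/
def bar (x : LDart) (z : ℝ × ℝ) : ℝ :=
  (dir x.2).1 * (z.2 - x.1.2) - (dir x.2).2 * (z.1 - x.1.1)

theorem bar_rev (x : LDart) (z : ℝ × ℝ) : bar (rev x) z = -bar x z := by
  simp only [bar, rev, dir_add_three, Prod.fst_add, Prod.snd_add, Prod.fst_neg, Prod.snd_neg]
  push_cast
  ring

theorem bar_sum (x : LDart) (z : ℝ × ℝ) : bar x z + bar (nx x) z + bar (nx (nx x)) z = 1 := by
  rcases x with ⟨⟨i, j⟩, k⟩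
  fin_cases k <;> simp [bar, nx, dir] <;> ring

theorem bar_nx_rev (x : LDart) (z : ℝ × ℝ) : bar (nx (rev x)) z = 1 - bar (nx x) z := by
  rcases x with ⟨⟨i, j⟩, k⟩
  fin_cases k <;> simp [bar, nx, rev, dir] <;> ring

theorem bar_nx_nx_rev (x : LDart) (z : ℝ × ℝ) :
    bar (nx (nx (rev x))) z = 1 - bar (nx (nx x)) z := by
  have h1 := bar_sum x z
  have h2 := bar_sum (rev x) z
  rw [bar_rev, bar_nx_rev] at h2
  linarith

/-- The closed triangle on the left of `x`. -/
def tri (x : LDart) : Set (ℝ × ℝ) := {z | 0 ≤ bar x z ∧ 0 ≤ bar (nx x) z ∧ 0 ≤ bar (nx (nx x)) z}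

theorem mem_tri {x : LDart} {z : ℝ × ℝ} :
    z ∈ tri x ↔ 0 ≤ bar x z ∧ 0 ≤ bar (nx x) z ∧ 0 ≤ bar (nx (nx x)) z := Iff.rfl

theorem mem_tri_nx {x : LDart} {z : ℝ × ℝ} : z ∈ tri (nx x) ↔ z ∈ tri x := by
  rw [mem_tri, mem_tri, nx_nx_nx]; tauto

theorem mem_tri_zero {i j : ℤ} {z : ℝ × ℝ} :
    z ∈ tri ((i, j), 0) ↔ i ≤ z.1 ∧ j ≤ z.2 ∧ z.1 + z.2 ≤ i + j + 1 := by
  simp only [mem_tri, bar, nx, dir]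
  simp
  constructor
  · rintro ⟨a, b, c⟩; refine ⟨?_, ?_, ?_⟩ <;> linarith
  · rintro ⟨a, b, c⟩; refine ⟨?_, ?_, ?_⟩ <;> linarith

theorem mem_tri_three {i j : ℤ} {z : ℝ × ℝ} :
    z ∈ tri ((i, j), 3) ↔ z.1 ≤ i ∧ z.2 ≤ j ∧ i + j - 1 ≤ z.1 + z.2 := by
  simp only [mem_tri, bar, nx, dir]
  simp
  constructor
  · rintro ⟨a, b, c⟩; refine ⟨?_, ?_, ?_⟩ <;> linarith
  · rintro ⟨a, b, c⟩; refine ⟨?_, ?_, ?_⟩ <;> linarith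

theorem exists_mem_tri (z : ℝ × ℝ) : ∃ x, z ∈ tri x := by
  by_cases h : z.1 + z.2 ≤ ⌊z.1⌋ + ⌊z.2⌋ + 1
  · exact ⟨((⌊z.1⌋, ⌊z.2⌋), 0), mem_tri_zero.2 ⟨Int.floor_le _, Int.floor_le _, h⟩⟩
  · refine ⟨((⌊z.1⌋ + 1, ⌊z.2⌋ + 1), 3), mem_tri_three.2 ?_⟩
    have h1 := Int.lt_floor_add_one z.1
    have h2 := Int.lt_floor_add_one z.2
    push_cast
    refine ⟨h1.le, h2.le, ?_⟩
    linarith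

/-- One step between triangles that contain `z`. -/
def TriStep (z : ℝ × ℝ) (a b : LDart) : Prop := (b = nx a ∨ b = rev a) ∧ z ∈ tri b

theorem TriStep.nx {z : ℝ × ℝ} {x : LDart} (h : z ∈ tri x) : TriStep z x (nx x) :=
  ⟨Or.inl rfl, mem_tri_nx.2 h⟩

theorem TriStep.of_nx {z : ℝ × ℝ} {x : LDart} (h : z ∈ tri x) :
    Relation.ReflTransGen (TriStep z) (LDart.nx x) x :=
  .tail (.single (.nx (mem_tri_nx.2 h))) ⟨Or.inl (nx_nx_nx x).symm, h⟩

/-- The orbit under `nx` contains a dart of the direction `0` or `3`. -/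
theorem TriStep.exists_normal {z : ℝ × ℝ} {x : LDart} (h : z ∈ tri x) :
    ∃ y, (y.2 = 0 ∨ y.2 = 3) ∧ z ∈ tri y ∧ Relation.ReflTransGen (TriStep z) x y ∧
      Relation.ReflTransGen (TriStep z) y x := by
  have key : ∀ k : Fin 6, (k = 0 ∨ k = 3) ∨ (k + 2 = 0 ∨ k + 2 = 3) ∨
    (k + 2 + 2 = 0 ∨ k + 2 + 2 = 3) := by decide
  have h1 := mem_tri_nx.2 h
  rcases key x.2 with hk | hk | hk
  · exact ⟨x, hk, h, .refl, .refl⟩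
  · exact ⟨LDart.nx x, hk, h1, .single (.nx h), TriStep.of_nx h⟩
  · exact ⟨LDart.nx (LDart.nx x), hk, mem_tri_nx.2 h1, .tail (.single (.nx h)) (.nx h1),
      .single ⟨Or.inl (nx_nx_nx x).symm, h⟩⟩

/-- The real coordinates of a lattice point. -/
def rpt (v : ℤ × ℤ) : ℝ × ℝ := (v.1, v.2)

theorem rpt_mem_tri (v : ℤ × ℤ) (k : Fin 6) : rpt v ∈ tri (v, k) := by
  rcases v with ⟨i, j⟩
  fin_cases k <;> simp [mem_tri, bar, nx, dir, rpt]

theorem TriStep.rot (v : ℤ × ℤ) (k : Fin 6) :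
    Relation.ReflTransGen (TriStep (rpt v)) (v, k) (v, k + 1) := by
  have h0 := rpt_mem_tri v k
  have h1 := mem_tri_nx.2 h0
  refine .tail (.tail (.single (.nx h0)) (.nx h1)) ⟨Or.inr (rev_nx_nx (v, k)).symm, rpt_mem_tri v _⟩

theorem TriStep.around (v : ℤ × ℤ) (k l : Fin 6) :
    Relation.ReflTransGen (TriStep (rpt v)) (v, k) (v, l) := by
  have h : ∀ k, Relation.ReflTransGen (TriStep (rpt v)) (v, k) (v, k + 1) := TriStep.rot v
  have step : ∀ m, Relation.ReflTransGen (TriStep (rpt v)) (v, k) (v, m) →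
      Relation.ReflTransGen (TriStep (rpt v)) (v, k) (v, m + 1) := fun m hm => hm.trans (h m)
  have key : ∀ k l : Fin 6, l = k ∨ l = k + 1 ∨ l = k + 1 + 1 ∨ l = k + 1 + 1 + 1 ∨
    l = k + 1 + 1 + 1 + 1 ∨ l = k + 1 + 1 + 1 + 1 + 1 := by decide
  have h0 : Relation.ReflTransGen (TriStep (rpt v)) (v, k) (v, k) := .refl
  have h1 := step _ h0
  have h2 := step _ h1
  have h3 := step _ h2
  have h4 := step _ h3
  have h5 := step _ h4
  rcases key k l with rfl | rfl | rfl | rfl | rfl | rfl <;> assumption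

/-- A lattice point in a closed lattice triangle is one of its vertices, hence the tail of one of
its darts. -/
theorem exists_tail_eq {v : ℤ × ℤ} {x : LDart} (h : rpt v ∈ tri x) : ∃ k,
    Relation.ReflTransGen (TriStep (rpt v)) x (v, k) ∧
    Relation.ReflTransGen (TriStep (rpt v)) (v, k) x := by
  obtain ⟨⟨⟨i, j⟩, k⟩, hk, hy, h1, h2⟩ := TriStep.exists_normal h
  have main : ∃ k', Relation.ReflTransGen (TriStep (rpt v)) ((i, j), k) (v, k') ∧
      Relation.ReflTransGen (TriStep (rpt v)) (v, k') ((i, j), k) := by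
    have hy1 := mem_tri_nx.2 hy
    have r1 := TriStep.nx hy
    have r2 := TriStep.nx hy1
    have r3 := TriStep.of_nx hy
    have r4 : TriStep (rpt v) (nx (nx ((i, j), k))) ((i, j), k) :=
      ⟨Or.inl (nx_nx_nx _).symm, hy⟩
    have hc : v = (i, j) ∨ v = (nx ((i, j), k)).1 ∨ v = (nx (nx ((i, j), k))).1 := by
      rcases v with ⟨a, b⟩
      rcases hk with hk | hk <;> change k = _ at hk <;> subst hk
      · obtain ⟨c1, c2, c3⟩ := mem_tri_zero.1 hy
        simp only [rpt] at c1 c2 c3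
        norm_cast at c1 c2 c3
        simp only [nx, dir, Prod.mk.injEq]
        simp
        omega
      · obtain ⟨c1, c2, c3⟩ := mem_tri_three.1 hy
        simp only [rpt] at c1 c2 c3
        norm_cast at c1 c2
        have c3 : i + j - 1 ≤ a + b := by exact_mod_cast c3
        simp only [nx, dir, Prod.mk.injEq]
        simp
        omega
    rcases hc with rfl | rfl | rfl
    · exact ⟨k, .refl, .refl⟩
    · exact ⟨_, .single r1, r3⟩
    · exact ⟨_, .tail (.single r1) r2, .single r4⟩
  obtain ⟨k', m1, m2⟩ := main
  exact ⟨k', h1.trans m1, m2.trans h2⟩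

theorem triStep_of_vertex {v : ℤ × ℤ} {x y : LDart} (hx : rpt v ∈ tri x) (hy : rpt v ∈ tri y) :
    Relation.ReflTransGen (TriStep (rpt v)) x y := by
  obtain ⟨k, h1, -⟩ := exists_tail_eq hx
  obtain ⟨l, -, h2⟩ := exists_tail_eq hy
  exact (h1.trans (TriStep.around v k l)).trans h2

theorem triStep_zero_zero {z : ℝ × ℝ} {i j i' j' : ℤ} (hx : z ∈ tri ((i, j), 0))
    (hy : z ∈ tri ((i', j'), 0)) : (i = i' ∧ j = j') ∨ ∃ v, z = rpt v := by
  rw [mem_tri_zero] at hx hy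
  obtain ⟨a1, a2, a3⟩ := hx
  obtain ⟨b1, b2, b3⟩ := hy
  have cast : ∀ {m n : ℤ}, m < n → (m : ℝ) + 1 ≤ n := fun h => by exact_mod_cast h
  rcases lt_trichotomy i i' with h | h | h
  · have := cast h
    refine Or.inr ⟨(i + 1, j), Prod.ext ?_ ?_⟩ <;> simp only [rpt] <;> push_cast <;> linarith
  · rcases lt_trichotomy j j' with h' | h' | h'
    · have := cast h'
      refine Or.inr ⟨(i, j + 1), Prod.ext ?_ ?_⟩ <;> simp only [rpt] <;> push_cast <;> linarith
    · exact Or.inl ⟨h, h'⟩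
    · have := cast h'
      have h : (i : ℝ) = i' := by exact_mod_cast h
      refine Or.inr ⟨(i', j' + 1), Prod.ext ?_ ?_⟩ <;> simp only [rpt] <;> push_cast <;> linarith
  · have := cast h
    refine Or.inr ⟨(i' + 1, j'), Prod.ext ?_ ?_⟩ <;> simp only [rpt] <;> push_cast <;> linarith

theorem triStep_three_three {z : ℝ × ℝ} {i j i' j' : ℤ} (hx : z ∈ tri ((i, j), 3))
    (hy : z ∈ tri ((i', j'), 3)) : (i = i' ∧ j = j') ∨ ∃ v, z = rpt v := by
  rw [mem_tri_three] at hx hy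
  have key := triStep_zero_zero (z := -z) (i := -i) (j := -j) (i' := -i') (j' := -j')
    (by rw [mem_tri_zero]; simp only [Prod.fst_neg, Prod.snd_neg]; push_cast
        refine ⟨?_, ?_, ?_⟩ <;> linarith [hx.1, hx.2.1, hx.2.2])
    (by rw [mem_tri_zero]; simp only [Prod.fst_neg, Prod.snd_neg]; push_cast
        refine ⟨?_, ?_, ?_⟩ <;> linarith [hy.1, hy.2.1, hy.2.2])
  rcases key with ⟨h1, h2⟩ | ⟨v, hv⟩
  · exact Or.inl ⟨neg_injective h1, neg_injective h2⟩
  · refine Or.inr ⟨-v, ?_⟩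
    rw [← neg_neg z, hv]
    simp [rpt]

/-- Two intersecting triangles of opposite orientation are in one of six relative positions: three
with a common edge, and three with only a common vertex. -/
theorem triStep_zero_three {z : ℝ × ℝ} {i j m n : ℤ} (hx : z ∈ tri ((i, j), 0))
    (hy : z ∈ tri ((m, n), 3)) : (∃ v, z = rpt v) ∨
      (Relation.ReflTransGen (TriStep z) ((i, j), 0) ((m, n), 3) ∧
       Relation.ReflTransGen (TriStep z) ((m, n), 3) ((i, j), 0)) := by
  have hx' := hx
  have hy' := hy
  rw [mem_tri_zero] at hx'
  rw [mem_tri_three] at hy'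
  obtain ⟨a1, a2, a3⟩ := hx'
  obtain ⟨b1, b2, b3⟩ := hy'
  have c1 : i ≤ m := by exact_mod_cast a1.trans b1
  have c2 : j ≤ n := by exact_mod_cast a2.trans b2
  have c3 : m + n - 1 ≤ i + j + 1 := by exact_mod_cast b3.trans a3
  have hx1 := mem_tri_nx.2 hx
  have hx2 := mem_tri_nx.2 hx1
  have hy1 := mem_tri_nx.2 hy
  have hy2 := mem_tri_nx.2 hy1
  have hcase : (m = i ∧ n = j) ∨ (m = i + 1 ∧ n = j) ∨ (m = i ∧ n = j + 1) ∨
    (m = i + 1 ∧ n = j + 1) ∨ (m = i + 2 ∧ n = j) ∨ (m = i ∧ n = j + 2) := by omega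
  rcases hcase with ⟨rfl, rfl⟩ | ⟨rfl, rfl⟩ | ⟨rfl, rfl⟩ | ⟨rfl, rfl⟩ | ⟨rfl, rfl⟩ | ⟨rfl, rfl⟩ <;>
    push_cast at b1 b2 b3
  · exact Or.inl ⟨(m, n), Prod.ext (by simp only [rpt]; linarith) (by simp only [rpt]; linarith)⟩
  · right
    have e : ((i + 1, n), 3) = rev ((i, n), 0) := by simp [rev, dir]
    have e' : ((i, n), 0) = rev ((i + 1, n), 3) := by simp [rev, dir]
    exact ⟨.single ⟨Or.inr e, hy⟩, .single ⟨Or.inr e', hx⟩⟩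
  · right
    have e : nx (nx ((m, j + 1), 3)) = rev (nx (nx ((m, j), 0))) := by simp [nx, rev, dir]
    have e' : nx (nx ((m, j), 0)) = rev (nx (nx ((m, j + 1), 3))) := by rw [e, rev_rev]
    constructor
    · exact .tail (.tail (.tail (.single (.nx hx)) (.nx hx1)) ⟨Or.inr e, hy2⟩)
        ⟨Or.inl (nx_nx_nx _).symm, hy⟩
    · exact .tail (.tail (.tail (.single (.nx hy)) (.nx hy1)) ⟨Or.inr e', hx2⟩)
        ⟨Or.inl (nx_nx_nx _).symm, hx⟩
  · right
    have e : nx ((i + 1, j + 1), 3) = rev (nx ((i, j), 0)) := by simp [nx, rev, dir]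
    have e' : nx ((i, j), 0) = rev (nx ((i + 1, j + 1), 3)) := by rw [e, rev_rev]
    constructor
    · exact (Relation.ReflTransGen.tail (.single (.nx hx)) ⟨Or.inr e, hy1⟩).trans (TriStep.of_nx hy)
    · exact (Relation.ReflTransGen.tail (.single (.nx hy)) ⟨Or.inr e', hx1⟩).trans (TriStep.of_nx hx)
  · refine Or.inl ⟨(i + 1, n), Prod.ext ?_ ?_⟩ <;> simp only [rpt] <;> push_cast <;> linarith
  · refine Or.inl ⟨(m, j + 1), Prod.ext ?_ ?_⟩ <;> simp only [rpt] <;> push_cast <;> linarith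

/-- Two triangles that contain `z` are connected through triangles that contain `z`. -/
theorem triStep_of_mem {z : ℝ × ℝ} {x y : LDart} (hx : z ∈ tri x) (hy : z ∈ tri y) :
    Relation.ReflTransGen (TriStep z) x y := by
  by_cases hv : ∃ v, z = rpt v
  · obtain ⟨v, rfl⟩ := hv
    exact triStep_of_vertex hx hy
  obtain ⟨⟨⟨i, j⟩, k⟩, hk, hx', r1, -⟩ := TriStep.exists_normal hx
  obtain ⟨⟨⟨m, n⟩, l⟩, hl, hy', -, r2⟩ := TriStep.exists_normal hy
  refine r1.trans (Relation.ReflTransGen.trans ?_ r2)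
  change k = 0 ∨ k = 3 at hk
  change l = 0 ∨ l = 3 at hl
  rcases hk with rfl | rfl <;> rcases hl with rfl | rfl
  · obtain ⟨rfl, rfl⟩ := (triStep_zero_zero hx' hy').resolve_right hv
    exact .refl
  · exact ((triStep_zero_three hx' hy').resolve_left hv).1
  · exact ((triStep_zero_three hy' hx').resolve_left hv).2
  · obtain ⟨rfl, rfl⟩ := (triStep_three_three hx' hy').resolve_right hv
    exact .refl

theorem exists_interior (x : LDart) :
    ∃ z, 0 < bar x z ∧ 0 < bar (nx x) z ∧ 0 < bar (nx (nx x)) z := by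
  refine ⟨(x.1.1 + ((dir x.2).1 + (dir (x.2 + 1)).1 : ℝ) / 3,
    x.1.2 + ((dir x.2).2 + (dir (x.2 + 1)).2 : ℝ) / 3), ?_⟩
  rcases x with ⟨⟨i, j⟩, k⟩
  fin_cases k <;> simp [bar, nx, dir] <;> norm_num

theorem continuous_bar (x : LDart) : Continuous (bar x) := by
  unfold bar; fun_prop

theorem isClosed_tri (x : LDart) : IsClosed (tri x) :=
  (isClosed_le continuous_const (continuous_bar x)).inter
    ((isClosed_le continuous_const (continuous_bar (nx x))).inter
      (isClosed_le continuous_const (continuous_bar (nx (nx x)))))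

theorem abs_sub_le_of_mem_tri {x : LDart} {z : ℝ × ℝ} (h : z ∈ tri x) :
    |x.1.1 - z.1| ≤ 1 ∧ |x.1.2 - z.2| ≤ 1 := by
  obtain ⟨h1, h2, h3⟩ := h
  rw [abs_le, abs_le]
  rcases x with ⟨⟨i, j⟩, k⟩
  fin_cases k <;> simp [bar, nx, dir] at h1 h2 h3 ⊢ <;>
    refine ⟨⟨?_, ?_⟩, ?_, ?_⟩ <;> linarith

/-- Needed because the uncovered triangles are infinitely many, and their unions have to be closed.
-/
theorem locallyFinite_tri : LocallyFinite tri := by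
  intro z
  refine ⟨Metric.ball z 1, Metric.ball_mem_nhds z one_pos, ?_⟩
  refine Set.Finite.subset ((((Set.finite_Icc ⌊z.1 - 2⌋ ⌈z.1 + 2⌉).prod
    (Set.finite_Icc ⌊z.2 - 2⌋ ⌈z.2 + 2⌉)).prod (Set.finite_univ (α := Fin 6)))) ?_
  rintro x ⟨w, hw, hwz⟩
  obtain ⟨h1, h2⟩ := abs_sub_le_of_mem_tri hw
  rw [Metric.mem_ball, Prod.dist_eq, max_lt_iff, Real.dist_eq, Real.dist_eq] at hwz
  obtain ⟨h3, h4⟩ := hwz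
  rw [abs_le] at h1 h2
  rw [abs_lt] at h3 h4
  refine ⟨⟨⟨?_, ?_⟩, ?_, ?_⟩, trivial⟩
  · exact Int.cast_le.1 ((Int.floor_le _).trans (by linarith : z.1 - 2 ≤ (x.1.1 : ℝ)))
  · exact Int.cast_le.1 ((by linarith : (x.1.1 : ℝ) ≤ z.1 + 2).trans (Int.le_ceil _))
  · exact Int.cast_le.1 ((Int.floor_le _).trans (by linarith : z.2 - 2 ≤ (x.1.2 : ℝ)))
  · exact Int.cast_le.1 ((by linarith : (x.1.2 : ℝ) ≤ z.2 + 2).trans (Int.le_ceil _))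

theorem isClosed_biUnion_tri (S : Set LDart) : IsClosed (⋃ x ∈ S, tri x) := by
  rw [Set.biUnion_eq_iUnion]
  exact (locallyFinite_tri.comp_injective Subtype.val_injective).isClosed_iUnion
    fun _ => isClosed_tri _

/-- The real lattice coordinates of a point of the plane. -/
noncomputable def crd (p u z : ℂ) : ℝ × ℝ :=
  (((z - p) / u).re - ((z - p) / u).im / omega.im / 2, ((z - p) / u).im / omega.im)

theorem continuous_crd (p u : ℂ) : Continuous (crd p u) := by
  unfold crd; fun_prop

theorem crd_mk {p u : ℂ} (hu : u ≠ 0) (X Y : ℝ) : crd p u (p + u * (X + Y * omega)) = (X, Y) := by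
  have h : (p + u * (X + Y * omega) - p) / u = X + Y * omega := by field_simp; ring
  have hre : omega.re = 1 / 2 := rfl
  have him := omega_im_pos.ne'
  rw [crd, h]
  ext
  · simp [hre]; field_simp; ring
  · simp; field_simp

theorem mk_crd {p u : ℂ} (hu : u ≠ 0) (z : ℂ) :
    p + u * ((crd p u z).1 + (crd p u z).2 * omega) = z := by
  have hre : omega.re = 1 / 2 := rfl
  have him := omega_im_pos.ne'
  have h : ((crd p u z).1 + (crd p u z).2 * omega : ℂ) = (z - p) / u := by
    apply Complex.ext
    · simp [crd, hre]; ring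
    · simp [crd]; field_simp
  rw [h]; field_simp; ring

theorem mem_tl_nx {p u : ℂ} (hu : u ≠ 0) {e : LDart} {z : ℂ} : z ∈ tl p u (nx e) ↔
    bar (nx (nx e)) (crd p u z) ∈ Set.Icc 0 1 ∧ bar e (crd p u z) ∈ Set.Icc 0 1 := by
  have point : ∀ s t : ℝ, pt p u e.1 + s * dirC u e.2 + t * (omega * dirC u e.2) =
      p + u * (((e.1.1 + s * (dir e.2).1 + t * (dir (e.2 + 1)).1 : ℝ) : ℂ) +
        ((e.1.2 + s * (dir e.2).2 + t * (dir (e.2 + 1)).2 : ℝ) : ℂ) * omega) := by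
    intro s t
    rw [← dirC_add_one, pt, dirC, dirC]
    push_cast
    ring
  rw [tl_nx]
  constructor
  · rintro ⟨s, hs, t, ht, rfl⟩
    rw [point, crd_mk hu]
    have : bar (nx (nx e)) (e.1.1 + s * (dir e.2).1 + t * (dir (e.2 + 1)).1,
        e.1.2 + s * (dir e.2).2 + t * (dir (e.2 + 1)).2) = s ∧
      bar e (e.1.1 + s * (dir e.2).1 + t * (dir (e.2 + 1)).1,
        e.1.2 + s * (dir e.2).2 + t * (dir (e.2 + 1)).2) = t := by
      rcases e with ⟨⟨i, j⟩, k⟩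
      fin_cases k <;> simp [bar, nx, dir] <;> ring
    rw [this.1, this.2]
    exact ⟨hs, ht⟩
  · rintro ⟨hs, ht⟩
    refine ⟨_, hs, _, ht, ?_⟩
    rw [point]
    nth_rw 1 [← mk_crd (p := p) hu z]
    generalize crd p u z = w
    have : w.1 = e.1.1 + bar (nx (nx e)) w * (dir e.2).1 + bar e w * (dir (e.2 + 1)).1 ∧
      w.2 = e.1.2 + bar (nx (nx e)) w * (dir e.2).2 + bar e w * (dir (e.2 + 1)).2 := by
      rcases e with ⟨⟨i, j⟩, k⟩
      fin_cases k <;> simp [bar, nx, dir] <;> ring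
    rw [← this.1, ← this.2]

theorem crd_mem_of_mem_tl {p u : ℂ} (hu : u ≠ 0) {d : LDart} {z : ℂ} (h : z ∈ tl p u d) :
    crd p u z ∈ tri d ∨ crd p u z ∈ tri (rev d) := by
  rw [← nx_nx_nx d, mem_tl_nx hu, nx_nx_nx] at h
  obtain ⟨⟨h1, h2⟩, h3, h4⟩ := h
  rcases le_total 0 (bar d (crd p u z)) with h0 | h0
  · exact Or.inl ⟨h0, h1, h3⟩
  · refine Or.inr ⟨?_, ?_, ?_⟩
    · rw [bar_rev]; linarith
    · rw [bar_nx_rev]; linarith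
    · rw [bar_nx_nx_rev]; linarith

theorem mem_tl_of_crd_mem {p u : ℂ} (hu : u ≠ 0) {d : LDart} {z : ℂ} (h : crd p u z ∈ tri d) :
    z ∈ tl p u d := by
  have hs := bar_sum d (crd p u z)
  obtain ⟨h0, h1, h2⟩ := h
  rw [← nx_nx_nx d, mem_tl_nx hu, nx_nx_nx]
  exact ⟨⟨h1, by linarith⟩, h2, by linarith⟩

namespace Represents

variable {p u : ℂ} {κ : ℕ} {T : Finset (Set ℂ)} {M : Finset LDart} (h : Represents p u T M)
include h

theorem ne_zero : u ≠ 0 := by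
  rintro rfl
  have := h.norm
  simp at this

theorem mem_union_iff {z : ℂ} : z ∈ (⋃ A ∈ T, A) ↔ ∃ x, Cov M x ∧ crd p u z ∈ tri x := by
  rw [Set.mem_iUnion₂]
  constructor
  · rintro ⟨A, hA, hz⟩
    obtain ⟨d, rfl⟩ := h.surj A hA
    have hd := (h.mem d).2 hA
    rcases crd_mem_of_mem_tl h.ne_zero hz with h' | h'
    · exact ⟨d, Or.inl hd, h'⟩
    · exact ⟨rev d, Or.inl (h.rev_mem hd), h'⟩
  · rintro ⟨x, hx | hx | hx, hz⟩
    · exact ⟨_, (h.mem x).1 hx, mem_tl_of_crd_mem h.ne_zero hz⟩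
    · exact ⟨_, (h.mem _).1 hx, mem_tl_of_crd_mem h.ne_zero (mem_tri_nx.2 hz)⟩
    · exact ⟨_, (h.mem _).1 hx, mem_tl_of_crd_mem h.ne_zero (mem_tri_nx.2 (mem_tri_nx.2 hz))⟩

/-- The interior of an uncovered triangle is not covered. -/
theorem exists_uncovered {d : LDart} (hd : ¬ Cov M d) :
    ∃ z, crd p u z ∈ tri d ∧ z ∈ (⋃ A ∈ T, A)ᶜ := by
  obtain ⟨w, hw⟩ := exists_interior d
  have hcrd : crd p u (p + u * (w.1 + w.2 * omega)) = w := crd_mk h.ne_zero w.1 w.2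
  have hmem : w ∈ tri d := ⟨hw.1.le, hw.2.1.le, hw.2.2.le⟩
  refine ⟨p + u * (w.1 + w.2 * omega), by rwa [hcrd], fun hz => ?_⟩
  obtain ⟨x, hx, hxz⟩ := h.mem_union_iff.1 hz
  rw [hcrd] at hxz
  -- An interior point lies on no edge, so no step to another triangle is possible.
  have key : ∀ y, Relation.ReflTransGen (TriStep w) d y →
      ¬ Cov M y ∧ 0 < bar y w ∧ 0 < bar (nx y) w ∧ 0 < bar (nx (nx y)) w := by
    intro y hy
    induction hy with
    | refl => exact ⟨hd, hw⟩
    | @tail b c _ hbc ih =>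
      obtain ⟨ih0, ih1, ih2, ih3⟩ := ih
      obtain ⟨rfl | rfl, hc⟩ := hbc
      · rw [cov_nx, nx_nx_nx]
        exact ⟨ih0, ih2, ih3, ih1⟩
      · have := hc.1
        rw [bar_rev] at this
        linarith
  exact (key x (triStep_of_mem hmem hxz)).1 hx

/-- The triangles that can be reached from `d` and the other uncovered triangles form two closed
sets that cover the complement. Connectedness gives an uncovered point in both. All triangles
containing this point are uncovered and joined through edges containing it, so the two classes are
linked. -/
theorem uncovConn (hT : IsDokuTiling κ T) : UncovConn M := by
  intro d e hd he
  by_contra hne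
  set S : Set LDart := {x | Relation.ReflTransGen
    (fun a b => b = nx a ∨ (b = rev a ∧ ¬ Cov M b)) d x} with hS
  have huncov : ∀ x ∈ S, ¬ Cov M x := by
    intro x hx
    induction hx with
    | refl => exact hd
    | tail _ hbc ih =>
      rcases hbc with rfl | ⟨-, hc⟩
      · rwa [cov_nx]
      · exact hc
  set F := crd p u ⁻¹' (⋃ x ∈ S, tri x) with hF
  set G := crd p u ⁻¹' (⋃ x ∈ {x | ¬ Cov M x ∧ x ∉ S}, tri x) with hG
  have hFc : IsClosed F := (isClosed_biUnion_tri _).preimage (continuous_crd p u)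
  have hGc : IsClosed G := (isClosed_biUnion_tri _).preimage (continuous_crd p u)
  have memF : ∀ {z}, z ∈ F ↔ ∃ x, x ∈ S ∧ crd p u z ∈ tri x := by
    intro z; rw [hF, Set.mem_preimage, Set.mem_iUnion₂]; simp only [exists_prop]
  have memG : ∀ {z}, z ∈ G ↔ ∃ x, (¬ Cov M x ∧ x ∉ S) ∧ crd p u z ∈ tri x := by
    intro z; rw [hG, Set.mem_preimage, Set.mem_iUnion₂]; simp only [exists_prop]; rfl
  have hcover : (⋃ A ∈ T, A)ᶜ ⊆ F ∪ G := by
    intro z hz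
    obtain ⟨x, hx⟩ := exists_mem_tri (crd p u z)
    by_cases hxS : x ∈ S
    · exact Or.inl (memF.2 ⟨x, hxS, hx⟩)
    · exact Or.inr (memG.2 ⟨x, ⟨fun hc => hz (h.mem_union_iff.2 ⟨x, hc, hx⟩), hxS⟩, hx⟩)
  obtain ⟨z1, hz1, hz1'⟩ := h.exists_uncovered hd
  obtain ⟨z2, hz2, hz2'⟩ := h.exists_uncovered he
  obtain ⟨z, hz, hzF, hzG⟩ := isPreconnected_closed_iff.1 hT.no_holes.isPreconnected F G hFc hGc
    hcover ⟨z1, hz1', memF.2 ⟨d, .refl, hz1⟩⟩ ⟨z2, hz2', memG.2 ⟨e, ⟨he, hne⟩, hz2⟩⟩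
  obtain ⟨x, hxS, hx⟩ := memF.1 hzF
  obtain ⟨y, ⟨-, hyS⟩, hy⟩ := memG.1 hzG
  have key : ∀ y, Relation.ReflTransGen (TriStep (crd p u z)) x y → y ∈ S := by
    intro y hy
    induction hy with
    | refl => exact hxS
    | tail _ hbc ih =>
      obtain ⟨h1, h2⟩ := hbc
      refine ih.tail (h1.imp id fun h3 => ⟨h3, fun hc => ?_⟩)
      exact hz (h.mem_union_iff.2 ⟨_, hc, h2⟩)
  exact hyS (key y (triStep_of_mem hx hy))

end Represents

end KDoku

/-! ### Runs are the long strips. -/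

namespace KDoku

open LDart IsDiag

theorem normDart_diag (M : Finset LDart) (x : LDart) : normDart (diag M x) = diag M x := by
  rw [normDart, if_pos (show (diag M x).2 < 3 from normDart_lt _)]

/-- The tiles of a strip. -/
noncomputable def stripTiles (p u : ℂ) (M : Finset LDart) (s : LDart) (n : ℕ) : Set (Set ℂ) :=
  (fun x => tl p u (diag M x)) '' stripFin M s n

/-- The tiles `A` and `B` share a side of the direction `k` or the opposite one. -/
def ShareDir (p u : ℂ) (M : Finset LDart) (k : Fin 6) (A B : Set ℂ) : Prop :=
  ∃ x, x.2 = k ∧ SideDart M x ∧ SideDart M (rev x) ∧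
    ((A = tl p u (diag M x) ∧ B = tl p u (diag M (rev x))) ∨
     (B = tl p u (diag M x) ∧ A = tl p u (diag M (rev x))))

theorem ShareDir.symm {p u : ℂ} {M : Finset LDart} {k : Fin 6} {A B : Set ℂ}
    (h : ShareDir p u M k A B) : ShareDir p u M k B A := by
  obtain ⟨x, h1, h2, h3, h4⟩ := h
  exact ⟨x, h1, h2, h3, h4.symm⟩

theorem ShareDir.of_add_three {p u : ℂ} {M : Finset LDart} {k : Fin 6} {A B : Set ℂ}
    (h : ShareDir p u M (k + 3) A B) : ShareDir p u M k A B := by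
  obtain ⟨x, h1, h2, h3, h4⟩ := h
  refine ⟨rev x, ?_, h3, by rwa [rev_rev], ?_⟩
  · change x.2 + 3 = k
    rw [h1, add_assoc]
    exact add_zero k
  · rw [rev_rev]; tauto

namespace Represents

variable {p u : ℂ} {κ : ℕ} {T : Finset (Set ℂ)} {M : Finset LDart} (h : Represents p u T M)
include h

theorem tl_diag_eq_iff {x y : LDart} :
    tl p u (diag M x) = tl p u (diag M y) ↔ diag M x = diag M y := by
  rw [h.tl_eq_iff, normDart_diag, normDart_diag]

theorem parallel_iff (hM : IsDiag M) {v : ℂ} {A B : Set ℂ} (hA : A ∈ T) (hB : B ∈ T) :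
    (parallelGraph v).Adj A B ↔ ∃ k, v = dirC u k ∧ ShareDir p u M k A B := by
  obtain ⟨d, rfl⟩ := h.surj A hA
  obtain ⟨e, rfl⟩ := h.surj B hB
  have hd := (h.mem d).2 hA
  have he := (h.mem e).2 hB
  have htl : ∀ d x, tl p u d = tl p u (diag M x) ↔ diag M x = normDart d := fun d x => by
    rw [h.tl_eq_iff, normDart_diag, eq_comm]
  constructor
  · rintro ⟨hne, hs⟩
    obtain ⟨x, hv, hx, hrx, hxd⟩ := (h.shareSide_iff hM hd he hne).1 hs
    refine ⟨x.2, hv, x, rfl, hx, hrx, ?_⟩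
    rwa [htl, htl, htl, htl]
  · rintro ⟨k, rfl, x, rfl, hx, hrx, hxd⟩
    have hn := hM.diag_rev_ne hx hrx.1
    rw [htl, htl, htl, htl] at hxd
    have hne : tl p u d ≠ tl p u e := by
      rw [Ne, h.tl_eq_iff]
      rcases hxd with ⟨a, b⟩ | ⟨a, b⟩
      · rw [← a, ← b]; exact hn.symm
      · rw [← a, ← b]; exact hn
    exact ⟨hne, (h.shareSide_iff hM hd he hne).2 ⟨x, rfl, hx, hrx, hxd⟩⟩

theorem stripTiles_subset (hM : IsDiag M) {s : LDart} {n : ℕ} (hs : IsStrip M s n) :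
    stripTiles p u M s n ⊆ T := by
  rintro _ ⟨x, hx, rfl⟩
  obtain ⟨i, hi, rfl⟩ := mem_stripFin.1 hx
  exact h.tl_diag_mem hM (hs.2.2.1 i hi).1

/-- A strip is closed under adjacency through its sides. -/
theorem mem_stripTiles_of_shareDir (hM : IsDiag M) {s : LDart} {n : ℕ} (hs : IsStrip M s n)
    {A B : Set ℂ} (hA : A ∈ stripTiles p u M s n) (hAB : ShareDir p u M s.2 A B) :
    B ∈ stripTiles p u M s n := by
  obtain ⟨f, hf, rfl⟩ := hA
  obtain ⟨i, hi, rfl⟩ := mem_stripFin.1 hf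
  have hside := hs.2.2.1 i hi
  have hdir : ((stp M)^[i] s).2 = s.2 := hM.snd_iterate_stp fun l hl => hs.2.2.1 l (by omega)
  obtain ⟨x, hxk, hx, hrx, ⟨h1, rfl⟩ | ⟨rfl, h1⟩⟩ := hAB
  · have hxf := hM.eq_of_diag_of_snd hside hx (h.tl_diag_eq_iff.1 h1).symm (hxk.trans hdir.symm)
    subst hxf
    cases i with
    | zero => exact absurd hrx.1 hs.2.1.2
    | succ i =>
      refine ⟨(stp M)^[i] s, mem_stripFin.2 ⟨i, by omega, rfl⟩, ?_⟩
      change tl p u (diag M _) = _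
      rw [Function.iterate_succ_apply', stp, rev_rev, hM.diag_opp (hs.2.2.1 i (by omega))]
  · have ho := hM.sideDart_opp hside
    have hd : diag M (rev x) = diag M (opp M ((stp M)^[i] s)) := by
      rw [hM.diag_opp hside]; exact (h.tl_diag_eq_iff.1 h1).symm
    have hro := hM.eq_of_diag_of_snd ho hrx hd (by
      rw [hM.snd_opp hside, hdir, ← hxk]; rfl)
    have hxs : x = (stp M)^[i + 1] s := by
      rw [Function.iterate_succ_apply', stp, ← hro, rev_rev]
    refine ⟨x, mem_stripFin.2 ⟨i + 1, ?_, hxs.symm⟩, rfl⟩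
    by_contra hn
    obtain rfl : i + 1 = n := by omega
    exact hs.iterate_not_side (hxs ▸ hx)

omit h in
theorem shareDir_succ (hM : IsDiag M) {s : LDart} {n i : ℕ} (hs : IsStrip M s n) (hi : i + 1 < n) :
    ShareDir p u M s.2 (tl p u (diag M ((stp M)^[i] s))) (tl p u (diag M ((stp M)^[i + 1] s))) := by
  have h0 := hs.2.2.1 i (by omega)
  refine ⟨(stp M)^[i + 1] s, hM.snd_iterate_stp fun l hl => hs.2.2.1 l (by omega),
    hs.2.2.1 _ hi, ?_, Or.inr ⟨rfl, ?_⟩⟩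
  · rw [Function.iterate_succ_apply', stp, rev_rev]
    exact hM.sideDart_opp h0
  · rw [Function.iterate_succ_apply', stp, rev_rev, hM.diag_opp h0]

/-- The component of a tile of a strip consists of the tiles of the strip. -/
theorem image_supp_eq (hM : IsDiag M) {s : LDart} {n : ℕ} (hs : IsStrip M s n) {k : Fin 6}
    (hk : k = s.2 ∨ k = s.2 + 3) {A : Set ℂ} (hA : A ∈ stripTiles p u M s n)
    (c : ((parallelGraph (dirC u k)).induce (T : Set (Set ℂ))).ConnectedComponent)
    (hc : ∃ hT : A ∈ (T : Set (Set ℂ)), (⟨A, hT⟩ : (T : Set (Set ℂ))) ∈ c.supp) :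
    Subtype.val '' c.supp = stripTiles p u M s n := by
  have hkinv : dirC u k = dirC u s.2 ∨ dirC u k = dirC u (s.2 + 3) := by
    rcases hk with rfl | rfl <;> simp
  have hsub := h.stripTiles_subset hM hs
  have hadj : ∀ B C : (T : Set (Set ℂ)), ((parallelGraph (dirC u k)).induce (T : Set (Set ℂ))).Adj
      B C → ShareDir p u M s.2 B C := by
    intro B C hBC
    obtain ⟨l, hl, hs'⟩ := (h.parallel_iff hM B.2 C.2).1 (SimpleGraph.comap_adj.1 hBC)
    obtain rfl := dirC_injective h.norm hl
    rcases hk with rfl | rfl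
    · exact hs'
    · exact hs'.of_add_three
  have hadj' : ∀ B C : (T : Set (Set ℂ)), ShareDir p u M s.2 B C →
      ((parallelGraph (dirC u k)).induce (T : Set (Set ℂ))).Adj B C := by
    intro B C hBC
    refine SimpleGraph.comap_adj.2 ((h.parallel_iff hM B.2 C.2).2 ⟨k, rfl, ?_⟩)
    rcases hk with rfl | rfl
    · exact hBC
    · apply ShareDir.of_add_three
      rw [add_assoc]
      change ShareDir p u M (s.2 + 0) B C
      rwa [add_zero]
  have hclosed : ∀ B C : (T : Set (Set ℂ)),
      ((parallelGraph (dirC u k)).induce (T : Set (Set ℂ))).Reachable B C →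
      (B : Set ℂ) ∈ stripTiles p u M s n → (C : Set ℂ) ∈ stripTiles p u M s n := by
    intro B C hBC hB
    rw [SimpleGraph.reachable_iff_reflTransGen] at hBC
    induction hBC with
    | refl => exact hB
    | tail _ hbc ih => exact h.mem_stripTiles_of_shareDir hM hs ih (hadj _ _ hbc)
  have h0 : ∀ i (hi : i < n), ((parallelGraph (dirC u k)).induce (T : Set (Set ℂ))).Reachable
      ⟨_, hsub ⟨s, mem_stripFin.2 ⟨0, hs.1, rfl⟩, rfl⟩⟩
      ⟨_, hsub ⟨_, mem_stripFin.2 ⟨i, hi, rfl⟩, rfl⟩⟩ := by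
    intro i
    induction i with
    | zero => intro hi; exact .refl _
    | succ i ih =>
      intro hi
      exact (ih (by omega)).trans (hadj' _ _ (shareDir_succ hM hs hi)).reachable
  obtain ⟨hAT, hAc⟩ := hc
  rw [SimpleGraph.ConnectedComponent.mem_supp_iff] at hAc
  subst hAc
  ext B
  constructor
  · rintro ⟨B, hB, rfl⟩
    rw [SimpleGraph.ConnectedComponent.mem_supp_iff, SimpleGraph.ConnectedComponent.eq] at hB
    exact hclosed _ B hB.symm hA
  · intro hB
    refine ⟨⟨B, hsub hB⟩, ?_, rfl⟩
    rw [SimpleGraph.ConnectedComponent.mem_supp_iff, SimpleGraph.ConnectedComponent.eq]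
    obtain ⟨x, hx, rfl⟩ := hA
    obtain ⟨y, hy, rfl⟩ := hB
    obtain ⟨i, hi, rfl⟩ := mem_stripFin.1 hx
    obtain ⟨j, hj, rfl⟩ := mem_stripFin.1 hy
    exact (h0 j hj).symm.trans (h0 i hi)

theorem ncard_stripTiles (hM : IsDiag M) {s : LDart} {n : ℕ} (hs : IsStrip M s n) :
    (stripTiles p u M s n).ncard = n := by
  rw [stripTiles, Set.InjOn.ncard_image, Set.ncard_coe_finset, card_stripFin hM hs]
  intro x hx y hy hxy
  obtain ⟨i, hi, rfl⟩ := mem_stripFin.1 hx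
  obtain ⟨j, hj, rfl⟩ := mem_stripFin.1 hy
  refine hM.eq_of_diag_of_snd (hs.2.2.1 j hj) (hs.2.2.1 i hi) (h.tl_diag_eq_iff.1 hxy) ?_
  rw [hM.snd_iterate_stp fun l hl => hs.2.2.1 l (by omega),
    hM.snd_iterate_stp fun l hl => hs.2.2.1 l (by omega)]

theorem isRun_stripTiles (hM : IsDiag M) {s : LDart} {n : ℕ} (hs : IsStrip M s n) (hn : n ≠ 1) :
    IsRun T (stripTiles p u M s n) := by
  have hcard := h.ncard_stripTiles hM hs
  have hpos := hs.1
  refine ⟨?_, dirC u s.2, SimpleGraph.connectedComponentMk _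
    ⟨_, h.stripTiles_subset hM hs ⟨s, mem_stripFin.2 ⟨0, hs.1, rfl⟩, rfl⟩⟩, ?_⟩
  · have hfin : (stripTiles p u M s n).Finite := (Finset.finite_toSet _).image _
    have := hfin.to_subtype
    exact Set.one_lt_ncard_iff_nontrivial.1 (by omega)
  · exact (h.image_supp_eq hM hs (Or.inl rfl) ⟨s, mem_stripFin.2 ⟨0, hs.1, rfl⟩, rfl⟩ _
      ⟨h.stripTiles_subset hM hs ⟨s, mem_stripFin.2 ⟨0, hs.1, rfl⟩, rfl⟩, rfl⟩).symm

theorem isPatch (hT : IsDokuTiling κ T) : IsPatch κ M where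
  toIsDiag := h.isDiag hT
  nonempty := h.nonempty hT
  exists_other := h.exists_other hT
  covConn := h.covConn hT
  uncovConn := h.uncovConn hT
  removeConn := h.removeConn hT
  length _ _ hs hn := by
    rw [← h.ncard_stripTiles (h.isDiag hT) hs]
    exact hT.run_length _ (h.isRun_stripTiles (h.isDiag hT) hs hn)

/-- A run has two tiles, so it contains an adjacent pair; the strip through their common side is the
whole component. Of the two senses of traversal, the one with direction below 3 is taken. -/
theorem exists_eq_stripTiles (hT : IsDokuTiling κ T) (hκ : κ ≠ 1) {R : Set (Set ℂ)}
    (hR : IsRun T R) : ∃ s, Bd M s ∧ ¬ Single M s ∧ s.2 < 3 ∧ R = stripTiles p u M s κ := by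
  have hM := h.isDiag hT
  have hlen := hT.run_length R hR
  obtain ⟨⟨A, hA, B, hB, hne⟩, v, c, rfl⟩ := hR
  obtain ⟨A, hA, rfl⟩ := hA
  obtain ⟨B, hB, rfl⟩ := hB
  have hr : ((parallelGraph v).induce (T : Set (Set ℂ))).Reachable A B := by
    rw [SimpleGraph.ConnectedComponent.mem_supp_iff] at hA hB
    exact SimpleGraph.ConnectedComponent.eq.1 (hA.trans hB.symm)
  rw [SimpleGraph.reachable_iff_reflTransGen] at hr
  obtain ⟨C, hAC⟩ : ∃ C, ((parallelGraph v).induce (T : Set (Set ℂ))).Adj A C := by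
    rcases hr.cases_head with rfl | ⟨C, hC, -⟩
    exacts [absurd rfl hne, ⟨C, hC⟩]
  obtain ⟨k, rfl, hsd⟩ := (h.parallel_iff hM A.2 C.2).1 (SimpleGraph.comap_adj.1 hAC)
  obtain ⟨l, hl, hkl, hsd⟩ : ∃ l : Fin 6, l < 3 ∧ (k = l ∨ k = l + 3) ∧
      ShareDir p u M l (A : Set ℂ) C := by
    have key : ∀ k : Fin 6, k < 3 ∨ (k + 3 < 3 ∧ k + 3 + 3 = k) := by decide
    rcases key k with hk | ⟨hk, hk'⟩
    · exact ⟨k, hk, Or.inl rfl, hsd⟩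
    · refine ⟨k + 3, hk, Or.inr hk'.symm, ShareDir.of_add_three ?_⟩
      rwa [hk']
  obtain ⟨x, rfl, hx, hrx, hxd⟩ := id hsd
  obtain ⟨s, n, hs, hxs⟩ := hM.exists_mem_stripFin hx
  have hs2 : x.2 = s.2 := by
    obtain ⟨i, hi, rfl⟩ := mem_stripFin.1 hxs
    exact hM.snd_iterate_stp fun l hl => hs.2.2.1 l (by omega)
  have hAS : (A : Set ℂ) ∈ stripTiles p u M s n := by
    rcases hxd with ⟨h1, -⟩ | ⟨h1, -⟩
    · exact ⟨x, hxs, h1.symm⟩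
    · exact h.mem_stripTiles_of_shareDir hM hs ⟨x, hxs, h1.symm⟩ (hs2 ▸ hsd.symm)
  have himg := h.image_supp_eq hM hs (hs2 ▸ hkl) hAS c ⟨A.2, hA⟩
  rw [himg, h.ncard_stripTiles hM hs] at hlen
  subst hlen
  refine ⟨s, hs.2.1, fun h1 => hκ (hs.length_unique (isStrip_one hM h1)), hs2 ▸ hl, himg⟩

/-- Two long strips with the same tiles coincide: if parallel, they share an entrance side;
otherwise they would have two common tiles, against `cross_unique`. -/
theorem numRuns_eq (hT : IsDokuTiling κ T) (hκ : 2 ≤ κ) : numRuns T = numLong M := by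
  have hP := h.isPatch hT
  have hM := hP.toIsDiag
  have hmem : ∀ s, s ∈ longFin M 0 ∪ longFin M 1 ∪ longFin M 2 ↔
      Bd M s ∧ ¬ Single M s ∧ s.2 < 3 := by
    intro s
    have key : ∀ k : Fin 6, k < 3 ↔ ((k = 0 ∨ k = 1) ∨ k = 2) := by decide
    rw [Finset.mem_union, Finset.mem_union, mem_longFin, mem_longFin, mem_longFin, key]
    tauto
  have hset : {R : Set (Set ℂ) | IsRun T R} = (fun s => stripTiles p u M s κ) ''
      ((longFin M 0 ∪ longFin M 1 ∪ longFin M 2 : Finset LDart) : Set LDart) := by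
    ext R
    constructor
    · intro hR
      obtain ⟨s, h1, h2, h3, rfl⟩ := h.exists_eq_stripTiles hT (by omega) hR
      exact ⟨s, (hmem s).2 ⟨h1, h2, h3⟩, rfl⟩
    · rintro ⟨s, hs, rfl⟩
      obtain ⟨h1, h2, -⟩ := (hmem s).1 hs
      exact h.isRun_stripTiles hM (hP.isStrip_long h1 h2) (by omega)
  have hinj : Set.InjOn (fun s => stripTiles p u M s κ)
      ((longFin M 0 ∪ longFin M 1 ∪ longFin M 2 : Finset LDart) : Set LDart) := by
    intro s hs t ht hst
    obtain ⟨s1, s2, s3⟩ := (hmem s).1 hs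
    obtain ⟨t1, t2, t3⟩ := (hmem t).1 ht
    have hS := hP.isStrip_long s1 s2
    have hS' := hP.isStrip_long t1 t2
    change stripTiles p u M s κ = stripTiles p u M t κ at hst
    have hmeet : ∀ x ∈ stripFin M s κ, ∃ y ∈ stripFin M t κ, diag M y = diag M x := by
      intro x hx
      have hx' : tl p u (diag M x) ∈ stripTiles p u M t κ := hst ▸ ⟨x, hx, rfl⟩
      obtain ⟨y, hy, hyx⟩ := hx'
      exact ⟨y, hy, h.tl_diag_eq_iff.1 hyx⟩
    have m0 : s ∈ stripFin M s κ := mem_stripFin.2 ⟨0, by omega, rfl⟩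
    have m1 : stp M s ∈ stripFin M s κ := mem_stripFin.2 ⟨1, by omega, rfl⟩
    obtain ⟨y, hy, hyx⟩ := hmeet s m0
    by_cases hd : s.2 = t.2
    · obtain ⟨j, hj, rfl⟩ := mem_stripFin.1 hy
      have := hM.eq_of_diag_of_snd (hS.2.2.1 0 (by omega)) (hS'.2.2.1 j hj) hyx (by
        rw [hM.snd_iterate_stp fun l hl => hS'.2.2.1 l (by omega)]; exact hd.symm)
      rw [this] at hy
      exact hS.eq_start hM hS' m0 hy
    · exfalso
      obtain ⟨y', hy', hyx'⟩ := hmeet _ m1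
      have hyy := hP.cross_unique hS hS' s3 t3 hd m0 m1 hy hy' hyx hyx'
      rw [← hyy, hyx] at hyx'
      have hs0 := hM.sideDart_of_bd s1
      have hs1 : SideDart M (stp M s) := hS.2.2.1 1 (by omega)
      exact hM.stp_ne_bd hs0 s1 (hM.eq_of_diag_of_snd hs0 hs1 hyx'.symm (hM.snd_stp hs0))
  rw [numRuns, hset, hinj.ncard_image, Set.ncard_coe_finset, numLong,
    Finset.card_union_of_disjoint, Finset.card_union_of_disjoint]
  · rw [Finset.disjoint_left]
    intro s h1 h2
    rw [mem_longFin] at h1 h2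
    have := h1.2.2.symm.trans h2.2.2
    revert this; decide
  · rw [Finset.disjoint_left]
    intro s h1 h2
    rw [Finset.mem_union, mem_longFin, mem_longFin] at h1
    rw [mem_longFin] at h2
    have h3 : s.2 = 0 ∨ s.2 = 1 := h1.imp (·.2.2) (·.2.2)
    rw [h2.2.2] at h3
    revert h3; decide

end Represents

end KDoku

theorem theorem3 (κ τ ρ : ℕ) (hκ : 5 ≤ κ) (T : Finset (Set ℂ))
    (hT : KDoku.IsDokuTiling κ T) (hτ : T.card = τ) (hρ : KDoku.numRuns T = ρ) :
    max ⌈3 * ((κ : ℝ) ^ 2 - 1) / 4⌉ ⌈(κ : ℝ) * (ρ : ℝ) / 2⌉ ≤ (τ : ℤ) ∧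
      (τ : ℤ) ≤ ⌊(((κ : ℝ) + 1) * (ρ : ℝ) + 3) / 2⌋ := by
  obtain ⟨p, u, M, h⟩ := KDoku.exists_represents hT
  obtain ⟨h1, h2, h3⟩ := (h.isPatch hT).bounds hκ
  rw [h.card_tiles hT, hτ, ← h.numRuns_eq hT (by omega), hρ] at h1 h2
  rw [h.card_tiles hT, hτ] at h3
  have h1 : 2 * (τ : ℝ) ≤ (κ + 1) * ρ + 3 := by exact_mod_cast h1
  have h2 : (κ : ℝ) * ρ ≤ 2 * τ := by exact_mod_cast h2
  have h3 : 3 * (κ : ℝ) ^ 2 ≤ 4 * τ + 3 := by exact_mod_cast h3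
  refine ⟨max_le (Int.ceil_le.2 ?_) (Int.ceil_le.2 ?_), Int.le_floor.2 ?_⟩ <;> push_cast <;>
    linarith
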